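/- Let $(G,c)$ be an electrical network, i.e. a connected, locally finite, simple graph $G=(V,E)$ with a function $c\colon E\to(0,\infty)$. Its network random walk moves from $x$ to a neighbour $y$ with probability $c\{x,y\}/\sum_{z\sim x}c\{x,z\}$. Suppose that the network is transient (the network random walk does not return to its starting point with probability one), and let $r\in V$. Write $\vec E(G)=\{(x,y):\{x,y\}\in E\}$ for the set of oriented edges. **Loop erasure.** The loop erasure of a walk $\langle x_i\rangle_{i\le\tau}$, $\tau\in\mathbb N\cup\{\infty\}$, that visits every vertex finitely often is the path $\langle y_0,y_1,\dots\rangle$ with $y_0=x_0$ and, if $j$ is the last index with $x_j=y_i$, $y_{i+1}=x_{j+1}$ when $j<\tau$, the path ending at $y_i$ when $j=\tau$. **Wilson's method rooted at $r$.** Let $x_1,x_2,\dots$ be an enumeration of $V\setminus\{r\}$ (each vertex appearing exactly once), and take independent network random walks $X^0,X^1,X^2,\dots$ started at $r,x_1,x_2,\dots$. Let $\langle y_0,y_1,\dots\rangle$ be the loop erasure of $X^0$; $\vec F(0)$ has the vertices $y_i$ and the oriented edges $(y_{i+1},y_i)$, $i\ge0$. Given $\vec F(i)$, stop $X^{i+1}$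 when it first hits a vertex of $\vec F(i)$ (let it run forever if it never does), let $\langle y'_0,y'_1,\dots\rangle$ be the loop erasure of the stopped walk, and obtain $\vec F(i+1)$ from $\vec F(i)$ by adding the vertices $y'_k$ and the oriented edges $(y'_k,y'_{k+1})$. The output is the set $\vec F\subseteq\vec E(G)$ of all oriented edges of $\bigcup_i\vec F(i)$. **Wired exhaustions.** A wired exhaustion is given by finite, non-empty $W_0\subseteq W_1\subseteq\cdots\subseteq V$ that induce connected subgraphs, with $\bigcup_nW_n=V$. The network $(G_n,c_n)$ is obtained by identifying all vertices outside $W_n$ to a single vertex $z_n$, removing loops and extra multiple edges, with $c_n\{x,y\}=c\{x,y\}$ for edges inside $W_n$ and $c_n\{x,z_n\}=\sum_{y\notin W_n,\,y\sim x}c\{x,y\}$. Let $\vec\mu_{r,n}$ be the law of the random $r$-oriented spanning tree $\vec T_n$ of $G_n$ (a set $\vec T$ of oriented edges such that from every vertex there is exactly one directed path in $\vec T$ to $r$) in which $\vec T$ has probability proportional to $\prod_{(x,y)\in\vec T}c_n\{x,y\}$. (Here $r$, and a set $\vec B\subseteq\vec E(G)$, stand for their images in $G_n$; for large $n$ these are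 unchanged.) **Theorem.** For every ordering of $V\setminus\{r\}$, almost surely each of the walks visits every vertex finitely often, so that the method is well defined almost surely, and $\vec F$ is a random (measurable) subset of $\vec E(G)$. For every ordering of $V\setminus\{r\}$, every finite $\vec B\subseteq\vec E(G)$ and every wired exhaustion of $G$, $$\mathbb P[\vec B\subseteq\vec F]=\lim_{n\to\infty}\vec\mu_{r,n}[\vec B\subseteq\vec T_n].$$ Consequently the $r$-oriented wired spanning forest exists and does not depend on the exhaustion: there is exactly one probability measure $\mu$ on the subsets of $\vec E(G)$, with the $\sigma$-algebra generated by the events $\{\vec H:\vec B\subseteq\vec H\}$, $\vec B$ finite, such that $\mu\{\vec H:\vec B\subseteq\vec H\}=\lim_{n\to\infty}\vec\mu_{r,n}[\vec B\subseteq\vec T_n]$ for every finite $\vec B\subseteq\vec E(G)$ and every wired exhaustion of $G$. -/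

import Mathlib

open MeasureTheory ProbabilityTheory Filter Topology

/-- An electrical network: a locally finite, simple, connected graph together with a positive
conductance on each unoriented edge, the conductance being extended by `0` to non-edges. -/
structure ElectricalNetwork (V : Type*) where
  graph : SimpleGraph V
  connected : graph.Connected
  finite_nbhd : ∀ x, (graph.neighborSet x).Finite
  cond : V → V → ℝ
  cond_symm : ∀ x y, cond x y = cond y x
  cond_pos : ∀ x y, graph.Adj x y → 0 < cond x y
  cond_eq_zero : ∀ x y, ¬ graph.Adj x y → cond x y = 0

/-- A subgraph with oriented edges, given by its vertices and its oriented edges. -/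
structure OrientedSubgraph (V : Type*) where
  verts : Set V
  edges : Set (V × V)

/-! ### Loop erasure

A (possibly infinite) walk is a sequence `x : ℕ → V` with a final time `τ : ℕ∞`: it consists of the
vertices `x i` with `i ≤ τ`. -/

section LoopErasure

variable {V : Type*}

/-- The first time at which `x` is in `S`; it is `⊤` if `x` never hits `S`. -/
noncomputable def hittingTimeOf (x : ℕ → V) (S : Set V) : ℕ∞ :=
  sInf ((fun i : ℕ => (i : ℕ∞)) '' {i | x i ∈ S})

/-- The last visit to `v` of the walk `x` with final time `τ` (for a vertex visited at least once
and at most finitely many times). -/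
noncomputable def lastVisit (x : ℕ → V) (τ : ℕ∞) (v : V) : ℕ :=
  sSup {j : ℕ | (j : ℕ∞) ≤ τ ∧ x j = v}

open Classical in
/-- The `i`-th vertex of the loop erasure of the walk `x` with final time `τ`; it is `none` if the
loop erasure has at most `i` vertices. -/
noncomputable def loopErasure (x : ℕ → V) (τ : ℕ∞) : ℕ → Option V
  | 0 => some (x 0)
  | i + 1 =>
    match loopErasure x τ i with
    | none => none
    | some v => if (lastVisit x τ v : ℕ∞) < τ then some (x (lastVisit x τ v + 1)) else none

/-- The vertices of the path `y`. -/
def pathVerts (y : ℕ → Option V) : Set V := {v | ∃ i, y i = some v}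

/-- The oriented edges of the path `y`. -/
def pathEdges (y : ℕ → Option V) : Set (V × V) :=
  {e | ∃ i, y i = some e.1 ∧ y (i + 1) = some e.2}

/-- The oriented edges of the reversal of the path `y`. -/
def reversedPathEdges (y : ℕ → Option V) : Set (V × V) :=
  {e | ∃ i, y i = some e.2 ∧ y (i + 1) = some e.1}

/-- The successive forests of Wilson's method in a transient network, driven by the walks
`X 0`, `X 1`, … (where `X 0` starts at the root, and `X (j + 1)` at the `j`-th other vertex). -/
noncomputable def wilsonStage (X : ℕ → ℕ → V) : ℕ → OrientedSubgraph V
  | 0 =>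
    { verts := pathVerts (loopErasure (X 0) ⊤)
      edges := reversedPathEdges (loopErasure (X 0) ⊤) }
  | i + 1 =>
    let F := wilsonStage X i
    let y := loopErasure (X (i + 1)) (hittingTimeOf (X (i + 1)) F.verts)
    { verts := F.verts ∪ pathVerts y
      edges := F.edges ∪ pathEdges y }

end LoopErasure

namespace ElectricalNetwork

variable {V : Type*} (N : ElectricalNetwork V)

/-! ### The network random walk -/

/-- The finite set of neighbours of `x`. -/
noncomputable def nbhd (x : V) : Finset V := (N.finite_nbhd x).toFinset

theorem mem_nbhd {x y : V} : y ∈ N.nbhd x ↔ N.graph.Adj x y := by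
  simp [nbhd]

/-- The probability of a transition from `x` to `y`. -/
noncomputable def transProb (x y : V) : ℝ := N.cond x y / ∑ z ∈ N.nbhd x, N.cond x z

theorem sum_transProb {x : V} (h : (N.nbhd x).Nonempty) :
    ∑ y ∈ N.nbhd x, ENNReal.ofReal (N.transProb x y) = 1 := by
  have hpos : ∀ z ∈ N.nbhd x, 0 < N.cond x z := fun z hz => N.cond_pos x z (N.mem_nbhd.1 hz)
  have hs : 0 < ∑ z ∈ N.nbhd x, N.cond x z := Finset.sum_pos hpos h
  have hnn : ∀ z ∈ N.nbhd x, 0 ≤ N.transProb x z := fun z hz =>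
    div_nonneg (hpos z hz).le hs.le
  rw [← ENNReal.ofReal_sum_of_nonneg hnn]
  simp only [transProb]
  rw [← Finset.sum_div, div_self hs.ne', ENNReal.ofReal_one]

theorem transProb_eq_zero {x y : V} (h : y ∉ N.nbhd x) :
    ENNReal.ofReal (N.transProb x y) = 0 := by
  rw [transProb, N.cond_eq_zero x y (fun h' => h (N.mem_nbhd.2 h'))]
  simp

open Classical in
/-- The law of one step of the network random walk from `x`. (A vertex has no neighbour only if it
is the only vertex of the network; the walk then stays there.) -/
noncomputable def step (x : V) : PMF V :=
  if h : (N.nbhd x).Nonempty then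
    PMF.ofFinset (fun y => ENNReal.ofReal (N.transProb x y)) (N.nbhd x)
      (N.sum_transProb h) (fun _ hy => N.transProb_eq_zero hy)
  else PMF.pure x

section Walk

variable [MeasurableSpace V] [DiscreteMeasurableSpace V]

/-- The transition kernel of the network random walk. -/
noncomputable def stepKernel : Kernel V V where
  toFun x := (N.step x).toMeasure
  measurable' := Measurable.of_discrete

instance : IsMarkovKernel N.stepKernel :=
  ⟨fun x => PMF.toMeasure.isProbabilityMeasure (N.step x)⟩

/-- The law, on the space of trajectories, of the network random walk started at `x`. -/
noncomputable def walkLaw (x : V) : Measure (ℕ → V) :=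
  Kernel.trajMeasure (X := fun _ => V) (Measure.dirac x)
    (fun n => N.stepKernel.comap
      (fun h : (Π _ : Finset.Iic n, V) => h ⟨n, Finset.mem_Iic.2 le_rfl⟩)
      (measurable_pi_apply _))

instance (x : V) : IsProbabilityMeasure (N.walkLaw x) := by
  unfold walkLaw; infer_instance

/-- The network is recurrent if the network random walk almost surely returns to its starting
point. -/
def IsRecurrent : Prop := ∀ x, ∀ᵐ ω ∂N.walkLaw x, ∃ n, 1 ≤ n ∧ ω n = x

def IsTransient : Prop := ¬ N.IsRecurrent

/-! ### Wilson's method -/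

/-- The starting vertices of the walks: the root, then the other vertices in the given order. -/
def wilsonStart (r : V) (ord : ℕ ≃ {v : V // v ≠ r}) : ℕ → V
  | 0 => r
  | j + 1 => ord j

/-- The joint law of the independent network random walks used in Wilson's method. -/
noncomputable def wilsonLaw (r : V) (ord : ℕ ≃ {v : V // v ≠ r}) : Measure (ℕ → ℕ → V) :=
  Measure.infinitePi (fun j => N.walkLaw (wilsonStart r ord j))

end Walk

/-- The output of Wilson's method driven by the walks `X`, as a set of oriented edges. -/
def wilsonForest (X : ℕ → ℕ → V) : Set N.graph.Dart :=
  {d | ∃ i, d.toProd ∈ (wilsonStage X i).edges}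

/-! ### Oriented spanning trees of a finite network -/

/-- `T` is an `r`-oriented spanning tree: from each vertex there is exactly one directed path (a
sequence of vertices, consecutive ones being joined by an oriented edge of `T`) to `r`. -/
def IsOrientedSpanningTree (r : V) (T : Finset N.graph.Dart) : Prop :=
  ∀ x, ∃! l : List V, l.head? = some x ∧ l.getLast? = some r ∧
    l.IsChain (fun a b => ∃ d ∈ T, d.toProd = (a, b))

/-- The weight of an oriented subgraph. -/
noncomputable def weight (T : Finset N.graph.Dart) : ℝ := ∏ d ∈ T, N.cond d.fst d.snd

/-- The probability of the event `A` for the random `r`-oriented spanning tree of a finite network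
in which each tree is picked with probability proportional to its weight. -/
noncomputable def treeProb (r : V) (A : Set (Finset N.graph.Dart)) : ℝ :=
  (∑ᶠ T ∈ {T | N.IsOrientedSpanningTree r T ∧ T ∈ A}, N.weight T) /
    ∑ᶠ T ∈ {T | N.IsOrientedSpanningTree r T}, N.weight T

/-! ### Wired exhaustions -/

open Classical in
/-- The identification of all the vertices outside `W` to a single vertex `none`. -/
noncomputable def wireFun (W : Finset V) (x : V) : Option V := if x ∈ W then some x else none

/-- The vertices of the wired network: those of `W`, and `none` if `W` does not contain all
vertices. -/
def WiredVertex (W : Finset V) : Type _ := {a : Option V // ∃ x, wireFun W x = a}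

/-- The vertex of the wired network that `x` becomes. -/
noncomputable def wire (W : Finset V) (x : V) : WiredVertex W := ⟨wireFun W x, x, rfl⟩

instance (W : Finset V) : Finite (WiredVertex W) := by
  classical
  refine Set.Finite.to_subtype (s := {a : Option V | ∃ x, wireFun W x = a})
    (Set.Finite.subset (Finset.finite_toSet (insert none (W.image some))) ?_)
  rintro a ⟨x, rfl⟩
  by_cases h : x ∈ W <;> simp [wireFun, h]

open Classical in
/-- The conductances of the wired network. -/
noncomputable def wiredCond (W : Finset V) : Option V → Option V → ℝ
  | some x, some y => N.cond x y
  | some x, none => ∑ y ∈ N.nbhd x with y ∉ W, N.cond x y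
  | none, some y => ∑ x ∈ N.nbhd y with x ∉ W, N.cond y x
  | none, none => 0

/-- The graph obtained by identifying the vertices outside `W`, and removing the loops and the
extra multiple edges. -/
def wiredGraph (W : Finset V) : SimpleGraph (WiredVertex W) where
  Adj a b := a ≠ b ∧ ∃ x y, N.graph.Adj x y ∧ wire W x = a ∧ wire W y = b
  symm := ⟨fun _ _ ⟨h, x, y, hxy, hx, hy⟩ => ⟨h.symm, y, x, hxy.symm, hy, hx⟩⟩
  loopless := ⟨fun _ h => h.1 rfl⟩

theorem wire_surjective (W : Finset V) : Function.Surjective (wire W) := by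
  rintro ⟨_, x, rfl⟩
  exact ⟨x, rfl⟩

theorem wiredGraph_connected (W : Finset V) : (N.wiredGraph W).Connected := by
  have key : ∀ x y : V, N.graph.Reachable x y →
      (N.wiredGraph W).Reachable (wire W x) (wire W y) := by
    rintro x y ⟨p⟩
    induction p with
    | nil => exact SimpleGraph.Reachable.refl _
    | @cons u v w h p ih =>
      by_cases huv : wire W u = wire W v
      · rw [huv]; exact ih
      · exact (SimpleGraph.Adj.reachable
          (show (N.wiredGraph W).Adj _ _ from ⟨huv, u, v, h, rfl, rfl⟩)).trans ih
  have : Nonempty (WiredVertex W) := N.connected.nonempty.map (wire W)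
  refine SimpleGraph.Connected.mk ?_
  intro a b
  obtain ⟨x, rfl⟩ := wire_surjective W a
  obtain ⟨y, rfl⟩ := wire_surjective W b
  exact key x y (N.connected.preconnected x y)

theorem wiredCond_symm (W : Finset V) (a b : Option V) :
    N.wiredCond W a b = N.wiredCond W b a := by
  cases a <;> cases b <;> simp [wiredCond, N.cond_symm]

theorem wiredCond_pos (W : Finset V) (a b : WiredVertex W) (h : (N.wiredGraph W).Adj a b) :
    0 < N.wiredCond W a.1 b.1 := by
  classical
  have out : ∀ x y, N.graph.Adj x y → y ∉ W → 0 < N.wiredCond W (some x) none := by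
    intro x y hxy hy
    refine Finset.sum_pos (fun z hz => N.cond_pos x z ?_) ⟨y, ?_⟩
    · exact N.mem_nbhd.1 (Finset.mem_filter.1 hz).1
    · exact Finset.mem_filter.2 ⟨N.mem_nbhd.2 hxy, hy⟩
  obtain ⟨hne, x, y, hxy, rfl, rfl⟩ := h
  by_cases hx : x ∈ W <;> by_cases hy : y ∈ W
  · simpa [wire, wireFun, hx, hy, wiredCond] using N.cond_pos x y hxy
  · simpa [wire, wireFun, hx, hy] using out x y hxy hy
  · rw [N.wiredCond_symm]
    simpa [wire, wireFun, hx, hy] using out y x hxy.symm hx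
  · exact absurd (Subtype.ext (by simp [wire, wireFun, hx, hy])) hne

theorem wiredCond_eq_zero (W : Finset V) (a b : WiredVertex W)
    (h : ¬ (N.wiredGraph W).Adj a b) : N.wiredCond W a.1 b.1 = 0 := by
  classical
  have out : ∀ x y, x ∈ W → y ∉ W → ¬ (N.wiredGraph W).Adj (wire W x) (wire W y) →
      N.wiredCond W (some x) none = 0 := by
    intro x y hx hy h'
    refine Finset.sum_eq_zero (fun z hz => ?_)
    obtain ⟨hz, hzW⟩ := Finset.mem_filter.1 hz
    refine absurd ⟨fun e => ?_, x, z, N.mem_nbhd.1 hz, rfl, ?_⟩ h'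
    · simpa [wire, wireFun, hx, hy] using congrArg Subtype.val e
    · exact Subtype.ext (by simp [wire, wireFun, hzW, hy])
  obtain ⟨x, rfl⟩ := wire_surjective W a
  obtain ⟨y, rfl⟩ := wire_surjective W b
  by_cases hx : x ∈ W <;> by_cases hy : y ∈ W
  · simp only [wire, wireFun, hx, hy, if_true, wiredCond]
    refine N.cond_eq_zero x y (fun hxy => h ⟨fun e => hxy.ne ?_, x, y, hxy, rfl, rfl⟩)
    simpa [wire, wireFun, hx, hy] using congrArg Subtype.val e
  · simpa [wire, wireFun, hx, hy] using out x y hx hy h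
  · rw [N.wiredCond_symm]
    simpa [wire, wireFun, hx, hy] using out y x hy hx (fun h' => h h'.symm)
  · simp [wire, wireFun, hx, hy, wiredCond]

/-- The electrical network obtained by wiring the vertices outside `W`. -/
noncomputable def wired (W : Finset V) : ElectricalNetwork (WiredVertex W) where
  graph := N.wiredGraph W
  connected := N.wiredGraph_connected W
  finite_nbhd _ := Set.toFinite _
  cond a b := N.wiredCond W a.1 b.1
  cond_symm a b := N.wiredCond_symm W a.1 b.1
  cond_pos := N.wiredCond_pos W
  cond_eq_zero := N.wiredCond_eq_zero W

/-- A sequence of finite connected vertex sets that defines a wired exhaustion. -/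
structure Exhaustion where
  W : ℕ → Finset V
  connected : ∀ n, (N.graph.induce (W n : Set V)).Connected
  mono : ∀ n, W n ⊆ W (n + 1)
  cover : ∀ x, ∃ n, x ∈ W n

/-- The probability that the random `r`-oriented spanning tree of the network wired outside `W`
contains all the edges in `B`. (An edge of `B`, and the root, stand for their images under the
identification.) -/
noncomputable def wiredTreeProb (W : Finset V) (r : V) (B : Finset N.graph.Dart) : ℝ :=
  (N.wired W).treeProb (wire W r)
    {T | ∀ d ∈ B, ∃ t ∈ T, t.toProd = (wire W d.fst, wire W d.snd)}

/-- `μ` is an `r`-oriented wired spanning forest: a probability distribution on the sets of oriented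
edges such that, for any wired exhaustion and any finite `B`, the probability that `B` is contained
in the random set is the limit of the corresponding probabilities for the wired networks. The
`σ`-algebra is Mathlib's on the type of sets, generated by the events that `d` belongs to the random
set, for `d` an oriented edge. -/
def IsOrientedWSF (r : V) (μ : Measure (Set N.graph.Dart)) : Prop :=
  IsProbabilityMeasure μ ∧
    ∀ (E : N.Exhaustion) (B : Finset N.graph.Dart),
      Tendsto (fun n => N.wiredTreeProb (E.W n) r B) atTop
        (𝓝 (μ.real {H | (B : Set N.graph.Dart) ⊆ H}))

end ElectricalNetwork

/-! Wilson's algorithm is run on all wired networks at once, with the walks of the infinite network.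
For a finite `W`, each walk is also stopped on leaving `W` (`stoppedStage` with `K = Wᶜ`). Until
then it cannot be told from a walk on the wired network, so that after identification of the outside
to one vertex `z` the stages are those of Wilson's method there, with one twist: the first walk goes
from the root `r` to `z`, and its loop erasure is reversed (`stoppedStage_comp`).

That this samples the weighted spanning tree is a computation with determinants. Let `P` be the
transition matrix and `P.killed A` the matrix with the rows in `A` set to `0`. Splitting a walk at
the last visit to its starting point, and using Cramer's rule for the expected number of such
visits, one finds that the loop erasure of a walk stopped on `A` is the path `l` with probability
`P.pathProd l * det (1 - P.killed (A ∪ l)) / det (1 - P.killed A)` (`walkLaw_erasesTo`). A given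
tree dictates the path of each walk, and each walk is stopped on what the earlier ones have covered.
So the determinants telescope, and only `det (1 - P.killed {z})`, which does not depend on the tree,
is left. Multiplication by the total conductances at the vertices other than `z` turns transition
probabilities into conductances; by their symmetry the first path may be reversed, and the weight of
the tree appears (`IsRootedAt.prod_pathProd`, `IsTransient.wiredTreeProb_eq`).

For the limit, transience makes the Green function finite, hence almost surely each walk visits each
vertex finitely often. Last visits, loop erasures and stages of the stopped method then agree
locally, for large `W`, with those of the method itself (`eventually_stoppedStage_iff`). A vertex
that is in the forest never receives an outgoing edge at a later stage, so the event that the finite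
set `B` is covered is decided at a stage that does not depend on `W`
(`mem_edges_of_mem_later_stage`), and bounded convergence applies. The law of the output is thus a
wired spanning forest; it is the only one because the events `B ⊆ H` form a generating π-system and
the balls around `r` form an exhaustion. -/

/-- The time shift of trajectories. -/
def timeShift {α : Type*} (n : ℕ) (x : ℕ → α) : ℕ → α := fun i => x (n + i)

theorem measurable_timeShift {α : Type*} [MeasurableSpace α] (n : ℕ) :
    Measurable (timeShift n : (ℕ → α) → ℕ → α) :=
  measurable_pi_lambda _ fun _ => measurable_pi_apply _

/-! ### Measures on sequence space -/

section Trajectories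

variable {V : Type*} [MeasurableSpace V] [DiscreteMeasurableSpace V] [Countable V]

/-- A finite measure on sequences in a countable set is determined by the probabilities of the
initial segments. -/
theorem MeasureTheory.Measure.ext_of_initialSegment {μ ν : Measure (ℕ → V)} [IsFiniteMeasure μ]
    [IsFiniteMeasure ν]
    (h : ∀ (n : ℕ) (a : ℕ → V), μ {ω | ∀ i ≤ n, ω i = a i} = ν {ω | ∀ i ≤ n, ω i = a i}) :
    μ = ν := by
  have h1 : ∀ n, μ.map (Preorder.frestrictLe n) = ν.map (Preorder.frestrictLe (π := fun _ => V) n) := by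
    intro n
    refine Measure.ext_of_singleton fun b => ?_
    rw [Measure.map_apply (by fun_prop) (measurableSet_singleton _),
      Measure.map_apply (by fun_prop) (measurableSet_singleton _)]
    have : (Preorder.frestrictLe n : (ℕ → V) → _) ⁻¹' {b} =
        {ω | ∀ i ≤ n, ω i = if hi : i ≤ n then b ⟨i, Finset.mem_Iic.2 hi⟩ else ω i} := by
      ext ω
      simp only [Set.mem_preimage, Set.mem_singleton_iff, Set.mem_ofPred_eq]
      constructor
      · rintro rfl i hi
        simp [hi]
      · intro h
        ext ⟨i, hi⟩
        have := h i (Finset.mem_Iic.1 hi)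
        rw [dif_pos (Finset.mem_Iic.1 hi)] at this
        exact this
    rw [this]
    -- The values after time `n` play no role; a fixed sequence `ξ` in place of `ω` brings the event
    -- to the form in the hypothesis.
    have key : ∀ ξ : ℕ → V,
        {ω : ℕ → V | ∀ i ≤ n, ω i = if hi : i ≤ n then b ⟨i, Finset.mem_Iic.2 hi⟩ else ω i}
        = {ω | ∀ i ≤ n, ω i = if hi : i ≤ n then b ⟨i, Finset.mem_Iic.2 hi⟩ else ξ i} := by
      intro ξ
      ext ω
      refine forall₂_congr fun i hi => ?_
      simp [hi]
    by_cases hV : Nonempty (ℕ → V)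
    · obtain ⟨ξ⟩ := hV
      rw [key ξ]
      exact h n _
    · have := not_nonempty_iff.1 hV
      simp [Set.eq_empty_of_isEmpty]
  refine IsProjectiveLimit.unique (P := fun I => ν.map I.restrict) ?_ (fun I => rfl)
  intro I
  have hI : I ⊆ Finset.Iic (I.sup id) := fun i hi => Finset.mem_Iic.2 (Finset.le_sup (f := id) hi)
  have e : (I.restrict : (ℕ → V) → _) =
    Finset.restrict₂ (π := fun _ => V) hI ∘ Preorder.frestrictLe (I.sup id) := rfl
  rw [e, ← Measure.map_map (by fun_prop) (by fun_prop), h1,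
    Measure.map_map (by fun_prop) (by fun_prop)]
  rfl

end Trajectories

namespace ElectricalNetwork

/-! ### Balls in the graph: an exhaustion, and countability of the vertex set -/

section Balls

variable {V : Type*} (N : ElectricalNetwork V)

theorem finite_setOf_dist_le (r : V) (n : ℕ) : {v | N.graph.dist r v ≤ n}.Finite := by
  induction n with
  | zero =>
    refine (Set.finite_singleton r).subset fun v hv => ?_
    have := N.connected.dist_eq_zero_iff.1 (Nat.le_zero.1 hv)
    exact this.symm
  | succ n ih =>
    refine (ih.union (ih.biUnion fun u _ => N.finite_nbhd u)).subset fun v hv => ?_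
    by_cases h : N.graph.dist r v ≤ n
    · exact Or.inl h
    right
    obtain ⟨p, hp⟩ := N.connected.exists_walk_length_eq_dist v r
    cases p with
    | nil => simp at h
    | @cons _ u _ huv q =>
      refine Set.mem_biUnion (x := u) ?_ huv.symm
      have h1 := SimpleGraph.dist_le q
      rw [SimpleGraph.Walk.length_cons, SimpleGraph.dist_comm] at hp
      rw [SimpleGraph.dist_comm] at h1
      have : N.graph.dist r v ≤ n + 1 := hv
      show N.graph.dist r u ≤ n
      omega

/-- A geodesic from a vertex of the ball to the centre stays in the ball. -/
theorem connected_induce_dist_le (r : V) (n : ℕ) :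
    (N.graph.induce {v | N.graph.dist r v ≤ n}).Connected := by
  have key : ∀ m, ∀ v, (hv : N.graph.dist r v ≤ n) → N.graph.dist r v = m →
      (N.graph.induce {v | N.graph.dist r v ≤ n}).Reachable ⟨r, by simp⟩ ⟨v, hv⟩ := by
    intro m
    induction m with
    | zero =>
      intro v hv h
      have := N.connected.dist_eq_zero_iff.1 h
      subst this
      exact SimpleGraph.Reachable.refl _
    | succ m ih =>
      intro v hv h
      obtain ⟨p, hp⟩ := N.connected.exists_walk_length_eq_dist v r
      cases p with
      | nil => simp at h
      | @cons _ u _ huv q =>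
        have h1 := SimpleGraph.dist_le q
        rw [SimpleGraph.Walk.length_cons, SimpleGraph.dist_comm] at hp
        rw [SimpleGraph.dist_comm] at h1
        have h2 := N.connected.dist_triangle (u := r) (v := u) (w := v)
        rw [SimpleGraph.dist_eq_one_iff_adj.2 huv.symm] at h2
        refine (ih u (by omega) (by omega)).trans (SimpleGraph.Adj.reachable ?_)
        exact huv.symm
  have : Nonempty {v | N.graph.dist r v ≤ n} := ⟨⟨r, by simp⟩⟩
  refine SimpleGraph.Connected.mk fun a b => ?_
  exact (key _ a.1 a.2 rfl).symm.trans (key _ b.1 b.2 rfl)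

/-- The exhaustion by the balls around a vertex. -/
noncomputable def ballExhaustion (r : V) : N.Exhaustion where
  W n := (N.finite_setOf_dist_le r n).toFinset
  connected n := by
    have := N.connected_induce_dist_le r n
    rwa [← (N.finite_setOf_dist_le r n).coe_toFinset] at this
  mono n := by
    intro v hv
    rw [Set.Finite.mem_toFinset] at hv ⊢
    exact Nat.le_succ_of_le hv
  cover x := ⟨N.graph.dist r x, by rw [Set.Finite.mem_toFinset]; simp⟩

theorem countable_vertices {V : Type*} (N : ElectricalNetwork V) : Countable V := by
  obtain ⟨r⟩ := N.connected.nonempty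
  rw [← Set.countable_univ_iff]
  refine (Set.countable_iUnion (t := fun n : ℕ => {v | N.graph.dist r v ≤ n})
    fun n => (N.finite_setOf_dist_le r n).countable).mono fun v _ => ?_
  exact Set.mem_iUnion.2 ⟨N.graph.dist r v, by simp⟩

end Balls

/-! ### The Markov property of the network random walk -/

section Markov

variable {V : Type*} (N : ElectricalNetwork V)
variable [MeasurableSpace V] [DiscreteMeasurableSpace V]

theorem walkLaw_zero (x y : V) : N.walkLaw x {ω | ω 0 = y} = Set.indicator {y} 1 x := by
  have h : (N.walkLaw x).map (fun ω => ω 0) = Measure.dirac x := by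
    unfold walkLaw Kernel.trajMeasure
    have e : (fun ω : ℕ → V => ω 0) = (fun b : (Finset.Iic 0 → V) => b ⟨0, by simp⟩) ∘
      Preorder.frestrictLe (π := fun _ => V) 0 := rfl
    rw [e, ← Measure.map_map (by fun_prop) (by fun_prop), Measure.map_comp _ _ (by fun_prop),
      Kernel.traj_map_frestrictLe, Kernel.partialTraj_self, Measure.id_comp,
      Measure.map_map (by fun_prop) (by fun_prop)]
    exact Measure.map_id
  have := congrArg (fun μ => μ {y}) h
  beta_reduce at this
  rw [Measure.map_apply (by fun_prop) (measurableSet_singleton _),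
    Measure.dirac_apply' _ (measurableSet_singleton _)] at this
  exact this

/-- The disintegration of the trajectory measure at time `n`, evaluated on a product of singletons.
Together with the law at time `0` it is all that is used of the construction of `walkLaw`. -/
theorem walkLaw_initialSegment_succ (x : V) (n : ℕ) (a : ℕ → V) :
    N.walkLaw x {ω | ∀ i ≤ n + 1, ω i = a i} =
      N.walkLaw x {ω | ∀ i ≤ n, ω i = a i} * N.step (a n) (a (n + 1)) := by
  have : Countable V := N.countable_vertices
  have h := Kernel.map_frestrictLe_trajMeasure_compProd_eq_map_trajMeasure (X := fun _ => V)
    (μ₀ := Measure.dirac x) (κ := fun n => N.stepKernel.comap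
      (fun h : (Π _ : Finset.Iic n, V) => h ⟨n, Finset.mem_Iic.2 le_rfl⟩)
      (measurable_pi_apply _)) (a := n)
  have h' := congrArg (fun μ => μ ({fun i : Finset.Iic n => a i} ×ˢ {a (n + 1)})) h
  beta_reduce at h'
  rw [Measure.compProd_apply_prod (measurableSet_singleton _) (measurableSet_singleton _),
    Measure.map_apply (by fun_prop)
    ((measurableSet_singleton _).prod (measurableSet_singleton _)), lintegral_singleton,
    Measure.map_apply (by fun_prop) (measurableSet_singleton _)] at h'
  have e0 : (Preorder.frestrictLe n : (ℕ → V) → _) ⁻¹' {fun i : Finset.Iic n => a i} =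
      {ω | ∀ i ≤ n, ω i = a i} := by
    ext ω
    simp only [Set.mem_preimage, Set.mem_singleton_iff, Set.mem_ofPred_eq]
    constructor
    · intro h i hi
      exact congrFun h ⟨i, Finset.mem_Iic.2 hi⟩
    · intro h
      ext ⟨i, hi⟩
      exact h i (Finset.mem_Iic.1 hi)
  have e1 : (fun ω : ℕ → V => (Preorder.frestrictLe (π := fun _ => V) n ω, ω (n + 1))) ⁻¹'
      ({fun i : Finset.Iic n => a i} ×ˢ {a (n + 1)}) = {ω | ∀ i ≤ n + 1, ω i = a i} := by
    have : (fun ω : ℕ → V => (Preorder.frestrictLe (π := fun _ => V) n ω, ω (n + 1))) ⁻¹'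
      ({fun i : Finset.Iic n => a i} ×ˢ {a (n + 1)}) =
      ((Preorder.frestrictLe n : (ℕ → V) → _) ⁻¹' {fun i : Finset.Iic n => a i}) ∩
        {ω | ω (n + 1) = a (n + 1)} := rfl
    rw [this, e0]
    ext ω
    simp only [Set.mem_inter_iff, Set.mem_ofPred_eq]
    constructor
    · rintro ⟨h1, h2⟩ i hi
      rcases Nat.le_succ_iff.1 hi with hi | rfl
      exacts [h1 i hi, h2]
    · intro h
      exact ⟨fun i hi => h i (by omega), h _ le_rfl⟩
  have e2 : (N.stepKernel.comap
      (fun h : (Π _ : Finset.Iic n, V) => h ⟨n, Finset.mem_Iic.2 le_rfl⟩)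
      (measurable_pi_apply _)) (fun i : Finset.Iic n => a i) {a (n + 1)} =
        N.step (a n) (a (n + 1)) := by
    rw [Kernel.comap_apply]
    exact PMF.toMeasure_apply_singleton _ _ (measurableSet_singleton _)
  rw [e1] at h'
  erw [e0] at h'
  rw [mul_comm, ← e2]
  exact h'.symm

theorem ae_walkLaw_zero (x : V) : ∀ᵐ ω ∂N.walkLaw x, ω 0 = x := by
  have h : N.walkLaw x {ω | ω 0 = x} = 1 := by rw [walkLaw_zero]; simp
  have hm : MeasurableSet {ω : ℕ → V | ω 0 = x} :=
    measurable_pi_apply (X := fun _ : ℕ => V) 0 (measurableSet_singleton x)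
  exact (prob_compl_eq_zero_iff hm).2 h

/-- The construction splits off the last transition, the Markov property at time `1` the first one.
Both sides are the same product of transition probabilities, by induction on its length. -/
theorem walkLaw_initialSegment_shift (x : V) (n : ℕ) (a : ℕ → V) :
    N.walkLaw x {ω | ∀ i ≤ n, ω (1 + i) = a i} =
      N.step x (a 0) * N.walkLaw (a 0) {ω | ∀ i ≤ n, ω i = a i} := by
  have hc : ∀ n, N.walkLaw x {ω | ∀ i ≤ n + 1, ω i = Nat.casesOn i x a} =
      N.step x (a 0) * N.walkLaw (a 0) {ω | ∀ i ≤ n, ω i = a i} := by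
    intro n
    induction n with
    | zero =>
      rw [N.walkLaw_initialSegment_succ x 0 (fun i => Nat.casesOn i x a)]
      simp only [Nat.le_zero, forall_eq, walkLaw_zero]
      simp
    | succ n ih =>
      rw [N.walkLaw_initialSegment_succ x (n + 1) (fun i => Nat.casesOn i x a), ih,
        N.walkLaw_initialSegment_succ (a 0) n a, mul_assoc]
  rw [← hc n]
  refine measure_congr ?_
  filter_upwards [N.ae_walkLaw_zero x] with ω hω
  refine propext ⟨fun h i hi => ?_, fun h i hi => ?_⟩
  · cases i with
    | zero => exact hω
    | succ i => exact (congrArg ω (add_comm i 1)).trans (h i (by omega))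
  · exact (congrArg ω (add_comm 1 i)).trans (h (i + 1) (by omega))

theorem map_shift_walkLaw (x : V) :
    (N.walkLaw x).map (timeShift 1) = Measure.sum fun y => N.step x y • N.walkLaw y := by
  have : Countable V := N.countable_vertices
  have hfin : IsFiniteMeasure (Measure.sum fun y => N.step x y • N.walkLaw y) := by
    refine ⟨?_⟩
    rw [Measure.sum_apply _ MeasurableSet.univ]
    simp [PMF.tsum_coe]
  have : IsProbabilityMeasure ((N.walkLaw x).map (timeShift 1)) :=
    Measure.isProbabilityMeasure_map (measurable_timeShift 1).aemeasurable
  refine Measure.ext_of_initialSegment fun n a => ?_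
  have hm : MeasurableSet {ω : ℕ → V | ∀ i ≤ n, ω i = a i} := by
    have : {ω : ℕ → V | ∀ i ≤ n, ω i = a i} = ⋂ i, ⋂ (_ : i ≤ n), {ω | ω i = a i} := by
      ext; simp
    rw [this]
    exact MeasurableSet.iInter fun i => MeasurableSet.iInter fun _ =>
      measurable_pi_apply (X := fun _ : ℕ => V) i (measurableSet_singleton (a i))
  rw [Measure.map_apply (measurable_timeShift 1) hm, Measure.sum_apply _ hm]
  refine (N.walkLaw_initialSegment_shift x n a).trans ?_
  rw [tsum_eq_single (a 0)]
  · rfl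
  · intro y hy
    rw [Measure.smul_apply, smul_eq_mul]
    refine mul_eq_zero_of_right _ (measure_mono_null (t := {ω | ω 0 = a 0})
      (fun ω hω => hω 0 (Nat.zero_le _)) ?_)
    rw [walkLaw_zero]
    simp [hy]

/-- The Markov property at time `1`. -/
theorem walkLaw_firstStep (x : V) (S : Set V) {B : Set (ℕ → V)} (hB : MeasurableSet B) :
    N.walkLaw x {ω | ω 0 ∈ S ∧ timeShift 1 ω ∈ B} =
      S.indicator (fun x => ∑' y, N.step x y * N.walkLaw y B) x := by
  by_cases hx : x ∈ S
  · have : N.walkLaw x {ω | ω 0 ∈ S ∧ timeShift 1 ω ∈ B} = N.walkLaw x (timeShift 1 ⁻¹' B) := by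
      refine measure_congr ?_
      filter_upwards [N.ae_walkLaw_zero x] with ω hω
      refine propext ⟨fun h => h.2, fun h => ⟨?_, h⟩⟩
      rw [hω]; exact hx
    rw [this, ← Measure.map_apply (measurable_timeShift 1) hB, map_shift_walkLaw,
      Measure.sum_apply _ hB, Set.indicator_of_mem hx]
    rfl
  · rw [Set.indicator_of_notMem hx]
    refine measure_eq_zero_iff_ae_notMem.2 ?_
    filter_upwards [N.ae_walkLaw_zero x] with ω hω h
    exact hx (hω ▸ h.1)

/-- The probability that the walk from `x` stays in `S` before the time `n`, at which it is in
`y`. -/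
noncomputable def killedProb (S : Set V) (n : ℕ) (x y : V) : ENNReal :=
  N.walkLaw x {ω | (∀ i < n, ω i ∈ S) ∧ ω n = y}

theorem measurableSet_walk_mem (n : ℕ) (S : Set V) : MeasurableSet {ω : ℕ → V | ω n ∈ S} :=
  (measurable_pi_apply n) (MeasurableSet.of_discrete (s := S))

theorem measurableSet_killed (S : Set V) (n : ℕ) :
    MeasurableSet {ω : ℕ → V | ∀ i < n, ω i ∈ S} := by
  have : {ω : ℕ → V | ∀ i < n, ω i ∈ S} = ⋂ i, ⋂ (_ : i < n), {ω | ω i ∈ S} := by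
    ext; simp
  rw [this]
  exact MeasurableSet.iInter fun i => MeasurableSet.iInter fun _ => measurableSet_walk_mem i S

theorem killedProb_zero (S : Set V) (x y : V) :
    N.killedProb S 0 x y = Set.indicator {y} 1 x := by
  rw [← N.walkLaw_zero]; simp [killedProb]

theorem killed_succ_iff {V : Type*} (S : Set V) (n : ℕ) (ω : ℕ → V) :
    (∀ i < n + 1, ω i ∈ S) ↔ ω 0 ∈ S ∧ ∀ i < n, timeShift 1 ω i ∈ S := by
  constructor
  · exact fun h => ⟨h 0 (by omega), fun i hi => h (1 + i) (by omega)⟩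
  · rintro ⟨h0, h⟩ i hi
    cases i with
    | zero => exact h0
    | succ i => rw [add_comm]; exact h i (by omega)

/-- The recursion in the first step; it is compared below with that of the powers of a killed
matrix. -/
theorem killedProb_succ (S : Set V) (n : ℕ) (x y : V) :
    N.killedProb S (n + 1) x y =
      S.indicator (fun x => ∑' v, N.step x v * N.killedProb S n v y) x := by
  rw [killedProb]
  change _ = S.indicator (fun x => ∑' v, N.step x v * N.walkLaw v
    ({ω | ∀ i < n, ω i ∈ S} ∩ {ω | ω n ∈ ({y} : Set V)})) x
  rw [← N.walkLaw_firstStep x S ((measurableSet_killed S n).inter (measurableSet_walk_mem n {y}))]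
  congr 1
  ext ω
  have : ω (n + 1) = timeShift 1 ω n := by rw [timeShift, add_comm]
  simp only [Set.mem_ofPred_eq, killed_succ_iff, this, and_assoc, Set.mem_inter_iff,
    Set.mem_singleton_iff]

/-- The Markov property at time `n` for the killed walk. -/
theorem walkLaw_killed_markov (S : Set V) {B : Set (ℕ → V)} (hB : MeasurableSet B) (n : ℕ)
    (x y : V) :
    N.walkLaw x {ω | (∀ i < n, ω i ∈ S) ∧ ω n = y ∧ timeShift n ω ∈ B} =
      N.killedProb S n x y * N.walkLaw y B := by
  induction n generalizing x with
  | zero =>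
    rw [killedProb_zero]
    by_cases h : x = y
    · subst h
      have : N.walkLaw x {ω | (∀ i < 0, ω i ∈ S) ∧ ω 0 = x ∧ timeShift 0 ω ∈ B} = N.walkLaw x B := by
        refine measure_congr ?_
        filter_upwards [N.ae_walkLaw_zero x] with ω hω
        have e : timeShift 0 ω = ω := by ext i; simp [timeShift]
        refine propext ⟨fun h => ?_, fun h => ⟨by simp, hω, ?_⟩⟩
        · rw [← e]; exact h.2.2
        · rw [e]; exact h
      rw [this]
      simp
    · have : Set.indicator {y} (1 : V → ENNReal) x = 0 := by simp [h]
      rw [this, zero_mul]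
      refine measure_eq_zero_iff_ae_notMem.2 ?_
      filter_upwards [N.ae_walkLaw_zero x] with ω hω h'
      exact h (hω ▸ h'.2.1)
  | succ n ih =>
    have hm : MeasurableSet {ω : ℕ → V | (∀ i < n, ω i ∈ S) ∧ ω n = y ∧ timeShift n ω ∈ B} :=
      (measurableSet_killed S n).inter ((measurableSet_walk_mem n {y}).inter
        (measurable_timeShift n hB))
    have := N.walkLaw_firstStep x S hm
    simp only [ih] at this
    rw [killedProb_succ]
    have e : {ω : ℕ → V | (∀ i < n + 1, ω i ∈ S) ∧ ω (n + 1) = y ∧ timeShift (n + 1) ω ∈ B} =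
        {ω | ω 0 ∈ S ∧ timeShift 1 ω ∈
          {ω : ℕ → V | (∀ i < n, ω i ∈ S) ∧ ω n = y ∧ timeShift n ω ∈ B}} := by
      ext ω
      have h1 : ω (n + 1) = timeShift 1 ω n := by rw [timeShift, add_comm]
      have h2 : timeShift (n + 1) ω = timeShift n (timeShift 1 ω) := by
        ext i; simp only [timeShift]; congr 1; omega
      simp only [Set.mem_ofPred_eq, killed_succ_iff, h1, h2, and_assoc]
    rw [e, this]
    by_cases hx : x ∈ S
    · simp only [Set.indicator_of_mem hx, ← ENNReal.tsum_mul_right, mul_assoc]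
    · simp only [Set.indicator_of_notMem hx, zero_mul]

end Markov

end ElectricalNetwork

namespace ElectricalNetwork

/-! ### Finiteness of the Green function -/

section Transience

variable {V : Type*} (N : ElectricalNetwork V)

theorem step_pos {x y : V} (h : N.graph.Adj x y) : N.step x y ≠ 0 := by
  have hne : (N.nbhd x).Nonempty := ⟨y, N.mem_nbhd.2 h⟩
  rw [step, dif_pos hne, PMF.ofFinset_apply, Ne, ENNReal.ofReal_eq_zero, not_le]
  exact div_pos (N.cond_pos x y h)
    (Finset.sum_pos (fun z hz => N.cond_pos x z (N.mem_nbhd.1 hz)) hne)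

variable [MeasurableSpace V] [DiscreteMeasurableSpace V]

/-- The expected number of visits to `y` of the walk from `x`. -/
noncomputable def green (x y : V) : ENNReal := ∑' n, N.walkLaw x {ω | ω n = y}

theorem killedProb_univ (n : ℕ) (x y : V) :
    N.killedProb Set.univ n x y = N.walkLaw x {ω | ω n = y} := by
  simp [killedProb]

theorem measurableSet_walk_eq (n : ℕ) (y : V) : MeasurableSet {ω : ℕ → V | ω n = y} :=
  measurableSet_walk_mem n {y}

/-- A walk from `x` has a positive chance to step to `v` first, and then makes the visits of a walk
from `v`. -/
theorem green_ne_top_of_adj_left {x v y : V} (h : N.graph.Adj x v) (hx : N.green x y ≠ ⊤) :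
    N.green v y ≠ ⊤ := by
  have h1 : N.step x v * N.green v y ≤ N.green x y := by
    rw [green, green, ← ENNReal.tsum_mul_left]
    refine le_trans (ENNReal.tsum_le_tsum fun n => ?_)
      (ENNReal.tsum_comp_le_tsum_of_injective (add_left_injective 1) _)
    rw [← killedProb_univ, ← killedProb_univ, killedProb_succ, Set.indicator_of_mem (Set.mem_univ _)]
    exact ENNReal.le_tsum v
  intro htop
  rw [htop, ENNReal.mul_top (N.step_pos h)] at h1
  exact hx (top_le_iff.1 h1)

/-- Each visit to `y` is followed with a fixed positive probability by a visit to `v`. -/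
theorem green_ne_top_of_adj_right {x y v : V} (h : N.graph.Adj y v) (hx : N.green x v ≠ ⊤) :
    N.green x y ≠ ⊤ := by
  have h1 : N.green x y * N.step y v ≤ N.green x v := by
    rw [green, green, ← ENNReal.tsum_mul_right]
    refine le_trans (ENNReal.tsum_le_tsum fun n => ?_)
      (ENNReal.tsum_comp_le_tsum_of_injective (add_left_injective 1) _)
    have h2 := N.walkLaw_killed_markov Set.univ (measurableSet_walk_eq 1 v) n x y
    have h3 : N.walkLaw y {ω | ω 1 = v} = N.step y v := by
      rw [← killedProb_univ, killedProb_succ, Set.indicator_of_mem (Set.mem_univ _),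
        tsum_eq_single v]
      · simp [killedProb_zero]
      · intro w hw
        simp [killedProb_zero, hw]
    rw [killedProb_univ, h3] at h2
    rw [← h2]
    exact measure_mono fun ω hω => hω.2.2
  intro htop
  rw [htop, ENNReal.top_mul (N.step_pos h)] at h1
  exact hx (top_le_iff.1 h1)

/-- The events that the last visit to `x` is at time `n` are disjoint, and by the Markov property
their probabilities are those of being in `x` at time `n` times that of never returning. Since they
sum to at most `1` and the last factor is positive, the Green function is finite. -/
theorem exists_green_self_ne_top (hN : N.IsTransient) : ∃ x, N.green x x ≠ ⊤ := by
  obtain ⟨x, hx⟩ := not_forall.1 hN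
  refine ⟨x, ?_⟩
  rw [ae_iff] at hx
  set R : Set (ℕ → V) := {ω | ¬∃ n, 1 ≤ n ∧ ω n = x} with hR
  have hRm : MeasurableSet R := by
    have : R = ⋂ n, ⋂ (_ : 1 ≤ n), {ω | ω n = x}ᶜ := by
      ext; simp [hR]
    rw [this]
    exact MeasurableSet.iInter fun n => MeasurableSet.iInter fun _ =>
      (measurableSet_walk_eq n x).compl
  have h1 : N.green x x * N.walkLaw x R ≤ 1 := by
    rw [green, ← ENNReal.tsum_mul_right]
    have h2 : ∀ n, N.walkLaw x {ω | ω n = x} * N.walkLaw x R =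
        N.walkLaw x {ω | ω n = x ∧ timeShift n ω ∈ R} := by
      intro n
      have := N.walkLaw_killed_markov Set.univ hRm n x x
      rw [killedProb_univ] at this
      rw [← this]
      simp
    simp_rw [h2]
    rw [← measure_iUnion]
    · exact prob_le_one
    · have key : ∀ m n ω, m < n → (ω n = x) → timeShift m ω ∈ R → False := by
        intro m n ω hmn hn hm
        exact hm ⟨n - m, by omega, by rw [timeShift, Nat.add_sub_cancel' hmn.le]; exact hn⟩
      intro m n hmn
      refine Set.disjoint_left.2 fun ω hm hn => ?_
      rcases lt_or_gt_of_ne hmn with h | h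
      · exact key m n ω h hn.1 hm.2
      · exact key n m ω h hm.1 hn.2
    · exact fun n => (measurableSet_walk_eq n x).inter (measurable_timeShift n hRm)
  intro htop
  rw [htop, ENNReal.top_mul hx] at h1
  exact absurd h1 (by simp)

theorem green_ne_top (hN : N.IsTransient) (x y : V) : N.green x y ≠ ⊤ := by
  obtain ⟨o, ho⟩ := N.exists_green_self_ne_top hN
  have h1 : N.green x o ≠ ⊤ := by
    obtain ⟨p⟩ := N.connected.preconnected x o
    induction p with
    | nil => exact ho
    | cons h p ih => exact N.green_ne_top_of_adj_left h.symm (ih ho)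
  obtain ⟨p⟩ := N.connected.preconnected y o
  induction p with
  | nil => exact h1
  | cons h p ih => exact N.green_ne_top_of_adj_right h (ih ho h1)

/-- Borel–Cantelli, the Green function being the sum of the probabilities. -/
theorem ae_finite_visits (hN : N.IsTransient) (x : V) :
    ∀ᵐ ω ∂N.walkLaw x, ∀ v, {i | ω i = v}.Finite := by
  have : Countable V := N.countable_vertices
  rw [ae_all_iff]
  intro v
  have h := measure_setOfPred_frequently_eq_zero (μ := N.walkLaw x)
    (p := fun n (ω : ℕ → V) => ω n = v) (N.green_ne_top hN x v)
  rw [ae_iff]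
  convert h using 2
  ext ω
  exact Nat.frequently_atTop_iff_infinite.symm

/-- Infinitely many times cannot be shared among finitely many vertices, each visited finitely
often. -/
theorem IsTransient.infinite {N : ElectricalNetwork V} (hN : N.IsTransient) : Infinite V := by
  obtain ⟨x⟩ := N.connected.nonempty
  by_contra hfin
  rw [not_infinite_iff_finite] at hfin
  obtain ⟨ω, hω⟩ := (N.ae_finite_visits hN x).exists
  have h : (⋃ v, {i | ω i = v}).Finite := Set.finite_iUnion hω
  have : (⋃ v, {i | ω i = v}) = Set.univ := by ext; simp
  rw [this] at h
  exact Set.infinite_univ h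

theorem IsTransient.nbhd_nonempty {N : ElectricalNetwork V} (hN : N.IsTransient) (x : V) :
    (N.nbhd x).Nonempty := by
  have := hN.infinite
  have := N.connected.preconnected.exists_adj_of_nontrivial x
  obtain ⟨y, hy⟩ := this
  exact ⟨y, N.mem_nbhd.2 hy⟩

theorem IsTransient.step_apply {N : ElectricalNetwork V} (hN : N.IsTransient) (x y : V) :
    N.step x y = ENNReal.ofReal (N.transProb x y) := by
  rw [step, dif_pos (hN.nbhd_nonempty x)]
  rfl

end Transience

end ElectricalNetwork

/-! ### Hitting times, last visits and the stages of the stopped method -/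

section LoopErasureFacts

variable {α : Type*}

theorem natCast_le_hittingTimeOf {x : ℕ → α} {S : Set α} {j : ℕ} :
    (j : ℕ∞) ≤ hittingTimeOf x S ↔ ∀ m < j, x m ∉ S := by
  rw [hittingTimeOf, le_sInf_iff]
  simp only [Set.forall_mem_image, Set.mem_ofPred_eq, Nat.cast_le]
  exact ⟨fun h m hm hx => absurd (h hx) (not_le.2 hm), fun h m hx => not_lt.1 fun hm => h m hm hx⟩

theorem natCast_lt_hittingTimeOf {x : ℕ → α} {S : Set α} {j : ℕ} :
    (j : ℕ∞) < hittingTimeOf x S ↔ ∀ m ≤ j, x m ∉ S := by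
  rw [← ENat.add_one_le_iff (ENat.natCast_ne_top j), ← Nat.cast_one, ← Nat.cast_add,
    natCast_le_hittingTimeOf]
  simp only [Nat.lt_succ_iff]

theorem hittingTimeOf_eq_natCast {x : ℕ → α} {S : Set α} {n : ℕ} :
    hittingTimeOf x S = n ↔ (∀ m < n, x m ∉ S) ∧ x n ∈ S := by
  have h : hittingTimeOf x S = n ↔ (n : ℕ∞) ≤ hittingTimeOf x S ∧ ¬ (n : ℕ∞) < hittingTimeOf x S := by
    rw [not_lt]
    exact ⟨fun h => ⟨h.ge, h.le⟩, fun h => le_antisymm h.2 h.1⟩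
  rw [h, natCast_le_hittingTimeOf, natCast_lt_hittingTimeOf]
  constructor
  · rintro ⟨h1, h2⟩
    refine ⟨h1, not_not.1 fun hn => h2 fun m hm => ?_⟩
    rcases hm.lt_or_eq with hm | rfl
    exacts [h1 m hm, hn]
  · rintro ⟨h1, h2⟩
    exact ⟨h1, fun h => h n le_rfl h2⟩

theorem hittingTimeOf_empty (x : ℕ → α) : hittingTimeOf x ∅ = ⊤ := by
  simp [hittingTimeOf]

/-- Each vertex is visited finitely often by the walk `x` with final time `τ`. -/
def FiniteVisits (x : ℕ → α) (τ : ℕ∞) : Prop := ∀ v, {j : ℕ | (j : ℕ∞) ≤ τ ∧ x j = v}.Finite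

theorem FiniteVisits.of_forall {x : ℕ → α} (h : ∀ v, {j | x j = v}.Finite) (τ : ℕ∞) :
    FiniteVisits x τ :=
  fun v => (h v).subset fun _ hj => hj.2

theorem finiteVisits_natCast (x : ℕ → α) (n : ℕ) : FiniteVisits x n :=
  fun _ => (Set.finite_Iic n).subset fun _ hj => Nat.cast_le.1 hj.1

theorem FiniteVisits.le_lastVisit {x : ℕ → α} {τ : ℕ∞} (h : FiniteVisits x τ) {j : ℕ}
    (hj : (j : ℕ∞) ≤ τ) : j ≤ lastVisit x τ (x j) :=
  le_csSup (h (x j)).bddAbove ⟨hj, rfl⟩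

theorem FiniteVisits.lastVisit_mem {x : ℕ → α} {τ : ℕ∞} (h : FiniteVisits x τ) {j : ℕ}
    (hj : (j : ℕ∞) ≤ τ) :
    (lastVisit x τ (x j) : ℕ∞) ≤ τ ∧ x (lastVisit x τ (x j)) = x j :=
  Nat.sSup_mem (s := {k : ℕ | (k : ℕ∞) ≤ τ ∧ x k = x j}) ⟨j, hj, rfl⟩ (h (x j)).bddAbove

theorem loopErasure_zero (x : ℕ → α) (τ : ℕ∞) : loopErasure x τ 0 = some (x 0) := rfl

theorem loopErasure_succ_of_eq_none {x : ℕ → α} {τ : ℕ∞} {i : ℕ} (h : loopErasure x τ i = none) :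
    loopErasure x τ (i + 1) = none := by
  rw [loopErasure, h]

open Classical in
theorem loopErasure_succ_of_eq_some {x : ℕ → α} {τ : ℕ∞} {i : ℕ} {v : α}
    (h : loopErasure x τ i = some v) :
    loopErasure x τ (i + 1) =
      if (lastVisit x τ v : ℕ∞) < τ then some (x (lastVisit x τ v + 1)) else none := by
  rw [loopErasure, h]

theorem loopErasure_succ_eq_some {x : ℕ → α} {τ : ℕ∞} {i : ℕ} {w : α}
    (h : loopErasure x τ (i + 1) = some w) :
    ∃ v, loopErasure x τ i = some v ∧ (lastVisit x τ v : ℕ∞) < τ ∧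
      w = x (lastVisit x τ v + 1) := by
  cases h' : loopErasure x τ i with
  | none => rw [loopErasure_succ_of_eq_none h'] at h; simp at h
  | some v =>
    rw [loopErasure_succ_of_eq_some h'] at h
    split_ifs at h with h2
    exact ⟨v, rfl, h2, (Option.some.inj h).symm⟩

/-- The last visits to the successive vertices of the loop erasure are at strictly increasing times,
whence the bound on `i`. It confines a given vertex to finitely many positions in the loop erasure.
-/
theorem FiniteVisits.loopErasure_spec {x : ℕ → α} {τ : ℕ∞} (h : FiniteVisits x τ) {i : ℕ} {v : α}
    (hi : loopErasure x τ i = some v) :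
    (lastVisit x τ v : ℕ∞) ≤ τ ∧ x (lastVisit x τ v) = v ∧ i ≤ lastVisit x τ v := by
  induction i generalizing v with
  | zero =>
    obtain rfl := Option.some.inj hi
    exact ⟨(h.lastVisit_mem (by simp)).1, (h.lastVisit_mem (by simp)).2, Nat.zero_le _⟩
  | succ i ih =>
    obtain ⟨u, hu, hlt, rfl⟩ := loopErasure_succ_eq_some hi
    have hle : ((lastVisit x τ u + 1 : ℕ) : ℕ∞) ≤ τ := by
      push_cast; exact Order.add_one_le_of_lt hlt
    have := h.le_lastVisit hle
    have := (ih hu).2.2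
    exact ⟨(h.lastVisit_mem hle).1, (h.lastVisit_mem hle).2, by omega⟩

/-- The successive forests of Wilson's method driven by the walks `X`, each walk being also stopped
when it hits `K`. -/
noncomputable def stoppedStage (K : Set α) (X : ℕ → ℕ → α) : ℕ → OrientedSubgraph α
  | 0 =>
    { verts := pathVerts (loopErasure (X 0) (hittingTimeOf (X 0) K))
      edges := reversedPathEdges (loopErasure (X 0) (hittingTimeOf (X 0) K)) }
  | i + 1 =>
    let F := stoppedStage K X i
    let y := loopErasure (X (i + 1)) (hittingTimeOf (X (i + 1)) (F.verts ∪ K))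
    { verts := F.verts ∪ pathVerts y
      edges := F.edges ∪ pathEdges y }

theorem stoppedStage_empty (X : ℕ → ℕ → α) (i : ℕ) : stoppedStage ∅ X i = wilsonStage X i := by
  induction i with
  | zero => simp only [stoppedStage, wilsonStage, hittingTimeOf_empty]
  | succ i ih => simp only [stoppedStage, wilsonStage, ih, Set.union_empty]

theorem stoppedStage_verts_mono (K : Set α) (X : ℕ → ℕ → α) :
    Monotone fun i => (stoppedStage K X i).verts :=
  monotone_nat_of_le_succ fun _ => Set.subset_union_left

theorem stoppedStage_edges_mono (K : Set α) (X : ℕ → ℕ → α) :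
    Monotone fun i => (stoppedStage K X i).edges :=
  monotone_nat_of_le_succ fun _ => Set.subset_union_left

theorem start_mem_stoppedStage (K : Set α) (X : ℕ → ℕ → α) (i : ℕ) :
    X i 0 ∈ (stoppedStage K X i).verts := by
  cases i with
  | zero => exact ⟨0, rfl⟩
  | succ i => exact Or.inr ⟨0, rfl⟩

/-- The tail of an edge of the loop erasure of a walk stopped on `S` is not in `S`. -/
theorem notMem_of_mem_pathEdges {x : ℕ → α} {S : Set α} (h : FiniteVisits x (hittingTimeOf x S))
    {e : α × α} (he : e ∈ pathEdges (loopErasure x (hittingTimeOf x S))) : e.1 ∉ S := by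
  obtain ⟨i, hi, hi1⟩ := he
  obtain ⟨v, hv, hlt, -⟩ := loopErasure_succ_eq_some hi1
  obtain rfl : e.1 = v := Option.some.inj (hi.symm.trans hv)
  have := natCast_lt_hittingTimeOf.1 hlt _ le_rfl
  rwa [(h.loopErasure_spec hi).2.1] at this

/-- The tails of the edges added later are new vertices, because a later walk is stopped as soon as
it hits the forest. -/
theorem mem_edges_of_mem_later_stage {K : Set α} {X : ℕ → ℕ → α}
    (hX : ∀ j S, FiniteVisits (X j) (hittingTimeOf (X j) (S ∪ K))) {i j : ℕ} (hij : i ≤ j)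
    {e : α × α} (he : e ∈ (stoppedStage K X j).edges)
    (hv : e.1 ∈ (stoppedStage K X i).verts) : e ∈ (stoppedStage K X i).edges := by
  induction j, hij using Nat.le_induction with
  | base => exact he
  | succ j hij ih =>
    rcases he with he | he
    · exact ih he
    · exact absurd (Or.inl (stoppedStage_verts_mono K X hij hv)) (notMem_of_mem_pathEdges (hX _ _) he)

end LoopErasureFacts

/-! ### Stability of loop erasure when the stopping sets converge pointwise -/

section Convergence

variable {α ι : Type*} {l : Filter ι} {x : ℕ → α}

/-- Only the finitely many positions of the walk before time `k` matter. The hitting time of `T` may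
be infinite, so truncated comparisons replace equality. -/
theorem eventually_le_hittingTimeOf_iff {S : ι → Set α} {T : Set α}
    (hS : ∀ v, ∀ᶠ n in l, (v ∈ S n ↔ v ∈ T)) (k : ℕ) :
    ∀ᶠ n in l, ∀ j ≤ k, ((j : ℕ∞) ≤ hittingTimeOf x (S n) ↔ (j : ℕ∞) ≤ hittingTimeOf x T) := by
  have h : ∀ᶠ n in l, ∀ m ∈ Set.Iic k, (x m ∈ S n ↔ x m ∈ T) :=
    (Filter.eventually_all_finite (Set.finite_Iic k)).2 fun m _ => hS (x m)
  filter_upwards [h] with n hn j hj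
  rw [natCast_le_hittingTimeOf, natCast_le_hittingTimeOf]
  refine forall₂_congr fun m hm => not_congr (hn m ?_)
  exact (hm.le.trans hj)

/-- All visits to `v` lie before some time, up to which the two hitting times cannot be told apart.
-/
theorem eventually_lastVisit_eq (hx : ∀ v, {i | x i = v}.Finite) {S : ι → Set α} {T : Set α}
    (hS : ∀ v, ∀ᶠ n in l, (v ∈ S n ↔ v ∈ T)) (v : α) :
    ∀ᶠ n in l, lastVisit x (hittingTimeOf x (S n)) v = lastVisit x (hittingTimeOf x T) v := by
  obtain ⟨k, hk⟩ := (hx v).bddAbove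
  filter_upwards [eventually_le_hittingTimeOf_iff hS k] with n hn
  unfold lastVisit
  congr 1
  ext j
  simp only [Set.mem_ofPred_eq]
  constructor
  · rintro ⟨h1, h2⟩; exact ⟨(hn j (hk h2)).1 h1, h2⟩
  · rintro ⟨h1, h2⟩; exact ⟨(hn j (hk h2)).2 h1, h2⟩

theorem eventually_loopErasure_eq (hx : ∀ v, {i | x i = v}.Finite) {S : ι → Set α} {T : Set α}
    (hS : ∀ v, ∀ᶠ n in l, (v ∈ S n ↔ v ∈ T)) (i : ℕ) :
    ∀ᶠ n in l, loopErasure x (hittingTimeOf x (S n)) i = loopErasure x (hittingTimeOf x T) i := by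
  classical
  induction i with
  | zero => exact Eventually.of_forall fun _ => rfl
  | succ i ih =>
    cases h : loopErasure x (hittingTimeOf x T) i with
    | none =>
      filter_upwards [ih] with n hn
      rw [loopErasure_succ_of_eq_none h, loopErasure_succ_of_eq_none (hn.trans h)]
    | some v =>
      filter_upwards [ih, eventually_lastVisit_eq hx hS v,
        eventually_le_hittingTimeOf_iff (x := x) hS (lastVisit x (hittingTimeOf x T) v + 1)]
        with n hn h1 h2
      -- The loop erasure goes on exactly if the walk makes one more step after the last visit,
      -- hence the comparison at `lastVisit + 1`.
      have h3 := h2 _ le_rfl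
      push_cast at h3
      rw [ENat.add_one_le_iff (ENat.natCast_ne_top _), ENat.add_one_le_iff (ENat.natCast_ne_top _)] at h3
      rw [loopErasure_succ_of_eq_some h, loopErasure_succ_of_eq_some (hn.trans h), h1]
      simp only [h3]

/-- Agreement holds at each index eventually; to have it for all `i` at once, note that `v` can only
occur at indices bounded by the time of its last visit. -/
theorem eventually_forall_le_loopErasure_eq (hx : ∀ v, {i | x i = v}.Finite) {S : ι → Set α}
    {T : Set α} (hS : ∀ v, ∀ᶠ n in l, (v ∈ S n ↔ v ∈ T)) (v : α) :
    ∀ᶠ n in l, ∀ i, (loopErasure x (hittingTimeOf x (S n)) i = some v ∨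
      loopErasure x (hittingTimeOf x T) i = some v) →
      loopErasure x (hittingTimeOf x (S n)) i = loopErasure x (hittingTimeOf x T) i ∧
      loopErasure x (hittingTimeOf x (S n)) (i + 1) =
        loopErasure x (hittingTimeOf x T) (i + 1) := by
  obtain ⟨k, hk⟩ := (hx v).bddAbove
  have h : ∀ᶠ n in l, ∀ i ∈ Set.Iic (k + 1),
      loopErasure x (hittingTimeOf x (S n)) i = loopErasure x (hittingTimeOf x T) i :=
    (Filter.eventually_all_finite (Set.finite_Iic (k + 1))).2 fun i _ =>
      eventually_loopErasure_eq hx hS i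
  filter_upwards [h] with n hn i hi
  have hle : ∀ τ, loopErasure x τ i = some v → i ≤ k := fun τ hτ =>
    ((FiniteVisits.of_forall hx τ).loopErasure_spec hτ).2.2.trans
      (hk ((FiniteVisits.of_forall hx τ).loopErasure_spec hτ).2.1)
  have hik : i ≤ k := hi.elim (hle _) (hle _)
  exact ⟨hn i (Set.mem_Iic.2 (by omega)), hn (i + 1) (Set.mem_Iic.2 (by omega))⟩

theorem eventually_mem_pathVerts_iff (hx : ∀ v, {i | x i = v}.Finite) {S : ι → Set α}
    {T : Set α} (hS : ∀ v, ∀ᶠ n in l, (v ∈ S n ↔ v ∈ T)) (v : α) :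
    ∀ᶠ n in l, (v ∈ pathVerts (loopErasure x (hittingTimeOf x (S n))) ↔
      v ∈ pathVerts (loopErasure x (hittingTimeOf x T))) := by
  filter_upwards [eventually_forall_le_loopErasure_eq hx hS v] with n hn
  refine exists_congr fun i => ⟨fun h => ?_, fun h => ?_⟩
  · rw [← (hn i (Or.inl h)).1]; exact h
  · rw [(hn i (Or.inr h)).1]; exact h

theorem eventually_mem_pathEdges_iff (hx : ∀ v, {i | x i = v}.Finite) {S : ι → Set α}
    {T : Set α} (hS : ∀ v, ∀ᶠ n in l, (v ∈ S n ↔ v ∈ T)) (e : α × α) :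
    ∀ᶠ n in l, (e ∈ pathEdges (loopErasure x (hittingTimeOf x (S n))) ↔
      e ∈ pathEdges (loopErasure x (hittingTimeOf x T))) := by
  filter_upwards [eventually_forall_le_loopErasure_eq hx hS e.1] with n hn
  refine exists_congr fun i => ⟨fun h => ?_, fun h => ?_⟩
  · rw [← (hn i (Or.inl h.1)).1, ← (hn i (Or.inl h.1)).2]; exact h
  · rw [(hn i (Or.inr h.1)).1, (hn i (Or.inr h.1)).2]; exact h

theorem mem_reversedPathEdges {y : ℕ → Option α} {e : α × α} :
    e ∈ reversedPathEdges y ↔ e.swap ∈ pathEdges y := Iff.rfl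

/-- If the sets `K n` decrease to the empty set, then the forests of Wilson's method with the walks
stopped on `K n` converge to those of Wilson's method. -/
theorem eventually_stoppedStage_iff {K : ι → Set α} (hK : ∀ v, ∀ᶠ n in l, v ∉ K n)
    {X : ℕ → ℕ → α} (hX : ∀ j v, {i | X j i = v}.Finite) (i : ℕ) :
    (∀ v, ∀ᶠ n in l, (v ∈ (stoppedStage (K n) X i).verts ↔ v ∈ (wilsonStage X i).verts)) ∧
    (∀ e, ∀ᶠ n in l, (e ∈ (stoppedStage (K n) X i).edges ↔ e ∈ (wilsonStage X i).edges)) := by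
  simp only [← stoppedStage_empty]
  induction i with
  | zero =>
    have h : ∀ v, ∀ᶠ n in l, (v ∈ K n ↔ v ∈ (∅ : Set α)) := fun v => by
      filter_upwards [hK v] with n hn; simp [hn]
    exact ⟨eventually_mem_pathVerts_iff (hX 0) h,
      fun e => eventually_mem_pathEdges_iff (hX 0) h e.swap⟩
  | succ i ih =>
    have h : ∀ v, ∀ᶠ n in l, (v ∈ (stoppedStage (K n) X i).verts ∪ K n ↔
        v ∈ (stoppedStage ∅ X i).verts ∪ ∅) := fun v => by
      filter_upwards [hK v, ih.1 v] with n hn h1; simp [hn, h1]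
    refine ⟨fun v => ?_, fun e => ?_⟩
    · filter_upwards [ih.1 v, eventually_mem_pathVerts_iff (hX (i + 1)) h v] with n h1 h2
      exact or_congr h1 h2
    · filter_upwards [ih.2 e, eventually_mem_pathEdges_iff (hX (i + 1)) h e] with n h1 h2
      exact or_congr h1 h2

end Convergence

/-! ### Identification of vertices -/

section Projection

variable {α β : Type*} {φ : α → β} {x : ℕ → α} {τ : ℕ∞}

theorem loopErasure_mem {i : ℕ} {v : α} (h : loopErasure x τ i = some v) :
    ∃ j : ℕ, (j : ℕ∞) ≤ τ ∧ x j = v := by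
  cases i with
  | zero => exact ⟨0, by simp, Option.some.inj h⟩
  | succ i =>
    obtain ⟨u, -, hlt, rfl⟩ := loopErasure_succ_eq_some h
    exact ⟨_, by push_cast; exact Order.add_one_le_of_lt hlt, rfl⟩

/-- Loop erasure only depends on which positions of the walk coincide, and `φ` creates no new
coincidences up to time `τ`. -/
theorem loopErasure_comp
    (h : ∀ j k : ℕ, (j : ℕ∞) ≤ τ → (k : ℕ∞) ≤ τ → φ (x j) = φ (x k) → x j = x k) (i : ℕ) :
    loopErasure (φ ∘ x) τ i = (loopErasure x τ i).map φ := by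
  classical
  induction i with
  | zero => rfl
  | succ i ih =>
    cases h' : loopErasure x τ i with
    | none =>
      rw [h'] at ih
      rw [loopErasure_succ_of_eq_none h', loopErasure_succ_of_eq_none ih]; rfl
    | some v =>
      rw [h'] at ih
      have hl : lastVisit (φ ∘ x) τ (φ v) = lastVisit x τ v := by
        obtain ⟨j, hj, rfl⟩ := loopErasure_mem h'
        unfold lastVisit
        congr 1
        ext k
        exact ⟨fun hk => ⟨hk.1, h k j hk.1 hj hk.2⟩, fun hk => ⟨hk.1, congrArg φ hk.2⟩⟩
      rw [loopErasure_succ_of_eq_some h', loopErasure_succ_of_eq_some ih, hl]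
      split_ifs <;> rfl

theorem pathVerts_map (y : ℕ → Option α) :
    pathVerts (fun i => (y i).map φ) = φ '' pathVerts y := by
  ext b
  simp only [pathVerts, Set.mem_ofPred_eq, Option.map_eq_some_iff, Set.mem_image]
  constructor
  · rintro ⟨i, v, h, rfl⟩; exact ⟨v, ⟨i, h⟩, rfl⟩
  · rintro ⟨v, ⟨i, h⟩, rfl⟩; exact ⟨i, v, h, rfl⟩

theorem pathEdges_map (y : ℕ → Option α) :
    pathEdges (fun i => (y i).map φ) = Prod.map φ φ '' pathEdges y := by
  ext b
  simp only [pathEdges, Set.mem_ofPred_eq, Option.map_eq_some_iff, Set.mem_image]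
  constructor
  · rintro ⟨i, ⟨v, h, h'⟩, w, h2, h2'⟩; exact ⟨(v, w), ⟨i, h, h2⟩, by ext <;> assumption⟩
  · rintro ⟨v, ⟨i, h, h'⟩, rfl⟩; exact ⟨i, ⟨_, h, rfl⟩, _, h', rfl⟩

theorem reversedPathEdges_map (y : ℕ → Option α) :
    reversedPathEdges (fun i => (y i).map φ) = Prod.map φ φ '' reversedPathEdges y := by
  ext b
  rw [mem_reversedPathEdges, pathEdges_map]
  constructor
  · rintro ⟨e, he, h⟩; exact ⟨e.swap, he, by rw [← Prod.swap_inj, ← h]; rfl⟩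
  · rintro ⟨e, he, rfl⟩; exact ⟨e.swap, he, rfl⟩

/-- Identifying the vertices of `K` to a single vertex commutes with Wilson's method in which the
walks are stopped on `K`. -/
theorem stoppedStage_comp {z : β} {K : Set α} (hz : ∀ v, φ v = z ↔ v ∈ K)
    (hφ : ∀ v w, v ∉ K → φ v = φ w → v = w) (X : ℕ → ℕ → α) (i : ℕ) :
    (stoppedStage {z} (fun j => φ ∘ X j) i).verts = φ '' (stoppedStage K X i).verts ∧
    (stoppedStage {z} (fun j => φ ∘ X j) i).edges =
      Prod.map φ φ '' (stoppedStage K X i).edges := by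
  have key : ∀ (x : ℕ → α) (S : Set α),
      hittingTimeOf (φ ∘ x) (φ '' S ∪ {z}) = hittingTimeOf x (S ∪ K) ∧
      loopErasure (φ ∘ x) (hittingTimeOf (φ ∘ x) (φ '' S ∪ {z})) =
        fun i => (loopErasure x (hittingTimeOf x (S ∪ K)) i).map φ := by
    intro x S
    have h1 : hittingTimeOf (φ ∘ x) (φ '' S ∪ {z}) = hittingTimeOf x (S ∪ K) := by
      unfold hittingTimeOf
      congr 2
      ext j
      simp only [Set.mem_ofPred_eq, Function.comp, Set.mem_union, Set.mem_singleton_iff, hz,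
        Set.mem_image]
      constructor
      · rintro (⟨v, hv, h⟩ | h)
        · by_cases hK : x j ∈ K
          · exact Or.inr hK
          · rw [hφ _ _ hK h.symm]; exact Or.inl hv
        · exact Or.inr h
      · rintro (h | h)
        · exact Or.inl ⟨_, h, rfl⟩
        · exact Or.inr h
    refine ⟨h1, ?_⟩
    rw [h1]
    ext1 i
    refine loopErasure_comp ?_ i
    intro j k hj hk hjk
    -- The stopped walk can be in `K` only at its final time, so two times at which it is in `K` are
    -- equal.
    by_cases hjK : x j ∈ K
    · have hkK : x k ∈ K := (hz _).1 (hjk ▸ (hz _).2 hjK)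
      have h2 : k ≤ j := not_lt.1 fun h => natCast_le_hittingTimeOf.1 hk j h (Or.inr hjK)
      have h3 : j ≤ k := not_lt.1 fun h => natCast_le_hittingTimeOf.1 hj k h (Or.inr hkK)
      rw [le_antisymm h2 h3]
    · exact hφ _ _ hjK hjk
  induction i with
  | zero =>
    have := (key (X 0) ∅).2
    simp only [Set.image_empty, Set.empty_union] at this
    simp only [stoppedStage, this]
    exact ⟨pathVerts_map _, reversedPathEdges_map _⟩
  | succ i ih =>
    have := (key (X (i + 1)) (stoppedStage K X i).verts).2
    simp only [stoppedStage, ih, this, Set.image_union]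
    exact ⟨by rw [pathVerts_map], by rw [pathEdges_map]⟩

end Projection

/-! ### Measurability of loop erasures and stages -/

section LoopErasureMeasurability

/-- Includes the default value `0` for an empty or unbounded set: measurability is needed for all
walks, also for those that visit a vertex infinitely often. The right side is made of countable
quantifiers. -/
theorem Nat.sSup_eq_iff {s : Set ℕ} {m : ℕ} :
    sSup s = m ↔ (m ∈ s ∧ ∀ j, j ∈ s → j ≤ m) ∨
      (m = 0 ∧ ((∀ j, j ∉ s) ∨ ∀ k, ∃ j, k < j ∧ j ∈ s)) := by
  by_cases hb : BddAbove s
  · rcases s.eq_empty_or_nonempty with rfl | hne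
    · simp [eq_comm]
    · constructor
      · rintro rfl
        exact Or.inl ⟨Nat.sSup_mem hne hb, fun j hj => le_csSup hb hj⟩
      · rintro (⟨h1, h2⟩ | ⟨-, h | h⟩)
        · exact le_antisymm (csSup_le hne h2) (le_csSup hb h1)
        · exact absurd hne.some_mem (h _)
        · obtain ⟨k, hk⟩ := hb
          obtain ⟨j, hj, hjs⟩ := h k
          exact absurd (hk hjs) (not_le.2 hj)
  · have h0 : sSup s = 0 := Nat.sSup_of_not_bddAbove hb
    rw [h0]
    constructor
    · rintro rfl
      refine Or.inr ⟨rfl, Or.inr fun k => ?_⟩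
      obtain ⟨j, hj, hk⟩ := not_bddAbove_iff.1 hb k
      exact ⟨j, hk, hj⟩
    · rintro (⟨-, h⟩ | ⟨h, -⟩)
      · exact absurd ⟨m, fun j hj => h j hj⟩ hb
      · exact h.symm

variable {Ω α : Type*} [MeasurableSpace Ω] [Countable α] {x : Ω → ℕ → α} {S : Ω → Set α}

theorem measurable_walk_mem (hx : ∀ n a, Measurable fun ω => x ω n = a)
    (hS : ∀ a, Measurable fun ω => a ∈ S ω) (n : ℕ) : Measurable fun ω => x ω n ∈ S ω := by
  have : (fun ω => x ω n ∈ S ω) = fun ω => ∃ a, x ω n = a ∧ a ∈ S ω := by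
    ext ω; simp
  rw [this]
  exact Measurable.exists fun a => (hx n a).and (hS a)

theorem measurable_natCast_le_hittingTimeOf (hx : ∀ n a, Measurable fun ω => x ω n = a)
    (hS : ∀ a, Measurable fun ω => a ∈ S ω) (j : ℕ) :
    Measurable fun ω => (j : ℕ∞) ≤ hittingTimeOf (x ω) (S ω) := by
  simp only [natCast_le_hittingTimeOf]
  exact Measurable.forall fun m => Measurable.forall fun _ => (measurable_walk_mem hx hS m).not

theorem measurable_lastVisit_eq (hx : ∀ n a, Measurable fun ω => x ω n = a)
    (hS : ∀ a, Measurable fun ω => a ∈ S ω) (v : α) (m : ℕ) :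
    Measurable fun ω => lastVisit (x ω) (hittingTimeOf (x ω) (S ω)) v = m := by
  simp only [lastVisit, Nat.sSup_eq_iff, Set.mem_ofPred_eq]
  have h : ∀ j : ℕ, Measurable fun ω => (j : ℕ∞) ≤ hittingTimeOf (x ω) (S ω) ∧ x ω j = v :=
    fun j => (measurable_natCast_le_hittingTimeOf hx hS j).and (hx j v)
  refine ((h m).and (Measurable.forall fun j => (h j).imp measurable_const)).or
    (measurable_const.and ((Measurable.forall fun j => (h j).not).or
      (Measurable.forall fun k => Measurable.exists fun j => measurable_const.and (h j))))

theorem measurable_loopErasure_eq_some (hx : ∀ n a, Measurable fun ω => x ω n = a)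
    (hS : ∀ a, Measurable fun ω => a ∈ S ω) (i : ℕ) (v : α) :
    Measurable fun ω => loopErasure (x ω) (hittingTimeOf (x ω) (S ω)) i = some v := by
  classical
  induction i generalizing v with
  | zero => simpa only [loopErasure_zero, Option.some.injEq] using hx 0 v
  | succ i ih =>
    have : (fun ω => loopErasure (x ω) (hittingTimeOf (x ω) (S ω)) (i + 1) = some v) =
        fun ω => ∃ u, loopErasure (x ω) (hittingTimeOf (x ω) (S ω)) i = some u ∧
          ∃ m, lastVisit (x ω) (hittingTimeOf (x ω) (S ω)) u = m ∧
            ((m + 1 : ℕ) : ℕ∞) ≤ hittingTimeOf (x ω) (S ω) ∧ x ω (m + 1) = v := by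
      ext ω
      constructor
      · intro h
        obtain ⟨u, hu, hlt, h2⟩ := loopErasure_succ_eq_some h
        exact ⟨u, hu, _, rfl, by push_cast; exact Order.add_one_le_of_lt hlt, h2.symm⟩
      · rintro ⟨u, hu, m, rfl, hlt, h2⟩
        push_cast at hlt
        rw [ENat.add_one_le_iff (ENat.natCast_ne_top _)] at hlt
        rw [loopErasure_succ_of_eq_some hu, if_pos hlt, h2]
    rw [this]
    exact Measurable.exists fun u => (ih u).and <| Measurable.exists fun m =>
      (measurable_lastVisit_eq hx hS u m).and
        ((measurable_natCast_le_hittingTimeOf hx hS (m + 1)).and (hx _ _))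

theorem measurable_loopErasure_eq (hx : ∀ n a, Measurable fun ω => x ω n = a)
    (hS : ∀ a, Measurable fun ω => a ∈ S ω) (i : ℕ) (v : Option α) :
    Measurable fun ω => loopErasure (x ω) (hittingTimeOf (x ω) (S ω)) i = v := by
  cases v with
  | some v => exact measurable_loopErasure_eq_some hx hS i v
  | none =>
    simp only [Option.eq_none_iff_forall_ne_some]
    exact Measurable.forall fun v => (measurable_loopErasure_eq_some hx hS i v).not

theorem measurable_mem_stoppedStage {X : Ω → ℕ → ℕ → α} (K : Set α)
    (hX : ∀ j n a, Measurable fun ω => X ω j n = a) (i : ℕ) :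
    (∀ v, Measurable fun ω => v ∈ (stoppedStage K (X ω) i).verts) ∧
    (∀ e, Measurable fun ω => e ∈ (stoppedStage K (X ω) i).edges) := by
  induction i with
  | zero =>
    have h := fun i v => measurable_loopErasure_eq_some (x := fun ω => X ω 0) (S := fun _ => K)
      (hX 0) (fun _ => measurable_const) i v
    exact ⟨fun v => Measurable.exists fun i => h i v,
      fun e => Measurable.exists fun i => (h i _).and (h (i + 1) _)⟩
  | succ i ih =>
    have h := fun k v => measurable_loopErasure_eq_some (x := fun ω => X ω (i + 1))
      (S := fun ω => (stoppedStage K (X ω) i).verts ∪ K)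
      (hX (i + 1)) (fun a => (ih.1 a).or measurable_const) k v
    exact ⟨fun v => (ih.1 v).or <| Measurable.exists fun i => h i v,
      fun e => (ih.2 e).or <| Measurable.exists fun i => (h i _).and (h (i + 1) _)⟩

end LoopErasureMeasurability

namespace ElectricalNetwork

variable {V : Type*} [MeasurableSpace V] [DiscreteMeasurableSpace V] (N : ElectricalNetwork V)

theorem measurable_walks_eq (j n : ℕ) (a : V) : Measurable fun X : ℕ → ℕ → V => X j n = a := by
  have : Measurable fun X : ℕ → ℕ → V => X j n :=
    (measurable_pi_apply n).comp (measurable_pi_apply j)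
  exact (Measurable.of_discrete (f := fun v : V => v = a)).comp this

theorem measurable_wilsonForest : Measurable N.wilsonForest := by
  have : Countable V := N.countable_vertices
  rw [measurable_set_iff]
  intro d
  refine Measurable.exists fun i => ?_
  simp only [← stoppedStage_empty]
  exact (measurable_mem_stoppedStage ∅ measurable_walks_eq i).2 d.toProd

end ElectricalNetwork

/-! ### Finite loop erasures as lists, and their recursion at the last visit to the starting point
-/

section ErasureLists

variable {α : Type*} {A : Set α} {x : ℕ → α}

/-- The loop erasure of the walk `x`, stopped when it hits `A`, is the path `l`. -/
def ErasesTo (A : Set α) (x : ℕ → α) (l : List α) : Prop :=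
  ∀ i, loopErasure x (hittingTimeOf x A) i = l[i]?

/-- `l` is a simple path whose last vertex is its only vertex in `A`. -/
inductive IsPathTo (A : Set α) : List α → Prop
  | singleton {b : α} (hb : b ∈ A) : IsPathTo A [b]
  | cons {a : α} {l : List α} (ha : a ∉ A) (hal : a ∉ l) (hl : IsPathTo A l) : IsPathTo A (a :: l)

theorem IsPathTo.ne_nil {l : List α} (h : IsPathTo A l) : l ≠ [] := by
  cases h <;> simp

theorem IsPathTo.nodup {l : List α} (h : IsPathTo A l) : l.Nodup := by
  induction h with
  | singleton hb => simp
  | cons ha hal hl ih => exact List.nodup_cons.2 ⟨hal, ih⟩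

theorem IsPathTo.exists_getLast? {l : List α} (h : IsPathTo A l) :
    ∃ b ∈ A, l.getLast? = some b := by
  induction h with
  | singleton hb => exact ⟨_, hb, rfl⟩
  | @cons a l ha hal hl ih =>
    obtain ⟨b, hb, h⟩ := ih
    refine ⟨b, hb, ?_⟩
    obtain ⟨c, l, rfl⟩ := List.exists_cons_of_ne_nil hl.ne_nil
    rwa [List.getLast?_cons_cons]

theorem IsPathTo.insert {l : List α} (h : IsPathTo A l) {a : α} (ha : a ∉ l) :
    IsPathTo (insert a A) l := by
  induction h with
  | singleton hb => exact .singleton (Or.inr hb)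
  | @cons c l hc hcl hl ih =>
    rw [List.mem_cons, not_or] at ha
    refine .cons ?_ hcl (ih ha.2)
    rintro (rfl | h)
    exacts [ha.1 rfl, hc h]

/-- As the path ends in `A` at a vertex other than `a`, and meets `insert a A` only there, it avoids
`a`. -/
theorem IsPathTo.of_insert {l : List α} {a b : α} (h : IsPathTo (Insert.insert a A) l)
    (hl : l.getLast? = some b) (hb : b ∈ A) (hab : b ≠ a) : IsPathTo A l ∧ a ∉ l := by
  induction h with
  | singleton hc =>
    obtain rfl := Option.some.inj hl
    exact ⟨.singleton hb, by simpa using hab.symm⟩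
  | @cons c l hc hcl hl' ih =>
    obtain ⟨d, l', rfl⟩ := List.exists_cons_of_ne_nil hl'.ne_nil
    rw [List.getLast?_cons_cons] at hl
    obtain ⟨h1, h2⟩ := ih hl
    exact ⟨.cons (fun h => hc (Or.inr h)) hcl h1,
      List.not_mem_cons_of_ne_of_not_mem (fun h => hc (Or.inl h.symm)) h2⟩

theorem lastVisit_timeShift {n t j : ℕ} (ht : t < n) (htj : t + 1 ≤ j) (hj : j ≤ n) :
    lastVisit x n (x j) =
      t + 1 + lastVisit (timeShift (t + 1) x) ((n - (t + 1) : ℕ) : ℕ∞) (x j) := by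
  have hx := finiteVisits_natCast x n
  have hy := finiteVisits_natCast (timeShift (t + 1) x) (n - (t + 1))
  have e : timeShift (t + 1) x (j - (t + 1)) = x j := by
    rw [timeShift, Nat.add_sub_cancel' htj]
  have h1 := hy.lastVisit_mem (j := j - (t + 1)) (Nat.cast_le.2 (by omega))
  rw [e] at h1
  have h2 := hx.lastVisit_mem (j := j) (Nat.cast_le.2 hj)
  have h3 := hx.le_lastVisit (j := j) (Nat.cast_le.2 hj)
  set L := lastVisit x n (x j)
  set L' := lastVisit (timeShift (t + 1) x) ((n - (t + 1) : ℕ) : ℕ∞) (x j) with hL'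
  have h11 := Nat.cast_le.1 h1.1
  have h21 := Nat.cast_le.1 h2.1
  have h4 := hx.le_lastVisit (j := t + 1 + L') (Nat.cast_le.2 (by omega))
  rw [show x (t + 1 + L') = x j from h1.2] at h4
  have h5 := hy.le_lastVisit (j := L - (t + 1)) (Nat.cast_le.2 (by omega))
  have e2 : timeShift (t + 1) x (L - (t + 1)) = x j := by
    rw [timeShift, Nat.add_sub_cancel' (by omega), h2.2]
  rw [e2, ← hL'] at h5
  change t + 1 + L' ≤ L at h4
  omega

/-- The rest of the loop erasure is the loop erasure of the walk after its last visit to the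
starting point: later last visits are the same for both walks, up to the shift. -/
theorem loopErasure_succ_eq_timeShift {n t : ℕ} (ht : lastVisit x n (x 0) = t) (htn : t < n)
    (i : ℕ) : loopErasure x n (i + 1) =
      loopErasure (timeShift (t + 1) x) ((n - (t + 1) : ℕ) : ℕ∞) i := by
  classical
  induction i with
  | zero =>
    rw [loopErasure_succ_of_eq_some (loopErasure_zero x n), ht, if_pos (Nat.cast_lt.2 htn)]
    rfl
  | succ i ih =>
    cases h : loopErasure (timeShift (t + 1) x) ((n - (t + 1) : ℕ) : ℕ∞) i with
    | none =>
      rw [loopErasure_succ_of_eq_none h, loopErasure_succ_of_eq_none (ih.trans h)]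
    | some v =>
      obtain ⟨j, hj, rfl⟩ := loopErasure_mem h
      have hj := Nat.cast_le.1 hj
      have hl := lastVisit_timeShift (x := x) htn (j := t + 1 + j) (by omega) (by omega)
      change lastVisit x n (timeShift (t + 1) x j) = t + 1 + lastVisit (timeShift (t + 1) x)
        ((n - (t + 1) : ℕ) : ℕ∞) (timeShift (t + 1) x j) at hl
      rw [loopErasure_succ_of_eq_some h, loopErasure_succ_of_eq_some (ih.trans h)]
      by_cases hc : lastVisit (timeShift (t + 1) x) ((n - (t + 1) : ℕ) : ℕ∞)
        (timeShift (t + 1) x j) < n - (t + 1)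
      · rw [if_pos (Nat.cast_lt.2 hc), if_pos (by rw [hl]; exact Nat.cast_lt.2 (by omega)), hl]
        rfl
      · rw [if_neg (by rw [hl, Nat.cast_lt]; omega), if_neg (by rwa [Nat.cast_lt])]

/-- After its last visit the starting point is not met again, so it may be added to the target. -/
theorem hittingTimeOf_timeShift {n t : ℕ} (hn : hittingTimeOf x A = n)
    (ht : lastVisit x n (x 0) = t) (htn : t < n) :
    hittingTimeOf (timeShift (t + 1) x) (insert (x 0) A) = ((n - (t + 1) : ℕ) : ℕ∞) := by
  rw [hittingTimeOf_eq_natCast] at hn ⊢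
  have hx := finiteVisits_natCast x n
  refine ⟨fun m hm => ?_, Or.inr ?_⟩
  · rintro (h | h)
    · have := hx.le_lastVisit (j := t + 1 + m) (Nat.cast_le.2 (by omega))
      rw [show x (t + 1 + m) = x 0 from h, ht] at this
      omega
    · exact hn.1 (t + 1 + m) (by omega) h
  · rw [timeShift, Nat.add_sub_cancel' (by omega)]
    exact hn.2

/-- Strong induction on the hitting time: the walk is cut at the last visit to its starting point,
which is then added to the target. -/
theorem exists_erasesTo {n : ℕ} (hn : hittingTimeOf x A = n) :
    ∃ l, ErasesTo A x l ∧ IsPathTo A l ∧ l.head? = some (x 0) ∧ l.getLast? = some (x n) := by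
  classical
  induction n using Nat.strong_induction_on generalizing x A with
  | _ n ih =>
    have hx := finiteVisits_natCast x n
    have h0 := hx.lastVisit_mem (j := 0) (by simp)
    have hA := (hittingTimeOf_eq_natCast.1 hn)
    rcases (Nat.cast_le.1 h0.1).lt_or_eq with hlt | heq
    · obtain ⟨l, h1, h2, h3, h4⟩ := ih _ (by omega) (hittingTimeOf_timeShift hn rfl hlt)
      rw [timeShift, Nat.add_sub_cancel' (by omega)] at h4
      have hne : x n ≠ x 0 := by
        intro h
        have := hx.le_lastVisit (j := n) le_rfl
        rw [h] at this
        omega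
      obtain ⟨h5, h6⟩ := h2.of_insert h4 hA.2 hne
      refine ⟨x 0 :: l, ?_, .cons (hA.1 0 (by omega)) h6 h5, rfl, ?_⟩
      · intro i
        cases i with
        | zero => rfl
        | succ i =>
          rw [hn, loopErasure_succ_eq_timeShift rfl hlt, List.getElem?_cons_succ, ← h1 i,
            hittingTimeOf_timeShift hn rfl hlt]
      · obtain ⟨d, l', rfl⟩ := List.exists_cons_of_ne_nil h5.ne_nil
        rwa [List.getLast?_cons_cons]
    · have h0n : x n = x 0 := by rw [← heq]; exact h0.2
      refine ⟨[x 0], ?_, .singleton (h0n ▸ hA.2), rfl, by rw [h0n]; rfl⟩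
      intro i
      rw [hn]
      induction i with
      | zero => rfl
      | succ i ih' =>
        cases i with
        | zero =>
          rw [loopErasure_succ_of_eq_some (loopErasure_zero x n), heq]
          simp
        | succ i => exact (loopErasure_succ_of_eq_none ih')

theorem ErasesTo.unique {l l' : List α} (h : ErasesTo A x l) (h' : ErasesTo A x l') : l = l' :=
  List.ext_getElem? fun i => (h i).symm.trans (h' i)

/-- By its definition, the loop erasure of a walk that is never stopped does not end, so it is not a
list. -/
theorem ErasesTo.exists_hittingTimeOf {l : List α} (h : ErasesTo A x l) :
    ∃ n : ℕ, hittingTimeOf x A = n := by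
  classical
  have hne : hittingTimeOf x A ≠ ⊤ := by
    intro htop
    have : ∀ i, loopErasure x ⊤ i ≠ none := by
      intro i
      induction i with
      | zero => exact Option.some_ne_none _
      | succ i ih =>
        obtain ⟨v, hv⟩ := Option.ne_none_iff_exists'.1 ih
        rw [loopErasure_succ_of_eq_some hv, if_pos (ENat.natCast_lt_top _)]
        exact Option.some_ne_none _
    have h1 := h l.length
    rw [htop, List.getElem?_eq_none le_rfl] at h1
    exact this _ h1
  obtain ⟨n, hn⟩ := ENat.ne_top_iff_exists.1 hne
  exact ⟨n, hn.symm⟩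

theorem ErasesTo.spec {l : List α} (h : ErasesTo A x l) :
    ∃ n : ℕ, hittingTimeOf x A = n ∧ IsPathTo A l ∧ l.head? = some (x 0) ∧
      l.getLast? = some (x n) := by
  obtain ⟨n, hn⟩ := h.exists_hittingTimeOf
  obtain ⟨l', h1, h2⟩ := exists_erasesTo hn
  obtain rfl := h.unique h1
  exact ⟨n, hn, h2⟩

theorem ErasesTo.head? {l : List α} (h : ErasesTo A x l) : l.head? = some (x 0) :=
  h.spec.choose_spec.2.2.1

theorem erasesTo_singleton {b : α} (hb : b ∈ A) (hx : x 0 = b) : ErasesTo A x [b] := by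
  have h0 : hittingTimeOf x A = (0 : ℕ) := by
    rw [hittingTimeOf_eq_natCast]; simp [hx, hb]
  obtain ⟨l, h1, h2, h3, h4⟩ := exists_erasesTo h0
  cases h2 with
  | singleton hc =>
    rw [List.head?_cons, hx] at h3
    rwa [Option.some.inj h3] at h1
  | cons hc hcl hl =>
    rw [List.head?_cons, hx] at h3
    rw [Option.some.inj h3] at hc
    exact absurd hb hc

/-- Decomposition of a walk, the loop erasure of which is `a :: l`, at the last visit to `a`. -/
theorem ErasesTo.exists_of_cons {a : α} {l : List α} (ha : a ∉ A) (h : ErasesTo A x (a :: l)) :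
    ∃ n, (∀ i ≤ n, x i ∉ A) ∧ x n = a ∧ ErasesTo (insert a A) (timeShift (n + 1) x) l := by
  classical
  obtain ⟨N, hN, hp, h0, -⟩ := h.spec
  have h0 : a = x 0 := Option.some.inj h0
  subst h0
  have hx := finiteVisits_natCast x N
  have h1 := hx.lastVisit_mem (j := 0) (by simp)
  have hlt : lastVisit x N (x 0) < N := by
    by_contra hge
    cases hp with
    | singleton hb => exact ha hb
    | cons _ _ hl =>
      obtain ⟨d, l', rfl⟩ := List.exists_cons_of_ne_nil hl.ne_nil
      have := h 1
      rw [hN, loopErasure_succ_of_eq_some (loopErasure_zero x N), if_neg] at this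
      · simp at this
      · rwa [Nat.cast_lt]
  refine ⟨lastVisit x N (x 0), fun i hi => ?_, h1.2, fun i => ?_⟩
  · exact (hittingTimeOf_eq_natCast.1 hN).1 i (by omega)
  · rw [hittingTimeOf_timeShift hN rfl hlt, ← loopErasure_succ_eq_timeShift rfl hlt, ← hN, h (i + 1),
      List.getElem?_cons_succ]

/-- The target `insert a A` together with `a ∉ l` expresses that the walk hits `A` before returning
to `a`, so `n` is the last visit. The second conclusion makes the events for distinct `n` disjoint.
-/
theorem ErasesTo.of_timeShift {a : α} {l : List α} (hl : IsPathTo A l) (hal : a ∉ l) {n : ℕ}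
    (hA : ∀ i ≤ n, x i ∉ A) (h0 : x 0 = a) (hn : x n = a)
    (h : ErasesTo (insert a A) (timeShift (n + 1) x) l) :
    ErasesTo A x (a :: l) ∧ lastVisit x (hittingTimeOf x A) a = n := by
  obtain ⟨m, hm, -, -, hlast⟩ := h.spec
  obtain ⟨b, hb, hlast'⟩ := hl.exists_getLast?
  have hbm : x (n + 1 + m) = b := Option.some.inj (hlast.symm.trans hlast')
  rw [hittingTimeOf_eq_natCast] at hm
  have hT : hittingTimeOf x A = ((n + 1 + m : ℕ) : ℕ∞) := by
    rw [hittingTimeOf_eq_natCast]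
    refine ⟨fun i hi => ?_, hbm ▸ hb⟩
    by_cases hin : i ≤ n
    · exact hA i hin
    · have := hm.1 (i - (n + 1)) (by omega)
      rw [timeShift, Nat.add_sub_cancel' (by omega)] at this
      exact fun h => this (Or.inr h)
  have hab : b ≠ a := by
    rintro rfl
    exact hA n le_rfl (hn ▸ hb)
  have hlv : lastVisit x ((n + 1 + m : ℕ) : ℕ∞) a = n := by
    have hx := finiteVisits_natCast x (n + 1 + m)
    have h1 := hx.le_lastVisit (j := n) (Nat.cast_le.2 (by omega))
    have h2 := hx.lastVisit_mem (j := n) (Nat.cast_le.2 (by omega))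
    rw [hn] at h1 h2
    refine le_antisymm (not_lt.1 fun hlt => ?_) h1
    have h21 := Nat.cast_le.1 h2.1
    rcases h21.lt_or_eq with h3 | h3
    · have := hm.1 (lastVisit x ((n + 1 + m : ℕ) : ℕ∞) a - (n + 1)) (by omega)
      rw [timeShift, Nat.add_sub_cancel' (by omega)] at this
      exact this (Or.inl h2.2)
    · rw [h3, hbm] at h2
      exact hab h2.2
  refine ⟨fun i => ?_, by rw [hT]; exact hlv⟩
  rw [hT]
  have hlv' : lastVisit x ((n + 1 + m : ℕ) : ℕ∞) (x 0) = n := by rw [h0]; exact hlv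
  cases i with
  | zero => rw [loopErasure_zero, h0]; rfl
  | succ i =>
    rw [loopErasure_succ_eq_timeShift hlv' (by omega), List.getElem?_cons_succ, ← h i, ← h0,
      hittingTimeOf_timeShift hT hlv' (by omega)]

end ErasureLists

/-! ### Determinants of killed transition matrices -/

namespace Matrix

variable {M : Type*}

open Classical in
/-- The matrix `P` with the rows in `A` replaced by `0`. -/
noncomputable def killed (P : Matrix M M ℝ) (A : Set M) : Matrix M M ℝ :=
  Matrix.of fun i j => if i ∈ A then 0 else P i j

theorem killed_apply_of_mem (P : Matrix M M ℝ) {A : Set M} {i : M} (h : i ∈ A) (j : M) :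
    P.killed A i j = 0 := if_pos h

theorem killed_apply_of_notMem (P : Matrix M M ℝ) {A : Set M} {i : M} (h : i ∉ A) (j : M) :
    P.killed A i j = P i j := if_neg h

theorem killed_univ (P : Matrix M M ℝ) : P.killed Set.univ = 0 := by
  ext i j; exact killed_apply_of_mem _ (Set.mem_univ _) j

variable [DecidableEq M]

/-- This makes the numerator in Cramer's rule a determinant of the same kind, with `y` killed as
well. -/
theorem one_sub_killed_updateRow (P : Matrix M M ℝ) (A : Set M) (y : M) :
    (1 - P.killed A).updateRow y (Pi.single y 1) = 1 - P.killed (insert y A) := by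
  ext i j
  by_cases hi : i = y
  · subst hi
    rw [updateRow_self, sub_apply, killed_apply_of_mem _ (Set.mem_insert _ _)]
    simp [one_apply, Pi.single_apply, eq_comm]
  · rw [updateRow_ne hi, sub_apply, sub_apply]
    by_cases hA : i ∈ A
    · rw [killed_apply_of_mem _ hA, killed_apply_of_mem _ (Set.mem_insert_of_mem y hA)]
    · rw [killed_apply_of_notMem _ hA, killed_apply_of_notMem]
      rintro (h | h)
      exacts [hi h, hA h]

variable [Fintype M]

/-- Cramer's rule for a diagonal entry of the Neumann series of `K`. -/
theorem det_one_sub_mul_tsum_pow (K : Matrix M M ℝ) (y : M)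
    (h : ∀ m, Summable fun n => (K ^ n) m y) :
    (1 - K).det * ∑' n, (K ^ n) y y = ((1 - K).updateRow y (Pi.single y 1)).det := by
  set g : M → ℝ := fun m => ∑' n, (K ^ n) m y with hg
  -- The column `g` of the Neumann series solves this linear system, which the adjugate then solves
  -- for its entry at `y`.
  have h1 : (1 - K) *ᵥ g = Pi.single y 1 := by
    ext m
    rw [sub_mulVec, one_mulVec, Pi.sub_apply, mulVec, dotProduct]
    have h2 : ∑ j, K m j * g j = ∑' n, (K ^ (n + 1)) m y := by
      simp only [hg, ← tsum_mul_left]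
      rw [← Summable.tsum_finsetSum fun j _ => (h j).mul_left _]
      refine tsum_congr fun n => ?_
      rw [pow_succ', mul_apply]
    rw [h2]
    change (∑' n, (K ^ n) m y) - _ = _
    rw [(h m).tsum_eq_zero_add]
    simp [one_apply, Pi.single_apply]
  have h3 := congrArg (fun v => (adjugate (1 - K) *ᵥ v) y) h1
  simp only [mulVec_mulVec, adjugate_mul, smul_mulVec, one_mulVec, Pi.smul_apply, smul_eq_mul,
    mulVec_single_one, col_apply] at h3
  rw [h3, adjugate_apply]

/-- The product of the entries of `P` along the path `l`. -/
def pathProd (P : Matrix M M ℝ) : List M → ℝ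
  | [] => 1
  | [_] => 1
  | a :: b :: l => P a b * pathProd P (b :: l)

end Matrix

/-! ### The law of the loop erasure of a stopped walk -/

namespace ElectricalNetwork

variable {V : Type*} {N : ElectricalNetwork V}

theorem transProb_nonneg (N : ElectricalNetwork V) {x v : V} (hv : v ∈ N.nbhd x) :
    0 ≤ N.transProb x v :=
  div_nonneg (N.cond_pos x v (N.mem_nbhd.1 hv)).le
    (Finset.sum_nonneg fun z hz => (N.cond_pos x z (N.mem_nbhd.1 hz)).le)

/-- The hypothesis `hP`, also used below, says that the walk seen through `φ` is a Markov chain with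
matrix `P` as long as it is not in `z`. -/
theorem sum_transProb_mul_comp {M : Type*} [Fintype M] [DecidableEq M] {φ : V → M} {z : M}
    {P : Matrix M M ℝ}
    (hP : ∀ x, φ x ≠ z → ∀ m, ∑ v ∈ N.nbhd x with φ v = m, N.transProb x v = P (φ x) m) {x : V}
    (hx : φ x ≠ z) (g : M → ℝ) :
    ∑ v ∈ N.nbhd x, N.transProb x v * g (φ v) = ∑ m, P (φ x) m * g m := by
  rw [← Finset.sum_fiberwise (N.nbhd x) φ]
  refine Finset.sum_congr rfl fun m _ => ?_
  rw [← hP x hx, Finset.sum_mul]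
  refine Finset.sum_congr rfl fun v hv => ?_
  rw [(Finset.mem_filter.1 hv).2]

variable [MeasurableSpace V] [DiscreteMeasurableSpace V]
variable {M : Type*}

theorem IsTransient.tsum_step_mul (hN : N.IsTransient) (x : V) (f : V → ℝ)
    (hf : ∀ v, 0 ≤ f v) :
    ∑' v, N.step x v * ENNReal.ofReal (f v) =
      ENNReal.ofReal (∑ v ∈ N.nbhd x, N.transProb x v * f v) := by
  rw [tsum_eq_sum (s := N.nbhd x),
    ENNReal.ofReal_sum_of_nonneg fun v hv => mul_nonneg (N.transProb_nonneg hv) (hf v)]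
  · refine Finset.sum_congr rfl fun v hv => ?_
    rw [hN.step_apply, ENNReal.ofReal_mul (N.transProb_nonneg hv)]
  · intro v hv
    rw [hN.step_apply, N.transProb_eq_zero hv, zero_mul]

theorem measurableSet_erasesTo [Countable M] (φ : V → M) (A : Set M) (l : List M) :
    MeasurableSet {ω : ℕ → V | ErasesTo A (φ ∘ ω) l} := by
  have h : ∀ n a, Measurable fun ω : ℕ → V => (φ ∘ ω) n = a := fun n a =>
    (Measurable.of_discrete (f := fun v : V => φ v = a)).comp (measurable_pi_apply n)
  refine measurableSet_setOfPred.2 (Measurable.forall fun i => ?_)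
  exact measurable_loopErasure_eq (x := fun ω : ℕ → V => φ ∘ ω) (S := fun _ => A) h
    (fun _ => measurable_const) i _

/-- The walk is split according to the time `n` of its last visit to `x` before it hits `A`. The
Markov property at time `n`, then at the next step, factors the probability, and the first factors
sum to the expected number of visits. -/
theorem walkLaw_erasesTo_cons [Countable M] (φ : V → M) {A : Set M} {a : M} {l : List M}
    (ha : a ∉ A) (hφ : ∀ v w, φ v = a → φ w = a → v = w) (hal : a ∉ l) (hl : IsPathTo A l) {x : V}
    (hx : φ x = a) :
    N.walkLaw x {ω | ErasesTo A (φ ∘ ω) (a :: l)} =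
      (∑' n, N.killedProb (φ ⁻¹' Aᶜ) n x x) *
        ∑' v, N.step x v * N.walkLaw v {ω | ErasesTo (insert a A) (φ ∘ ω) l} := by
  set B' : Set (ℕ → V) := {ω | ErasesTo (insert a A) (φ ∘ ω) l} with hB'
  have hB'm : MeasurableSet B' := measurableSet_erasesTo φ _ l
  set B : Set (ℕ → V) := {ω | ω 0 ∈ Set.univ ∧ timeShift 1 ω ∈ B'} with hB
  have hBm : MeasurableSet B :=
    (measurableSet_walk_mem 0 Set.univ).inter (measurable_timeShift 1 hB'm)
  set D : ℕ → Set (ℕ → V) := fun n =>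
    {ω | (∀ i < n, ω i ∈ φ ⁻¹' Aᶜ) ∧ ω n = x ∧ timeShift n ω ∈ B} with hD
  have hDm : ∀ n, MeasurableSet (D n) := fun n =>
    (measurableSet_killed _ n).inter ((measurableSet_walk_eq n x).inter
      (measurable_timeShift n hBm))
  have hPB : N.walkLaw x B = ∑' v, N.step x v * N.walkLaw v B' := by
    rw [hB, N.walkLaw_firstStep x Set.univ hB'm, Set.indicator_of_mem (Set.mem_univ _)]
  have hshift : ∀ n (ω : ℕ → V), timeShift 1 (timeShift n ω) = timeShift (n + 1) ω := by
    intro n ω; ext i; simp only [timeShift]; congr 1; omega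
  have hDE : ∀ n ω, ω 0 = x → ω ∈ D n → ErasesTo A (φ ∘ ω) (a :: l) ∧
      lastVisit (φ ∘ ω) (hittingTimeOf (φ ∘ ω) A) a = n := by
    rintro n ω h0 ⟨h1, h2, -, h3⟩
    refine ErasesTo.of_timeShift hl hal (n := n) (fun i hi => ?_) (by simp [h0, hx])
      (by simp [h2, hx]) ?_
    · rcases hi.lt_or_eq with hi | rfl
      · exact h1 i hi
      · simpa [h2, hx] using ha
    · rw [hshift] at h3
      exact h3
  have h1 : N.walkLaw x {ω | ErasesTo A (φ ∘ ω) (a :: l)} =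
      N.walkLaw x (⋃ n, D n ∩ {ω | ω 0 = x}) := by
    refine measure_congr ?_
    filter_upwards [N.ae_walkLaw_zero x] with ω h0
    refine propext ⟨fun h => ?_, fun h => ?_⟩
    · obtain ⟨n, h2, h3, h4⟩ := ErasesTo.exists_of_cons ha h
      refine Set.mem_iUnion.2 ⟨n, ⟨fun i hi => h2 i hi.le, hφ _ _ h3 hx, Set.mem_univ _, ?_⟩, h0⟩
      rw [hshift]
      exact h4
    · obtain ⟨n, hn, -⟩ := Set.mem_iUnion.1 h
      exact (hDE n ω h0 hn).1
  rw [h1, measure_iUnion, ← hPB, ← ENNReal.tsum_mul_right]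
  · refine tsum_congr fun n => ?_
    rw [← N.walkLaw_killed_markov _ hBm]
    refine measure_congr ?_
    filter_upwards [N.ae_walkLaw_zero x] with ω h0
    exact propext ⟨fun h => h.1, fun h => ⟨h, h0⟩⟩
  · intro m n hmn
    refine Set.disjoint_left.2 fun ω hm hn => hmn ?_
    rw [← (hDE m ω hm.2 hm.1).2, ← (hDE n ω hn.2 hn.1).2]
  · exact fun n => (hDm n).inter (measurableSet_walk_eq 0 x)

section Wired

variable [Fintype M] [DecidableEq M] {φ : V → M} {z : M} {P : Matrix M M ℝ} {A : Set M}

/-- Both sides satisfy the same recursion in the first step. The identification is harmless since `z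
∈ A` and `y` is the only vertex over `φ y`. Nonnegativity is carried along because `ENNReal.ofReal`
truncates. -/
theorem killedProb_eq_pow (hN : N.IsTransient) (hsurj : Function.Surjective φ)
    (hφ : ∀ v w, φ v ≠ z → φ v = φ w → v = w)
    (hP : ∀ x, φ x ≠ z → ∀ m, ∑ v ∈ N.nbhd x with φ v = m, N.transProb x v = P (φ x) m)
    (hz : z ∈ A) {y : V} (hy : φ y ≠ z) (n : ℕ) (v : V) :
    N.killedProb (φ ⁻¹' Aᶜ) n v y = ENNReal.ofReal ((P.killed A ^ n) (φ v) (φ y)) ∧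
      0 ≤ (P.killed A ^ n) (φ v) (φ y) := by
  induction n generalizing v with
  | zero =>
    rw [killedProb_zero, pow_zero, Matrix.one_apply]
    by_cases h : v = y
    · subst h; simp
    · have : φ v ≠ φ y := fun h' => h (hφ y v hy h'.symm).symm
      simp [h, this]
  | succ n ih =>
    rw [killedProb_succ, pow_succ', Matrix.mul_apply]
    by_cases hv : φ v ∈ A
    · rw [Set.indicator_of_notMem (by simpa using hv)]
      simp [Matrix.killed_apply_of_mem _ hv]
    · rw [Set.indicator_of_mem (by simpa using hv)]
      have hvz : φ v ≠ z := fun h => hv (h ▸ hz)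
      have hnn : ∀ m, 0 ≤ (P.killed A ^ n) m (φ y) := fun m => by
        obtain ⟨u, rfl⟩ := hsurj m
        exact (ih u).2
      simp only [fun u => (ih u).1, Matrix.killed_apply_of_notMem _ hv]
      rw [hN.tsum_step_mul v (fun u => (P.killed A ^ n) (φ u) (φ y)) fun u => (ih u).2,
        sum_transProb_mul_comp hP hvz fun m => (P.killed A ^ n) m (φ y)]
      refine ⟨rfl, Finset.sum_nonneg fun m _ => mul_nonneg ?_ (hnn m)⟩
      rw [← hP v hvz]
      exact Finset.sum_nonneg fun u hu => N.transProb_nonneg (Finset.mem_filter.1 hu).1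

/-- Cramer's rule for the Neumann series, which converges because it is dominated by the Green
function. The form without division allows the determinants to be shown nonzero from it. -/
theorem tsum_killedProb (hN : N.IsTransient) (hsurj : Function.Surjective φ)
    (hφ : ∀ v w, φ v ≠ z → φ v = φ w → v = w)
    (hP : ∀ x, φ x ≠ z → ∀ m, ∑ v ∈ N.nbhd x with φ v = m, N.transProb x v = P (φ x) m)
    (hz : z ∈ A) {y : V} (hy : φ y ≠ z) :
    (∑' n, N.killedProb (φ ⁻¹' Aᶜ) n y y).toReal * (1 - P.killed A).det =
      (1 - P.killed (insert (φ y) A)).det := by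
  have hk := fun n v => killedProb_eq_pow hN hsurj hφ hP hz hy n v
  have hfin : ∀ v, ∑' n, N.killedProb (φ ⁻¹' Aᶜ) n v y ≠ ⊤ := fun v =>
    ne_top_of_le_ne_top (N.green_ne_top hN v y) <| ENNReal.tsum_le_tsum fun n =>
      measure_mono fun ω hω => hω.2
  have hsum : ∀ m, Summable fun n => (P.killed A ^ n) m (φ y) := by
    intro m
    obtain ⟨v, rfl⟩ := hsurj m
    have := ENNReal.summable_toReal (hfin v)
    simpa only [(hk _ v).1, ENNReal.toReal_ofReal (hk _ v).2] using this
  have h := Matrix.det_one_sub_mul_tsum_pow (P.killed A) (φ y) hsum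
  rw [Matrix.one_sub_killed_updateRow] at h
  rw [← h, mul_comm, ENNReal.tsum_toReal_eq]
  · simp only [(hk _ y).1, ENNReal.toReal_ofReal (hk _ y).2]
  · exact fun n => ENNReal.ne_top_of_tsum_ne_top (hfin y) n

/-- Vertices are added to `A` one at a time: by `tsum_killedProb` the determinant for `A` divides
that for the larger set, and at the end, with everything killed, the determinant is `1`. -/
theorem det_one_sub_killed_ne_zero (hN : N.IsTransient) (hsurj : Function.Surjective φ)
    (hφ : ∀ v w, φ v ≠ z → φ v = φ w → v = w)
    (hP : ∀ x, φ x ≠ z → ∀ m, ∑ v ∈ N.nbhd x with φ v = m, N.transProb x v = P (φ x) m)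
    (hz : z ∈ A) : (1 - P.killed A).det ≠ 0 := by
  induction h : (Aᶜ).ncard generalizing A with
  | zero =>
    have : A = Set.univ := by
      rwa [Set.ncard_eq_zero (Set.toFinite _), Set.compl_empty_iff] at h
    rw [this, Matrix.killed_univ]
    simp
  | succ k ih =>
    obtain ⟨m, hm⟩ := (Set.ncard_pos (Set.toFinite Aᶜ)).1 (by omega)
    obtain ⟨y, rfl⟩ := hsurj m
    have hy : φ y ≠ z := fun h' => hm (h' ▸ hz)
    have h1 := tsum_killedProb hN hsurj hφ hP hz hy
    have h2 : (1 - P.killed (insert (φ y) A)).det ≠ 0 := by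
      refine ih (Or.inr hz) ?_
      rw [← Set.union_singleton, Set.compl_union, ← Set.sdiff_eq,
        Set.ncard_sdiff_singleton_of_mem hm, h]
      rfl
    rw [← h1] at h2
    exact right_ne_zero_of_mul h2

/-- The probability that the loop erasure of a walk stopped on `A` is a given path. -/
theorem walkLaw_erasesTo (hN : N.IsTransient) (hsurj : Function.Surjective φ)
    (hφ : ∀ v w, φ v ≠ z → φ v = φ w → v = w)
    (hP : ∀ x, φ x ≠ z → ∀ m, ∑ v ∈ N.nbhd x with φ v = m, N.transProb x v = P (φ x) m)
    (hz : z ∈ A) {l : List M} (hl : IsPathTo A l) {x : V} (hx : l.head? = some (φ x)) :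
    (N.walkLaw x).real {ω | ErasesTo A (φ ∘ ω) l} * (1 - P.killed A).det =
      P.pathProd l * (1 - P.killed (A ∪ {m | m ∈ l})).det := by
  induction l generalizing A x with
  | nil => simp at hx
  | cons a l ih =>
    obtain rfl : a = φ x := Option.some.inj hx
    cases hl with
    | singleton hb =>
      have h1 : (N.walkLaw x).real {ω | ErasesTo A (φ ∘ ω) [φ x]} = 1 := by
        have h0 : {ω : ℕ → V | ErasesTo A (φ ∘ ω) [φ x]} =ᵐ[N.walkLaw x] Set.univ := by
          refine Filter.eventuallyEq_univ.2 ?_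
          filter_upwards [N.ae_walkLaw_zero x] with ω hω
          exact erasesTo_singleton hb (by simp [hω])
        rw [measureReal_def, measure_congr h0, measure_univ,
          ENNReal.toReal_one]
      have h2 : A ∪ {m | m ∈ [φ x]} = A := by
        refine Set.union_eq_self_of_subset_right ?_
        intro m hm
        rwa [List.mem_singleton.1 hm]
      rw [h1, h2, one_mul, Matrix.pathProd, one_mul]
    | cons ha hal hl =>
      obtain ⟨b, l, rfl⟩ := List.exists_cons_of_ne_nil hl.ne_nil
      have hxz : φ x ≠ z := fun h => ha (h ▸ hz)
      have h1 := walkLaw_erasesTo_cons (N := N) φ ha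
        (fun v w hv hw => hφ v w (hv ▸ hxz) (hv.trans hw.symm)) hal hl rfl
      have h2 := tsum_killedProb hN hsurj hφ hP hz hxz
      have h3 : ∑' v, N.step x v * N.walkLaw v {ω | ErasesTo (insert (φ x) A) (φ ∘ ω) (b :: l)} =
          ENNReal.ofReal (∑ v ∈ N.nbhd x, N.transProb x v *
            (N.walkLaw v).real {ω | ErasesTo (insert (φ x) A) (φ ∘ ω) (b :: l)}) := by
        rw [← hN.tsum_step_mul x _ fun v => measureReal_nonneg]
        simp
      -- Only first steps to vertices over `b` contribute, as a loop erasure starts where its walk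
      -- does; to these the induction hypothesis applies, with the target enlarged by `φ x`.
      have h4 : (∑ v ∈ N.nbhd x, N.transProb x v *
            (N.walkLaw v).real {ω | ErasesTo (insert (φ x) A) (φ ∘ ω) (b :: l)}) *
            (1 - P.killed (insert (φ x) A)).det =
          P (φ x) b * (P.pathProd (b :: l) *
            (1 - P.killed (insert (φ x) A ∪ {m | m ∈ b :: l})).det) := by
        rw [Finset.sum_mul, ← hP x hxz, Finset.sum_mul, Finset.sum_filter]
        refine Finset.sum_congr rfl fun v _ => ?_
        split_ifs with hv
        · rw [mul_assoc, ih (Or.inr hz) (hl.insert hal) (by rw [hv]; rfl)]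
        · have : (N.walkLaw v).real
              {ω | ErasesTo (insert (φ x) A) (φ ∘ ω) (b :: l)} = 0 := by
            rw [measureReal_def, measure_eq_zero_iff_ae_notMem.2]
            · rfl
            · filter_upwards [N.ae_walkLaw_zero v] with ω hω h
              have := Option.some.inj h.head?
              exact hv (by rw [this, Function.comp, hω])
          rw [this, mul_zero, zero_mul]
      have h5 : insert (φ x) A ∪ {m | m ∈ b :: l} = A ∪ {m | m ∈ φ x :: b :: l} := by
        ext m
        simp only [Set.mem_union, Set.mem_insert_iff, Set.mem_ofPred_eq, List.mem_cons]
        tauto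
      rw [measureReal_def, h1, ENNReal.toReal_mul, h3, ENNReal.toReal_ofReal
        (Finset.sum_nonneg fun v hv => mul_nonneg (N.transProb_nonneg hv) measureReal_nonneg),
        mul_right_comm, h2, mul_comm, h4, h5, Matrix.pathProd, mul_assoc]

end Wired

end ElectricalNetwork

/-! ### Edges of a path given as a list -/

section ListEdges

variable {α : Type*} {A : Set α}

theorem pathVerts_getElem? (l : List α) : pathVerts (fun i => l[i]?) = {m | m ∈ l} := by
  ext m
  exact List.mem_iff_getElem?.symm

/-- The pairs of consecutive elements of a list. -/
def listEdges (l : List α) : Set (α × α) := pathEdges fun i => l[i]?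

theorem listEdges_singleton (b : α) : listEdges [b] = ∅ := by
  ext e
  simp [listEdges, pathEdges]

theorem listEdges_cons_cons (a b : α) (l : List α) :
    listEdges (a :: b :: l) = insert (a, b) (listEdges (b :: l)) := by
  ext ⟨c, d⟩
  constructor
  · rintro ⟨i, h1, h2⟩
    cases i with
    | zero =>
      left
      have h1 : some a = some c := h1
      have h2 : some b = some d := h2
      rw [Option.some.inj h1, Option.some.inj h2]
    | succ i => exact Or.inr ⟨i, h1, h2⟩
  · rintro (h | ⟨i, h1, h2⟩)
    · obtain ⟨rfl, rfl⟩ := Prod.mk.inj h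
      exact ⟨0, rfl, rfl⟩
    · exact ⟨i + 1, h1, h2⟩

theorem mem_listEdges_iff {l : List α} {a b : α} : (a, b) ∈ listEdges l ↔ [a, b] <:+: l := by
  induction l with
  | nil => simp [listEdges, pathEdges]
  | cons c l ih =>
    cases l with
    | nil =>
      rw [listEdges_singleton]
      simp only [Set.mem_empty_iff_false, false_iff]
      intro h
      have := h.length_le
      simp at this
    | cons d l =>
      rw [listEdges_cons_cons, List.infix_cons_iff, ← ih, Set.mem_insert_iff]
      simp

theorem mem_listEdges_reverse {l : List α} {a b : α} :
    (a, b) ∈ listEdges l.reverse ↔ (b, a) ∈ listEdges l := by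
  rw [mem_listEdges_iff, mem_listEdges_iff, ← List.reverse_infix]
  simp

theorem mem_of_mem_listEdges {l : List α} {e : α × α} (h : e ∈ listEdges l) :
    e.1 ∈ l ∧ e.2 ∈ l := by
  obtain ⟨i, h1, h2⟩ := h
  exact ⟨List.mem_iff_getElem?.2 ⟨i, h1⟩, List.mem_iff_getElem?.2 ⟨i + 1, h2⟩⟩

theorem isChain_of_listEdges {R : α → α → Prop} {l : List α}
    (h : ∀ a b, (a, b) ∈ listEdges l → R a b) : l.IsChain R := by
  induction l with
  | nil => simp
  | cons a l ih =>
    cases l with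
    | nil => simp
    | cons b l =>
      rw [listEdges_cons_cons] at h
      exact List.isChain_cons_cons.2 ⟨h a b (Or.inl rfl), ih fun c d hcd => h c d (Or.inr hcd)⟩

theorem IsPathTo.notMem_of_mem_listEdges {l : List α} (hl : IsPathTo A l) {e : α × α}
    (h : e ∈ listEdges l) : e.1 ∉ A := by
  induction hl with
  | singleton hb => rw [listEdges_singleton] at h; exact h.elim
  | @cons a l ha hal hl ih =>
    obtain ⟨b, l, rfl⟩ := List.exists_cons_of_ne_nil hl.ne_nil
    rw [listEdges_cons_cons] at h
    rcases h with rfl | h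
    exacts [ha, ih h]

theorem IsPathTo.listEdges_functional {l : List α} (hl : IsPathTo A l) {a b b' : α}
    (h : (a, b) ∈ listEdges l) (h' : (a, b') ∈ listEdges l) : b = b' := by
  induction hl with
  | singleton hb => rw [listEdges_singleton] at h; exact h.elim
  | @cons c l hc hcl hl ih =>
    obtain ⟨d, l, rfl⟩ := List.exists_cons_of_ne_nil hl.ne_nil
    rw [listEdges_cons_cons] at h h'
    rcases h with h | h <;> rcases h' with h' | h'
    · rw [(Prod.mk.inj h).2, (Prod.mk.inj h').2]
    · rw [(Prod.mk.inj h).1] at h'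
      exact absurd (mem_of_mem_listEdges h').1 hcl
    · rw [(Prod.mk.inj h').1] at h
      exact absurd (mem_of_mem_listEdges h).1 hcl
    · exact ih h h'

theorem IsPathTo.reflTransGen {l : List α} (hl : IsPathTo A l) {R : α → α → Prop} {r : α}
    (hR : ∀ a b, (a, b) ∈ listEdges l → R a b) (hA : ∀ m ∈ A, Relation.ReflTransGen R m r) :
    ∀ m ∈ l, Relation.ReflTransGen R m r := by
  induction hl with
  | singleton hb => intro m hm; rw [List.mem_singleton.1 hm]; exact hA _ hb
  | @cons c l hc hcl hl ih =>
    obtain ⟨d, l, rfl⟩ := List.exists_cons_of_ne_nil hl.ne_nil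
    rw [listEdges_cons_cons] at hR
    have ih := ih fun a b h => hR a b (Or.inr h)
    intro m hm
    rcases List.mem_cons.1 hm with rfl | hm
    · exact .head (hR _ _ (Or.inl rfl)) (ih d List.mem_cons_self)
    · exact ih m hm

/-- Exactly the last vertex of the path is in `A`, and every other vertex is followed by its parent.
-/
theorem IsPathTo.listEdges_eq {l : List α} (hl : IsPathTo A l) {f : α → α}
    (hf : l.IsChain fun a b => f a = b) : listEdges l = {e | e.1 ∈ l ∧ e.1 ∉ A ∧ f e.1 = e.2} := by
  induction hl with
  | @singleton b hb =>
    rw [listEdges_singleton]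
    ext e
    simp only [Set.mem_empty_iff_false, List.mem_singleton, Set.mem_ofPred_eq, false_iff]
    rintro ⟨h1, h2, -⟩
    exact h2 (h1 ▸ hb)
  | @cons c l hc hcl hl ih =>
    obtain ⟨d, l, rfl⟩ := List.exists_cons_of_ne_nil hl.ne_nil
    rw [List.isChain_cons_cons] at hf
    rw [listEdges_cons_cons, ih hf.2]
    ext ⟨a, b⟩
    simp only [Set.mem_insert_iff, Set.mem_ofPred_eq, List.mem_cons (a := a) (b := c), Prod.mk.injEq]
    constructor
    · rintro (⟨rfl, rfl⟩ | ⟨h1, h2, h3⟩)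
      exacts [⟨Or.inl rfl, hc, hf.1⟩, ⟨Or.inr h1, h2, h3⟩]
    · rintro ⟨rfl | h1, h2, h3⟩
      exacts [Or.inl ⟨rfl, h3.symm.trans hf.1⟩, Or.inr ⟨h1, h2, h3⟩]

theorem isPathTo_singleton_of_nodup {l : List α} (hl : l.Nodup) {b : α}
    (hb : l.getLast? = some b) : IsPathTo {b} l := by
  induction l with
  | nil => simp at hb
  | cons a l ih =>
    cases l with
    | nil => exact .singleton (Option.some.inj hb)
    | cons c l =>
      rw [List.getLast?_cons_cons] at hb
      rw [List.nodup_cons] at hl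
      refine .cons ?_ hl.1 (ih hl.2 hb)
      rintro rfl
      exact hl.1 (List.mem_of_getLast? hb)

theorem IsPathTo.reverse {l : List α} {r z : α} (hl : IsPathTo {r} l) (hz : l.head? = some z) :
    IsPathTo {z} l.reverse ∧ l.reverse.head? = some r := by
  refine ⟨isPathTo_singleton_of_nodup (List.nodup_reverse.2 hl.nodup) (by simpa using hz), ?_⟩
  obtain ⟨b, rfl, h⟩ := hl.exists_getLast?
  simpa using h

theorem IsPathTo.reverse_of_head? {l : List α} {r : α} (hl : IsPathTo A l)
    (hr : l.head? = some r) : IsPathTo {r} l.reverse :=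
  isPathTo_singleton_of_nodup (List.nodup_reverse.2 hl.nodup) (by simpa using hr)

theorem IsPathTo.eq_of_isChain {l l' : List α} (hl : IsPathTo A l) (hl' : IsPathTo A l')
    {f : α → α} (hf : l.IsChain fun a b => f a = b) (hf' : l'.IsChain fun a b => f a = b)
    (h : l.head? = l'.head?) : l = l' := by
  induction hl generalizing l' with
  | @singleton b hb =>
    cases hl' with
    | singleton hc => simpa using h
    | cons hc _ _ => rw [List.head?_cons, List.head?_cons] at h; exact absurd (Option.some.inj h ▸ hb) hc
  | @cons a l ha hal hl ih =>
    cases hl' with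
    | singleton hc => rw [List.head?_cons, List.head?_cons] at h; exact absurd (Option.some.inj h ▸ hc) ha
    | cons hc hcl hl' =>
      obtain ⟨d, l, rfl⟩ := List.exists_cons_of_ne_nil hl.ne_nil
      obtain ⟨d', l', rfl⟩ := List.exists_cons_of_ne_nil hl'.ne_nil
      rw [List.isChain_cons_cons] at hf hf'
      have h := Option.some.inj h
      subst h
      rw [ih hl' hf.2 hf'.2 (by rw [List.head?_cons, List.head?_cons, ← hf.1, ← hf'.1])]

end ListEdges

/-! ### Trees as parent functions, and the paths that they dictate to Wilson's method -/

section Rooted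

variable {M : Type*}

/-- The parent function of a spanning tree oriented towards `r`: the root is its own parent, and
each vertex has `r` among its ancestors. -/
def IsRootedAt (r : M) (f : M → M) : Prop := f r = r ∧ ∀ m, ∃ k, f^[k] m = r

theorem IsRootedAt.exists_path {r : M} {f : M → M} (hf : IsRootedAt r f) {A : Set M} (hA : r ∈ A)
    (s : M) : ∃ l, IsPathTo A l ∧ l.head? = some s ∧ l.IsChain fun a b => f a = b := by
  classical
  set rank : M → ℕ := fun m => Nat.find (hf.2 m) with hrank
  -- The number of steps to the root decreases from child to parent; the bound on it shows that `s`
  -- does not reappear among its proper ancestors.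
  suffices h : ∀ k s, rank s = k → ∃ l, IsPathTo A l ∧ l.head? = some s ∧
      (l.IsChain fun a b => f a = b) ∧ ∀ m ∈ l, rank m ≤ k by
    obtain ⟨l, h1, h2, h3, -⟩ := h _ s rfl
    exact ⟨l, h1, h2, h3⟩
  intro k
  induction k using Nat.strong_induction_on with
  | _ k ih =>
    rintro s rfl
    by_cases hs : s ∈ A
    · exact ⟨[s], .singleton hs, rfl, by simp, by simp⟩
    · have hlt : rank (f s) < rank s := by
        have h1 : f^[rank s] s = r := Nat.find_spec (hf.2 s)
        cases h2 : rank s with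
        | zero =>
          rw [h2] at h1
          exact absurd ((show s = r from h1) ▸ hA) hs
        | succ k =>
          rw [h2] at h1
          exact Nat.lt_succ_of_le (Nat.find_min' (hf.2 (f s)) h1)
      obtain ⟨l, h1, h2, h3, h4⟩ := ih _ hlt (f s) rfl
      obtain ⟨d, l, rfl⟩ := List.exists_cons_of_ne_nil h1.ne_nil
      obtain rfl : d = f s := Option.some.inj h2
      refine ⟨s :: f s :: l, .cons hs (fun h => absurd (h4 s h) (not_le.2 hlt)) h1, rfl,
        List.isChain_cons_cons.2 ⟨rfl, h3⟩, ?_⟩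
      intro m hm
      rcases List.mem_cons.1 hm with rfl | hm
      exacts [le_rfl, (h4 m hm).trans hlt.le]

open Classical in
/-- The path of ancestors of `s` up to the first one in `A`. -/
noncomputable def ancestors (f : M → M) (A : Set M) (s : M) : List M :=
  if h : ∃ l, IsPathTo A l ∧ l.head? = some s ∧ l.IsChain fun a b => f a = b then h.choose else []

theorem IsRootedAt.ancestors_spec {r : M} {f : M → M} (hf : IsRootedAt r f) {A : Set M}
    (hA : r ∈ A) (s : M) : IsPathTo A (ancestors f A s) ∧ (ancestors f A s).head? = some s ∧
      (ancestors f A s).IsChain fun a b => f a = b := by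
  rw [ancestors, dif_pos (hf.exists_path hA s)]
  exact (hf.exists_path hA s).choose_spec

theorem IsRootedAt.eq_ancestors {r : M} {f : M → M} (hf : IsRootedAt r f) {A : Set M}
    (hA : r ∈ A) {s : M} {l : List M} (h1 : IsPathTo A l) (h2 : l.head? = some s)
    (h3 : l.IsChain fun a b => f a = b) : l = ancestors f A s :=
  have h := hf.ancestors_spec hA s
  h1.eq_of_isChain h.1 h3 h.2.2 (h2.trans h.2.1.symm)

/-- The vertices of the successive forests of Wilson's method, when the resulting tree has the
parent function `f`. -/
noncomputable def treeVerts (f : M → M) (r z : M) (s : ℕ → M) : ℕ → Set M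
  | 0 => {m | m ∈ ancestors f {r} z}
  | i + 1 => treeVerts f r z s i ∪ {m | m ∈ ancestors f (treeVerts f r z s i) (s i)}

/-- The set on which the `i`-th walk is stopped, when the resulting tree has the parent function
`f`. -/
noncomputable def treeTarget (f : M → M) (r z : M) (s : ℕ → M) : ℕ → Set M
  | 0 => {z}
  | i + 1 => treeVerts f r z s i

/-- The loop erasure of the `i`-th walk, when the resulting tree has the parent function `f`. -/
noncomputable def treePath (f : M → M) (r z : M) (s : ℕ → M) : ℕ → List M
  | 0 => (ancestors f {r} z).reverse
  | i + 1 => ancestors f (treeVerts f r z s i) (s i)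

variable {f : M → M} {r z : M} {s : ℕ → M}

theorem IsRootedAt.root_mem_treeVerts (hf : IsRootedAt r f) (i : ℕ) : r ∈ treeVerts f r z s i := by
  induction i with
  | zero =>
    obtain ⟨b, rfl, h⟩ := (hf.ancestors_spec (Set.mem_singleton r) z).1.exists_getLast?
    exact List.mem_of_getLast? h
  | succ i ih => exact Or.inl ih

theorem IsRootedAt.boundary_mem_treeVerts (hf : IsRootedAt r f) (i : ℕ) :
    z ∈ treeVerts f r z s i := by
  induction i with
  | zero => exact List.mem_of_head? (hf.ancestors_spec (Set.mem_singleton r) z).2.1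
  | succ i ih => exact Or.inl ih

theorem IsRootedAt.boundary_mem_treeTarget (hf : IsRootedAt r f) (i : ℕ) :
    z ∈ treeTarget f r z s i := by
  cases i with
  | zero => exact rfl
  | succ i => exact hf.boundary_mem_treeVerts i

theorem IsRootedAt.treePath_spec (hf : IsRootedAt r f) (i : ℕ) :
    IsPathTo (treeTarget f r z s i) (treePath f r z s i) ∧
      (treePath f r z s i).head? = some (Nat.casesOn i r s) ∧
      treeTarget f r z s i ∪ {m | m ∈ treePath f r z s i} = treeVerts f r z s i := by
  cases i with
  | zero =>
    have h := hf.ancestors_spec (Set.mem_singleton r) z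
    refine ⟨(h.1.reverse h.2.1).1, (h.1.reverse h.2.1).2, ?_⟩
    ext m
    simp only [treeTarget, treePath, treeVerts, Set.mem_union, Set.mem_singleton_iff,
      Set.mem_ofPred_eq, List.mem_reverse, or_iff_right_iff_imp]
    rintro rfl
    exact List.mem_of_head? h.2.1
  | succ i =>
    have h := hf.ancestors_spec (hf.root_mem_treeVerts (z := z) (s := s) i) (s i)
    exact ⟨h.1, h.2.1, rfl⟩

theorem treeEdges_union {A : Set M} (hf : IsRootedAt r f) (hA : r ∈ A) (v : M) :
    {e : M × M | e.1 ∈ A ∧ e.1 ≠ r ∧ f e.1 = e.2} ∪ listEdges (ancestors f A v) =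
      {e | e.1 ∈ A ∪ {m | m ∈ ancestors f A v} ∧ e.1 ≠ r ∧ f e.1 = e.2} := by
  have h := hf.ancestors_spec hA v
  rw [h.1.listEdges_eq h.2.2]
  ext e
  simp only [Set.mem_union, Set.mem_ofPred_eq]
  have : e.1 ∉ A → e.1 ≠ r := fun h1 h2 => h1 (h2 ▸ hA)
  tauto

theorem reversedPathEdges_getElem? (l : List M) :
    reversedPathEdges (fun i => l[i]?) = listEdges l.reverse := by
  ext ⟨a, b⟩
  rw [mem_listEdges_reverse]
  exact Iff.rfl

/-- Wilson's method yields the tree with parent function `f` if each loop erasure is the right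
one. -/
theorem IsRootedAt.stoppedStage_eq (hf : IsRootedAt r f) {Y : ℕ → ℕ → M} {i : ℕ}
    (h : ∀ j ≤ i, ErasesTo (treeTarget f r z s j) (Y j) (treePath f r z s j)) :
    (stoppedStage {z} Y i).verts = treeVerts f r z s i ∧
      (stoppedStage {z} Y i).edges =
        {e | e.1 ∈ treeVerts f r z s i ∧ e.1 ≠ r ∧ f e.1 = e.2} := by
  induction i with
  | zero =>
    have h0 := funext (h 0 le_rfl)
    simp only [treeTarget] at h0
    simp only [stoppedStage, h0, pathVerts_getElem?, reversedPathEdges_getElem?]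
    refine ⟨?_, ?_⟩
    · ext m; simp [treePath, treeVerts]
    · have h1 := hf.ancestors_spec (Set.mem_singleton r) z
      rw [treePath, List.reverse_reverse, h1.1.listEdges_eq h1.2.2]
      rfl
  | succ i ih =>
    obtain ⟨h1, h2⟩ := ih fun j hj => h j (hj.trans (Nat.le_succ i))
    have h0 := funext (h (i + 1) le_rfl)
    simp only [treeTarget] at h0
    -- From stage `0` on the boundary vertex is in the tree, so stopping on it changes nothing.
    have hu : treeVerts f r z s i ∪ {z} = treeVerts f r z s i :=
      Set.union_eq_self_of_subset_right
        (Set.singleton_subset_iff.2 (hf.boundary_mem_treeVerts i))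
    simp only [stoppedStage, h1, hu, h0, pathVerts_getElem?, h2]
    exact ⟨rfl, treeEdges_union hf (hf.root_mem_treeVerts i) (s i)⟩

/-- `E` is the set of edges of a tree with the set of vertices `A` that is oriented towards `r`. -/
structure IsTreeOn (r : M) (A : Set M) (E : Set (M × M)) : Prop where
  root_mem : r ∈ A
  mem : ∀ e ∈ E, e.1 ∈ A ∧ e.2 ∈ A ∧ e.1 ≠ r
  functional : ∀ a b b', (a, b) ∈ E → (a, b') ∈ E → b = b'
  reach : ∀ m ∈ A, Relation.ReflTransGen (fun a b => (a, b) ∈ E) m r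

theorem isTreeOn_singleton (r : M) : IsTreeOn r {r} ∅ :=
  ⟨rfl, fun _ h => h.elim, fun _ _ _ h => h.elim, fun m hm => by
    rw [Set.mem_singleton_iff.1 hm]⟩

theorem IsTreeOn.union {A : Set M} {E : Set (M × M)} (h : IsTreeOn r A E) {l : List M}
    (hl : IsPathTo A l) : IsTreeOn r (A ∪ {m | m ∈ l}) (E ∪ listEdges l) where
  root_mem := Or.inl h.root_mem
  mem := by
    rintro e (he | he)
    · exact ⟨Or.inl (h.mem e he).1, Or.inl (h.mem e he).2.1, (h.mem e he).2.2⟩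
    · refine ⟨Or.inr (mem_of_mem_listEdges he).1, Or.inr (mem_of_mem_listEdges he).2, ?_⟩
      intro her
      exact hl.notMem_of_mem_listEdges he (her ▸ h.root_mem)
  functional := by
    rintro a b b' (h1 | h1) (h2 | h2)
    · exact h.functional a b b' h1 h2
    · exact absurd (h.mem (a, b) h1).1 (hl.notMem_of_mem_listEdges (e := (a, b')) h2)
    · exact absurd (h.mem (a, b') h2).1 (hl.notMem_of_mem_listEdges (e := (a, b)) h1)
    · exact hl.listEdges_functional h1 h2
  reach := by
    have hA : ∀ m ∈ A, Relation.ReflTransGen (fun a b => (a, b) ∈ E ∪ listEdges l) m r :=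
      fun m hm =>
      Relation.ReflTransGen.mono (r := fun a b => (a, b) ∈ E) (fun _ _ hab => Or.inl hab) _ _
        (h.reach m hm)
    rintro m (hm | hm)
    · exact hA m hm
    · exact hl.reflTransGen (fun a b hab => Or.inr hab) hA m hm

theorem exists_hittingTimeOf_eq {x : ℕ → M} {A : Set M} (h : ∃ n, x n ∈ A) :
    ∃ n : ℕ, hittingTimeOf x A = n := by
  classical
  exact ⟨Nat.find h, hittingTimeOf_eq_natCast.2 ⟨fun m hm => Nat.find_min h hm, Nat.find_spec h⟩⟩

/-- Since `z` is in the tree from the start and each walk hits it, every loop erasure is a finite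
path. The first one runs from `r` to `z`, and its reversal is oriented towards `r`; each later one
is grafted at its end. -/
theorem isTreeOn_stoppedStage {Y : ℕ → ℕ → M} (hr : Y 0 0 = r) (hY : ∀ j, ∃ n, Y j n = z) (i : ℕ) :
    z ∈ (stoppedStage {z} Y i).verts ∧
      IsTreeOn r (stoppedStage {z} Y i).verts (stoppedStage {z} Y i).edges := by
  induction i with
  | zero =>
    obtain ⟨n, hn⟩ := exists_hittingTimeOf_eq (x := Y 0) (A := {z}) (hY 0)
    obtain ⟨l, h1, h2, h3, h4⟩ := exists_erasesTo hn
    have h0 := funext h1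
    simp only [stoppedStage, h0, pathVerts_getElem?, reversedPathEdges_getElem?]
    rw [(hittingTimeOf_eq_natCast.1 hn).2] at h4
    refine ⟨List.mem_of_getLast? h4, ?_⟩
    have h5 : IsPathTo {r} l.reverse := (h2.reverse_of_head? (by rw [h3, hr]))
    have := (isTreeOn_singleton r).union h5
    rw [Set.empty_union] at this
    convert this using 1
    ext m
    simp only [Set.mem_ofPred_eq, Set.mem_union, List.mem_reverse, Set.mem_singleton_iff]
    refine ⟨Or.inr, ?_⟩
    rintro (rfl | h)
    · rw [hr] at h3; exact List.mem_of_head? h3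
    · exact h
  | succ i ih =>
    obtain ⟨hz, hT⟩ := ih
    have hu : (stoppedStage {z} Y i).verts ∪ {z} = (stoppedStage {z} Y i).verts :=
      Set.union_eq_self_of_subset_right (Set.singleton_subset_iff.2 hz)
    obtain ⟨n, hn⟩ := exists_hittingTimeOf_eq (x := Y (i + 1)) (A := (stoppedStage {z} Y i).verts)
      ((hY (i + 1)).imp fun n hn => by rwa [hn])
    obtain ⟨l, h1, h2, -⟩ := exists_erasesTo hn
    have h0 := funext h1
    simp only [stoppedStage, hu, h0, pathVerts_getElem?]
    exact ⟨Or.inl hz, hT.union h2⟩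

theorem IsTreeOn.exists_isRootedAt {E : Set (M × M)} (h : IsTreeOn r Set.univ E) :
    ∃ f, IsRootedAt r f ∧ ∀ a b, (a, b) ∈ E → f a = b := by
  classical
  set f : M → M := fun a => if h : ∃ b, (a, b) ∈ E then h.choose else a with hf
  have hE : ∀ a b, (a, b) ∈ E → f a = b := by
    intro a b hab
    have h1 : ∃ b, (a, b) ∈ E := ⟨b, hab⟩
    simp only [hf, dif_pos h1]
    exact h.functional _ _ _ h1.choose_spec hab
  refine ⟨f, ⟨?_, fun m => ?_⟩, hE⟩
  · have : ¬ ∃ b, (r, b) ∈ E := fun ⟨b, hb⟩ => (h.mem _ hb).2.2 rfl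
    simp only [hf, dif_neg this]
  · refine Relation.ReflTransGen.head_induction_on (h.reach m (Set.mem_univ m)) ⟨0, rfl⟩ ?_
    rintro a b hab - ⟨k, hk⟩
    exact ⟨k + 1, by rw [Function.iterate_succ_apply, hE a b hab, hk]⟩

/-- If all the walks hit the boundary, then Wilson's method yields a tree. -/
theorem exists_isRootedAt_erasesTo {Y : ℕ → ℕ → M} (hr : Y 0 0 = r) (hs : ∀ j, Y (j + 1) 0 = s j)
    (hY : ∀ j, ∃ n, Y j n = z) {i : ℕ} (hi : (stoppedStage {z} Y i).verts = Set.univ) :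
    ∃ f, IsRootedAt r f ∧
      ∀ j ≤ i, ErasesTo (treeTarget f r z s j) (Y j) (treePath f r z s j) := by
  have hT := (isTreeOn_stoppedStage hr hY i).2
  rw [hi] at hT
  obtain ⟨f, hf, hE⟩ := hT.exists_isRootedAt
  refine ⟨f, hf, ?_⟩
  intro j
  induction j using Nat.strong_induction_on with
  | _ j ih =>
    intro hji
    cases j with
    | zero =>
      obtain ⟨n, hn⟩ := exists_hittingTimeOf_eq (x := Y 0) (A := {z}) (hY 0)
      obtain ⟨l, h1, h2, h3, h4⟩ := exists_erasesTo hn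
      rw [(hittingTimeOf_eq_natCast.1 hn).2] at h4
      have h0 := funext h1
      have h5 : listEdges l.reverse ⊆ (stoppedStage {z} Y 0).edges := by
        simp only [stoppedStage, h0, reversedPathEdges_getElem?, subset_rfl]
      have h6 := h2.reverse_of_head? (by rw [h3, hr])
      -- The edges of the final tree determine `f`, and the edges laid at this stage are among them;
      -- so the path follows parents, and such paths are unique.
      have h7 := hf.eq_ancestors (Set.mem_singleton r) h6 (by rw [List.head?_reverse, h4])
        (isChain_of_listEdges fun a b hab =>
          hE a b (stoppedStage_edges_mono {z} Y (Nat.zero_le i) (h5 hab)))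
      rw [treePath, ← h7, List.reverse_reverse]
      exact h1
    | succ j =>
      have h1 := (hf.stoppedStage_eq (i := j) (z := z) (s := s) (Y := Y) fun k hk =>
        ih k (Nat.lt_succ_of_le hk) (by omega)).1
      have hz := (isTreeOn_stoppedStage hr hY j).1
      have hu : (stoppedStage {z} Y j).verts ∪ {z} = (stoppedStage {z} Y j).verts :=
        Set.union_eq_self_of_subset_right (Set.singleton_subset_iff.2 hz)
      obtain ⟨n, hn⟩ := exists_hittingTimeOf_eq (x := Y (j + 1))
        (A := (stoppedStage {z} Y j).verts) ((hY (j + 1)).imp fun n hn => by rwa [hn])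
      obtain ⟨l, h2, h3, h4, -⟩ := exists_erasesTo hn
      have h0 := funext h2
      have h5 : listEdges l ⊆ (stoppedStage {z} Y (j + 1)).edges := by
        simp only [stoppedStage, hu, h0]
        exact Set.subset_union_right
      rw [h1] at h2 h3
      have h7 := hf.eq_ancestors (hf.root_mem_treeVerts j) h3 (h4.trans (congrArg some (hs j)))
        (isChain_of_listEdges fun a b hab => hE a b (stoppedStage_edges_mono {z} Y hji (h5 hab)))
      rw [treePath, ← h7]
      exact h2

end Rooted

/-! ### From transition probabilities along paths to the weight of a tree -/

section Weights

variable {M : Type*}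

theorem Matrix.pathProd_append (c : Matrix M M ℝ) (l : List M) (a b : M) :
    c.pathProd (l ++ [a, b]) = c.pathProd (l ++ [a]) * c a b := by
  induction l with
  | nil => simp [Matrix.pathProd]
  | cons d l ih =>
    cases l with
    | nil => simp [Matrix.pathProd]
    | cons e l =>
      simp only [List.cons_append, Matrix.pathProd] at ih ⊢
      rw [ih, mul_assoc]

/-- This is where the reversibility of the walk enters: it permits the first path to be run from the
root. -/
theorem Matrix.pathProd_reverse {c : Matrix M M ℝ} (hc : ∀ a b, c a b = c b a) (l : List M) :
    c.pathProd l.reverse = c.pathProd l := by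
  induction l with
  | nil => rfl
  | cons a l ih =>
    cases l with
    | nil => rfl
    | cons b l =>
      rw [List.reverse_cons, List.reverse_cons, List.append_assoc, List.singleton_append,
        Matrix.pathProd_append, ← List.reverse_cons, ih, hc b a, Matrix.pathProd, mul_comm]

variable [Fintype M]

open Classical in
theorem IsPathTo.prod_cons {A : Set M} {a : M} {l : List M} (ha : a ∉ A) (hal : a ∉ l)
    (g : M → ℝ) : ∏ m with m ∈ a :: l ∧ m ∉ A, g m = g a * ∏ m with m ∈ l ∧ m ∉ A, g m := by
  rw [← Finset.prod_insert (by simp [hal])]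
  refine Finset.prod_congr ?_ fun _ _ => rfl
  ext m
  simp only [Finset.mem_filter, Finset.mem_univ, true_and, List.mem_cons, Finset.mem_insert]
  constructor
  · rintro ⟨rfl | h, h'⟩
    exacts [Or.inl rfl, Or.inr ⟨h, h'⟩]
  · rintro (rfl | ⟨h, h'⟩)
    exacts [⟨Or.inl rfl, ha⟩, ⟨Or.inr h, h'⟩]

open Classical in
theorem IsPathTo.prod_singleton {A : Set M} {a : M} (ha : a ∈ A) (g : M → ℝ) :
    ∏ m with m ∈ [a] ∧ m ∉ A, g m = 1 := by
  refine Finset.prod_eq_one fun m hm => ?_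
  obtain ⟨h1, h2⟩ := (Finset.mem_filter.1 hm).2
  exact absurd (List.mem_singleton.1 h1 ▸ ha) h2

open Classical in
theorem IsPathTo.pathProd_mul {A : Set M} {l : List M} (hl : IsPathTo A l) {P c : Matrix M M ℝ}
    {π : M → ℝ} (h : ∀ a ∉ A, ∀ b, P a b * π a = c a b) :
    P.pathProd l * ∏ m with m ∈ l ∧ m ∉ A, π m = c.pathProd l := by
  induction hl with
  | singleton hb => rw [IsPathTo.prod_singleton hb]; simp [Matrix.pathProd]
  | @cons a l ha hal hl ih =>
    obtain ⟨b, l, rfl⟩ := List.exists_cons_of_ne_nil hl.ne_nil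
    rw [IsPathTo.prod_cons ha hal, Matrix.pathProd, Matrix.pathProd, ← ih, ← h a ha]
    ring

open Classical in
theorem IsPathTo.pathProd_eq {A : Set M} {l : List M} (hl : IsPathTo A l) (c : Matrix M M ℝ)
    {f : M → M} (hf : l.IsChain fun a b => f a = b) :
    c.pathProd l = ∏ m with m ∈ l ∧ m ∉ A, c m (f m) := by
  induction hl with
  | singleton hb => rw [IsPathTo.prod_singleton hb]; simp [Matrix.pathProd]
  | @cons a l ha hal hl ih =>
    obtain ⟨b, l, rfl⟩ := List.exists_cons_of_ne_nil hl.ne_nil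
    rw [List.isChain_cons_cons] at hf
    rw [IsPathTo.prod_cons ha hal, Matrix.pathProd, ih hf.2, hf.1]

open Classical in
theorem prod_union_path {A B : Set M} {l : List M} (hB : ∀ m, m ∈ B ↔ m ∈ A ∨ m ∈ l) {v : M}
    (hv : v ∈ A) (g : M → ℝ) : ∏ m with m ∈ B ∧ m ≠ v, g m =
      (∏ m with m ∈ A ∧ m ≠ v, g m) * ∏ m with m ∈ l ∧ m ∉ A, g m := by
  rw [← Finset.prod_union]
  · refine Finset.prod_congr ?_ fun _ _ => rfl
    ext m
    simp only [Finset.mem_filter, Finset.mem_univ, true_and, Finset.mem_union, hB]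
    have : m ∉ A → m ≠ v := fun h1 h2 => h1 (h2 ▸ hv)
    tauto
  · refine Finset.disjoint_left.2 fun m h1 h2 => ?_
    exact (Finset.mem_filter.1 h2).2.2 (Finset.mem_filter.1 h1).2.1

-- Each path contributes one transition from each of its vertices but the last. For the paths after
-- the first these are the new vertices of the tree. For the first path, from `r` to `z`, they are
-- all but `z`; after reversal they become all but `r`, each with the edge to its parent.
open Classical in
theorem IsRootedAt.prod_pathProd {f : M → M} {r z : M} (hf : IsRootedAt r f) (s : ℕ → M)
    {P c : Matrix M M ℝ} {π : M → ℝ} (h : ∀ a ≠ z, ∀ b, P a b * π a = c a b)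
    (hc : ∀ a b, c a b = c b a) (i : ℕ) :
    (∏ j ∈ Finset.range (i + 1), P.pathProd (treePath f r z s j)) *
        ∏ m with m ∈ treeVerts f r z s i ∧ m ≠ z, π m =
      ∏ m with m ∈ treeVerts f r z s i ∧ m ≠ r, c m (f m) := by
  induction i with
  | zero =>
    have h1 := hf.ancestors_spec (Set.mem_singleton r) z
    have h2 := (h1.1.reverse h1.2.1).1
    have h3 := h2.pathProd_mul (P := P) (c := c) (π := π) fun a ha b => h a ha b
    rw [Matrix.pathProd_reverse hc, h1.1.pathProd_eq c h1.2.2] at h3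
    simp only [List.mem_reverse] at h3
    have e : ∀ v (g : M → ℝ), ∏ m with m ∈ treeVerts f r z s 0 ∧ m ≠ v, g m =
        ∏ m with m ∈ ancestors f {r} z ∧ m ∉ ({v} : Set M), g m := fun v g =>
      Finset.prod_congr (Finset.filter_congr fun m _ => Iff.rfl) fun _ _ => rfl
    rw [zero_add, Finset.prod_range_one, e, e]
    exact h3
  | succ i ih =>
    have hz := hf.boundary_mem_treeVerts (z := z) (s := s) i
    have hr := hf.root_mem_treeVerts (z := z) (s := s) i
    have h1 := hf.ancestors_spec hr (s i)
    have h2 := h1.1.pathProd_mul (P := P) (c := c) (π := π)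
      fun a ha b => h a (fun h => ha (h ▸ hz)) b
    rw [h1.1.pathProd_eq c h1.2.2] at h2
    have hu : ∀ m, m ∈ treeVerts f r z s (i + 1) ↔
        m ∈ treeVerts f r z s i ∨ m ∈ ancestors f (treeVerts f r z s i) (s i) := fun _ => Iff.rfl
    rw [prod_union_path hu hz, prod_union_path hu hr, ← ih, ← h2, Finset.prod_range_succ _ (i + 1)]
    simp only [treePath]
    ring

end Weights

namespace ElectricalNetwork

/-! ### Oriented spanning trees correspond to parent functions -/

section Trees

variable {M : Type*} [Fintype M] (N : ElectricalNetwork M) {r : M}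

open Classical in
/-- The oriented edges from the vertices other than `r` to their parents. -/
noncomputable def treeDarts (r : M) (f : M → M) : Finset N.graph.Dart :=
  {d | d.fst ≠ r ∧ f d.fst = d.snd}

variable {N}

theorem mem_treeDarts {f : M → M} {d : N.graph.Dart} :
    d ∈ N.treeDarts r f ↔ d.fst ≠ r ∧ f d.fst = d.snd := by
  simp [treeDarts]

theorem exists_mem_treeDarts {f : M → M} (hadj : ∀ m ≠ r, N.graph.Adj m (f m)) {e : M × M} :
    (∃ d ∈ N.treeDarts r f, d.toProd = e) ↔ e.1 ≠ r ∧ f e.1 = e.2 := by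
  constructor
  · rintro ⟨d, hd, rfl⟩
    exact mem_treeDarts.1 hd
  · rintro ⟨h1, h2⟩
    obtain ⟨a, b⟩ := e
    simp only at h1 h2
    subst h2
    exact ⟨⟨(a, f a), hadj a h1⟩, mem_treeDarts.2 ⟨h1, rfl⟩, rfl⟩

/-- Every vertex has at most one outgoing edge and the root has none, so a directed path to the root
is forced and cannot go on beyond it. -/
theorem isOrientedSpanningTree_treeDarts {f : M → M} (hf : IsRootedAt r f)
    (hadj : ∀ m ≠ r, N.graph.Adj m (f m)) : N.IsOrientedSpanningTree r (N.treeDarts r f) := by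
  intro x
  simp only [exists_mem_treeDarts hadj]
  obtain ⟨h1, h2, h3⟩ := hf.ancestors_spec (Set.mem_singleton r) x
  obtain ⟨b, rfl, h4⟩ := h1.exists_getLast?
  refine ⟨_, ⟨h2, h4, ?_⟩, ?_⟩
  · refine isChain_of_listEdges fun a c hac => ?_
    rw [h1.listEdges_eq h3] at hac
    exact ⟨hac.2.1, hac.2.2⟩
  · have key : ∀ l l' : List M, l.head? = l'.head? → l.getLast? = some b → l'.getLast? = some b →
        (l.IsChain fun a c => a ≠ b ∧ f a = c) → (l'.IsChain fun a c => a ≠ b ∧ f a = c) →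
        l = l' := by
      intro l
      induction l with
      | nil => intro l' _ h; simp at h
      | cons a l ih =>
        intro l' h5 h6 h7 h8 h9
        obtain ⟨a', l', rfl⟩ := List.exists_cons_of_ne_nil (l := l') (by rintro rfl; simp at h7)
        obtain rfl : a = a' := Option.some.inj h5
        rcases l with _ | ⟨d, l⟩ <;> rcases l' with _ | ⟨d', l'⟩
        · rfl
        · exact absurd (Option.some.inj h6) (List.isChain_cons_cons.1 h9).1.1
        · exact absurd (Option.some.inj h7) (List.isChain_cons_cons.1 h8).1.1
        · rw [List.getLast?_cons_cons] at h6 h7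
          rw [List.isChain_cons_cons] at h8 h9
          rw [ih (d' :: l') (by rw [List.head?_cons, List.head?_cons, ← h8.1.2, ← h9.1.2]) h6 h7
            h8.2 h9.2]
    rintro l' ⟨h5, h6, h7⟩
    refine key _ _ (h5.trans h2.symm) h6 h4 h7 ?_
    refine isChain_of_listEdges fun a c hac => ?_
    rw [h1.listEdges_eq h3] at hac
    exact ⟨hac.2.1, hac.2.2⟩

/-- By uniqueness, the path of `a` is `a` followed by the path of `b` whenever there is an edge from
`a` to `b`. So `b` is determined by `a`, and no edge leaves `r`, whose path is trivial. -/
theorem exists_eq_treeDarts {T : Finset N.graph.Dart} (hT : N.IsOrientedSpanningTree r T) :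
    ∃ f, IsRootedAt r f ∧ (∀ m ≠ r, N.graph.Adj m (f m)) ∧ T = N.treeDarts r f := by
  choose p hp hu using hT
  beta_reduce at hu
  have hcons : ∀ a b, (∃ d ∈ T, d.toProd = (a, b)) → p a = a :: p b := by
    intro a b hab
    refine (hu a _ ⟨rfl, ?_, ?_⟩).symm
    · obtain ⟨c, l, hl⟩ := List.exists_cons_of_ne_nil (l := p b)
        (by intro h; have := (hp b).1; simp [h] at this)
      have := (hp b).2.1
      rw [hl] at this ⊢
      rwa [List.getLast?_cons_cons]
    · obtain ⟨c, l, hl⟩ := List.exists_cons_of_ne_nil (l := p b)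
        (by intro h; have := (hp b).1; simp [h] at this)
      have h1 := (hp b).1
      have h2 := (hp b).2.2
      rw [hl] at h1 h2 ⊢
      obtain rfl : c = b := Option.some.inj h1
      exact List.isChain_cons_cons.2 ⟨hab, h2⟩
  have hr : p r = [r] := (hu r [r] ⟨rfl, rfl, by simp⟩).symm
  have hne : ∀ b, p b ≠ [] := by
    intro b h; have := (hp b).1; simp [h] at this
  have htree : IsTreeOn r Set.univ {e | ∃ d ∈ T, d.toProd = e} := by
    refine ⟨Set.mem_univ _, fun e he => ⟨Set.mem_univ _, Set.mem_univ _, ?_⟩, ?_, ?_⟩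
    · rintro h
      have := hcons e.1 e.2 he
      rw [h, hr] at this
      exact hne e.2 (List.cons.inj this).2.symm
    · intro a b b' h h'
      have h1 := (hcons a b h).symm.trans (hcons a b' h')
      have h2 := (hp b).1
      rw [(List.cons.inj h1).2, (hp b').1] at h2
      exact (Option.some.inj h2).symm
    · intro m _
      have key : ∀ (l : List M) m, l.head? = some m → l.getLast? = some r →
          (l.IsChain fun a b => ∃ d ∈ T, d.toProd = (a, b)) →
          Relation.ReflTransGen (fun a b => (a, b) ∈ {e | ∃ d ∈ T, d.toProd = e}) m r := by
        intro l
        induction l with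
        | nil => intro m h; simp at h
        | cons a l ih =>
          intro m h1 h2 h3
          obtain rfl : a = m := Option.some.inj h1
          rcases l with _ | ⟨d, l⟩
          · obtain rfl : a = r := Option.some.inj h2
            exact .refl
          · rw [List.getLast?_cons_cons] at h2
            rw [List.isChain_cons_cons] at h3
            exact .head h3.1 (ih d rfl h2 h3.2)
      exact key _ m (hp m).1 (hp m).2.1 (hp m).2.2
  obtain ⟨f, hf, hE⟩ := htree.exists_isRootedAt
  have hex : ∀ m ≠ r, ∃ d ∈ T, d.toProd = (m, f m) := by
    intro m hm
    rcases Relation.ReflTransGen.cases_head (htree.reach m (Set.mem_univ m)) with h | ⟨b, hb, -⟩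
    · exact absurd h hm
    · rw [hE m b hb]; exact hb
  refine ⟨f, hf, fun m hm => ?_, ?_⟩
  · obtain ⟨d, -, hd⟩ := hex m hm
    have := d.adj
    rwa [show d.fst = m from congrArg Prod.fst hd, show d.snd = f m from congrArg Prod.snd hd]
      at this
  · ext d
    rw [mem_treeDarts]
    constructor
    · intro hd
      have hd' : (d.fst, d.snd) ∈ {e | ∃ d ∈ T, d.toProd = e} := ⟨d, hd, rfl⟩
      exact ⟨(htree.mem _ hd').2.2, hE _ _ hd'⟩
    · rintro ⟨h1, h2⟩
      obtain ⟨d', hd', h3⟩ := hex d.fst h1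
      have : d' = d := SimpleGraph.Dart.ext _ _ (h3.trans (by rw [h2]))
      rwa [← this]

open Classical in
theorem weight_treeDarts {f : M → M} (hadj : ∀ m ≠ r, N.graph.Adj m (f m)) :
    N.weight (N.treeDarts r f) = ∏ m with m ≠ r, N.cond m (f m) := by
  refine Finset.prod_nbij (fun d => d.fst) ?_ ?_ ?_ ?_
  · intro d hd
    simpa using (mem_treeDarts.1 hd).1
  · intro d hd d' hd' h
    have h : d.fst = d'.fst := h
    refine SimpleGraph.Dart.ext _ _ (Prod.ext h ?_)
    exact ((mem_treeDarts.1 hd).2.symm.trans (congrArg f h)).trans (mem_treeDarts.1 hd').2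
  · intro m hm
    have hm : m ≠ r := by simpa using hm
    exact ⟨⟨(m, f m), hadj m hm⟩, mem_treeDarts.2 ⟨hm, rfl⟩, rfl⟩
  · intro d hd
    rw [(mem_treeDarts.1 hd).2]

-- Parent functions that use a non-edge may be included in the sum, as their product has a factor
-- `0`.
open Classical in
theorem finsum_weight (N : ElectricalNetwork M) (r : M) (B : Set (M × M)) :
    ∑ᶠ T ∈ {T : Finset N.graph.Dart | N.IsOrientedSpanningTree r T ∧
        T ∈ {T | ∀ e ∈ B, ∃ t ∈ T, t.toProd = e}}, N.weight T =
      ∑ f with IsRootedAt r f ∧ B ⊆ {e | e.1 ≠ r ∧ f e.1 = e.2},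
        ∏ m with m ≠ r, N.cond m (f m) := by
  set F : Set (M → M) := {f | IsRootedAt r f ∧ (∀ m ≠ r, N.graph.Adj m (f m)) ∧
    B ⊆ {e | e.1 ≠ r ∧ f e.1 = e.2}} with hF
  have himg : {T : Finset N.graph.Dart | N.IsOrientedSpanningTree r T ∧
      T ∈ {T | ∀ e ∈ B, ∃ t ∈ T, t.toProd = e}} = N.treeDarts r '' F := by
    ext T
    constructor
    · rintro ⟨h1, h2⟩
      obtain ⟨f, hf, hadj, rfl⟩ := exists_eq_treeDarts h1
      exact ⟨f, ⟨hf, hadj, fun e he => (exists_mem_treeDarts hadj).1 (h2 e he)⟩, rfl⟩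
    · rintro ⟨f, ⟨hf, hadj, hB⟩, rfl⟩
      exact ⟨isOrientedSpanningTree_treeDarts hf hadj,
        fun e he => (exists_mem_treeDarts hadj).2 (hB he)⟩
  have hinj : Set.InjOn (N.treeDarts r) F := by
    rintro f ⟨hf, hadj, -⟩ g ⟨hg, hadj', -⟩ h
    ext m
    by_cases hm : m = r
    · rw [hm, hf.1, hg.1]
    · have : (⟨(m, f m), hadj m hm⟩ : N.graph.Dart) ∈ N.treeDarts r f :=
        mem_treeDarts.2 ⟨hm, rfl⟩
      rw [h, mem_treeDarts] at this
      exact this.2.symm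
  rw [himg, finsum_mem_image hinj, finsum_mem_eq_finite_toFinset_sum _ (Set.toFinite F)]
  rw [Finset.sum_congr rfl fun f hf => weight_treeDarts ((Set.Finite.mem_toFinset _).1 hf).2.1]
  refine Finset.sum_subset ?_ ?_
  · intro f hf
    have := (Set.Finite.mem_toFinset _).1 hf
    simp only [Finset.mem_filter, Finset.mem_univ, true_and]
    exact ⟨this.1, this.2.2⟩
  · intro f hf hf'
    simp only [Finset.mem_filter, Finset.mem_univ, true_and] at hf
    rw [Set.Finite.mem_toFinset] at hf'
    have : ¬ ∀ m ≠ r, N.graph.Adj m (f m) := fun h => hf' ⟨hf.1, h, hf.2⟩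
    push Not at this
    obtain ⟨m, hm, hadj⟩ := this
    exact Finset.prod_eq_zero (i := m) (by simpa using hm) (N.cond_eq_zero m (f m) hadj)

end Trees

end ElectricalNetwork

/-! ### All vertices are covered once the walks from all of them have been used -/

section

variable {M : Type*} {f : M → M} {r z : M} {s : ℕ → M}

theorem exists_notMem_of_finite_visits {ω : ℕ → M} (h : ∀ v, {i | ω i = v}.Finite)
    (W : Finset M) : ∃ n, ω n ∉ W := by
  by_contra hW
  push Not at hW
  have h1 : (⋃ v ∈ W, {i | ω i = v}).Finite := Set.Finite.biUnion W.finite_toSet fun v _ => h v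
  refine Set.infinite_univ (h1.subset fun i _ => ?_)
  exact Set.mem_biUnion (hW i) rfl

theorem treeVerts_mono : Monotone (treeVerts f r z s) :=
  monotone_nat_of_le_succ fun _ => Set.subset_union_left

theorem IsRootedAt.treeVerts_eq_univ (hf : IsRootedAt r f) {i : ℕ}
    (h : ∀ m, m = r ∨ m = z ∨ ∃ j < i, s j = m) : treeVerts f r z s i = Set.univ := by
  refine Set.eq_univ_of_forall fun m => ?_
  rcases h m with rfl | rfl | ⟨j, hj, rfl⟩
  · exact hf.root_mem_treeVerts i
  · exact hf.boundary_mem_treeVerts i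
  · refine treeVerts_mono (Nat.succ_le_of_lt hj) (Or.inr ?_)
    exact List.mem_of_head? (hf.ancestors_spec (hf.root_mem_treeVerts j) (s j)).2.1

theorem stoppedStage_verts_eq_univ {Y : ℕ → ℕ → M} (hr : Y 0 0 = r)
    (hs : ∀ j, Y (j + 1) 0 = s j) (hY : ∀ j, ∃ n, Y j n = z) {i : ℕ}
    (h : ∀ m, m = r ∨ m = z ∨ ∃ j < i, s j = m) : (stoppedStage {z} Y i).verts = Set.univ := by
  refine Set.eq_univ_of_forall fun m => ?_
  rcases h m with rfl | rfl | ⟨j, hj, rfl⟩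
  · exact (isTreeOn_stoppedStage hr hY i).2.root_mem
  · exact (isTreeOn_stoppedStage hr hY i).1
  · rw [← hs]
    exact stoppedStage_verts_mono {z} Y (Nat.succ_le_of_lt hj) (start_mem_stoppedStage _ _ _)

end

/-! ### Wilson's algorithm for the wired networks -/

namespace ElectricalNetwork

variable {V : Type*} (N : ElectricalNetwork V)

section Wire

variable {W : Finset V}

theorem wire_eq_wire_iff {v w : V} : wire W v = wire W w ↔ wireFun W v = wireFun W w :=
  Subtype.ext_iff

theorem wire_eq_wire_of_notMem {v w : V} (hw : w ∉ W) : wire W v = wire W w ↔ v ∉ W := by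
  rw [wire_eq_wire_iff]
  by_cases hv : v ∈ W <;> simp [wireFun, hv, hw]

theorem eq_of_wire_eq {v w : V} (hv : v ∈ W) (h : wire W v = wire W w) : v = w := by
  rw [wire_eq_wire_iff] at h
  by_cases hw : w ∈ W
  · simpa [wireFun, hv, hw] using h
  · simp [wireFun, hv, hw] at h

/-- The sum of the conductances at a vertex of the wired network (`1` at the boundary). -/
noncomputable def wiredTotal (W : Finset V) (a : WiredVertex W) : ℝ :=
  match a.1 with
  | some x => ∑ y ∈ N.nbhd x, N.cond x y
  | none => 1

/-- The transition probabilities of the walk on the wired network. -/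
noncomputable def wiredMatrix (W : Finset V) : Matrix (WiredVertex W) (WiredVertex W) ℝ :=
  fun a b => N.wiredCond W a.1 b.1 / N.wiredTotal W a

-- Wiring keeps the total conductance at a vertex of `W` and merges its edges to the outside, so the
-- walk satisfies the hypothesis `hP` of the preceding computations.
open Classical in
theorem sum_transProb_wire {x : V} (hx : x ∈ W) (m : WiredVertex W) :
    ∑ v ∈ N.nbhd x with wire W v = m, N.transProb x v = N.wiredMatrix W (wire W x) m := by
  obtain ⟨w, rfl⟩ := wire_surjective W m
  simp only [transProb]
  rw [← Finset.sum_div]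
  have hx' : (wire W x).1 = some x := by simp [wire, wireFun, hx]
  simp only [wiredMatrix, wiredTotal, hx']
  congr 1
  by_cases hw : w ∈ W
  · have hw' : (wire W w).1 = some w := by simp [wire, wireFun, hw]
    simp only [hw', wiredCond]
    have : ∀ v, wire W v = wire W w ↔ v = w := fun v =>
      ⟨fun h => (eq_of_wire_eq hw h.symm).symm, fun h => h ▸ rfl⟩
    simp only [this, Finset.sum_filter, Finset.sum_ite_eq']
    split_ifs with h
    · rfl
    · exact (N.cond_eq_zero x w fun h' => h (N.mem_nbhd.2 h')).symm
  · have hw' : (wire W w).1 = none := by simp [wire, wireFun, hw]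
    simp only [hw', wiredCond, wire_eq_wire_of_notMem hw]

end Wire

variable [MeasurableSpace V] [DiscreteMeasurableSpace V] {N}

theorem wilsonLaw_ae {r : V} {ord : ℕ ≃ {v : V // v ≠ r}} (j : ℕ) {p : (ℕ → V) → Prop}
    (h : ∀ᵐ ω ∂N.walkLaw (wilsonStart r ord j), p ω) : ∀ᵐ X ∂N.wilsonLaw r ord, p (X j) :=
  (measurePreserving_eval_infinitePi (fun j => N.walkLaw (wilsonStart r ord j))
    j).quasiMeasurePreserving.ae h

theorem IsTransient.wilsonLaw_ae_finite (hN : N.IsTransient) (r : V)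
    (ord : ℕ ≃ {v : V // v ≠ r}) :
    ∀ᵐ X ∂N.wilsonLaw r ord, ∀ (j : ℕ) (v : V), {i | X j i = v}.Finite :=
  ae_all_iff.2 fun j => wilsonLaw_ae j (N.ae_finite_visits hN _)

theorem wilsonLaw_ae_start (r : V) (ord : ℕ ≃ {v : V // v ≠ r}) :
    ∀ᵐ X ∂N.wilsonLaw r ord, ∀ j, X j 0 = wilsonStart r ord j :=
  ae_all_iff.2 fun j => wilsonLaw_ae (p := fun ω => ω 0 = wilsonStart r ord j) j
    (N.ae_walkLaw_zero _)

instance (r : V) (ord : ℕ ≃ {v : V // v ≠ r}) : IsProbabilityMeasure (N.wilsonLaw r ord) := by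
  unfold wilsonLaw; infer_instance

open Classical in
/-- Wilson's algorithm: the forest obtained by stopping the walks when they leave `W` is
distributed as the random spanning tree of the network wired outside `W`. -/
theorem IsTransient.wiredTreeProb_eq (hN : N.IsTransient) {W : Finset V} {r : V} (hr : r ∈ W)
    (ord : ℕ ≃ {v : V // v ≠ r}) (B : Finset N.graph.Dart)
    (hB : ∀ d ∈ B, d.fst ∈ W ∧ d.snd ∈ W) {i : ℕ}
    (hi : ∀ v ∈ W, v = r ∨ ∃ j < i, (ord j : V) = v) :
    N.wiredTreeProb W r B = (N.wilsonLaw r ord).real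
      {X | ∀ d ∈ B, d.toProd ∈ (stoppedStage (W : Set V)ᶜ X i).edges} := by
  have := hN.infinite
  -- An outside vertex exists because a transient network is infinite; it represents the boundary
  -- vertex `z`.
  obtain ⟨o, ho⟩ := Infinite.exists_notMem_finset W
  let _ : Fintype (WiredVertex W) := Fintype.ofFinite _
  set φ := wire W with hφ
  set z := φ o with hz
  have hφz : ∀ v, φ v = z ↔ v ∉ W := fun v => wire_eq_wire_of_notMem ho
  have hinj : ∀ v w, φ v ≠ z → φ v = φ w → v = w := fun v w hv h =>
    eq_of_wire_eq (not_not.1 fun h' => hv ((hφz v).2 h')) h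
  have hsurj := wire_surjective W
  set P := N.wiredMatrix W with hPdef
  have hP : ∀ x, φ x ≠ z → ∀ m, ∑ v ∈ N.nbhd x with φ v = m, N.transProb x v = P (φ x) m :=
    fun x hx m => N.sum_transProb_wire (not_not.1 fun h' => hx ((hφz x).2 h')) m
  set c : Matrix (WiredVertex W) (WiredVertex W) ℝ := fun a b => (N.wired W).cond a b with hc
  set π := N.wiredTotal W with hπ
  have hπ0 : ∀ a, π a ≠ 0 := by
    rintro ⟨_, x, rfl⟩
    by_cases hx : x ∈ W
    · simp only [hπ, wiredTotal, wireFun, hx, if_true]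
      exact (Finset.sum_pos (fun y hy => N.cond_pos x y (N.mem_nbhd.1 hy))
        (hN.nbhd_nonempty x)).ne'
    · simp [hπ, wiredTotal, wireFun, hx]
  have hPc : ∀ a ≠ z, ∀ b, P a b * π a = c a b := fun a _ b => div_mul_cancel₀ _ (hπ0 a)
  set s : ℕ → WiredVertex W := fun j => φ (ord j) with hs
  set μ := N.wilsonLaw r ord with hμ
  have hcover : ∀ m, m = φ r ∨ m = z ∨ ∃ j < i, s j = m := by
    intro m
    obtain ⟨v, rfl⟩ := hsurj m
    by_cases hv : v ∈ W
    · rcases hi v hv with rfl | ⟨j, hj, rfl⟩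
      exacts [Or.inl rfl, Or.inr (Or.inr ⟨j, hj, rfl⟩)]
    · exact Or.inr (Or.inl ((hφz v).2 hv))
  -- The event that the tree with parent function `f` results, written as one condition on each walk
  -- so that independence applies.
  set E : (WiredVertex W → WiredVertex W) → Set (ℕ → ℕ → V) := fun f =>
    {X | ∀ j ≤ i, ErasesTo (treeTarget f (φ r) z s j) (φ ∘ X j) (treePath f (φ r) z s j)} with hE
  have hEm : ∀ f, MeasurableSet (E f) := by
    intro f
    have : E f = ⋂ j, ⋂ (_ : j ≤ i), (fun X : ℕ → ℕ → V => X j) ⁻¹'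
        {ω | ErasesTo (treeTarget f (φ r) z s j) (φ ∘ ω) (treePath f (φ r) z s j)} := by
      ext X; simp [hE]
    rw [this]
    exact MeasurableSet.iInter fun j => MeasurableSet.iInter fun _ =>
      measurable_pi_apply (X := fun _ : ℕ => ℕ → V) j (measurableSet_erasesTo φ _ _)
  have hEedges : ∀ f, IsRootedAt (φ r) f → ∀ X ∈ E f,
      Prod.map φ φ '' (stoppedStage (W : Set V)ᶜ X i).edges =
        {e | e.1 ≠ φ r ∧ f e.1 = e.2} := by
    intro f hf X hX
    rw [← (stoppedStage_comp (z := z) (K := (W : Set V)ᶜ) (by simpa using hφz)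
      (fun v w hv => hinj v w ((hφz v).not.2 (by simpa using hv))) X i).2,
      (hf.stoppedStage_eq hX).2, hf.treeVerts_eq_univ hcover]
    simp
  -- The normalising constant: what the telescoping leaves, times the factors that turn transition
  -- probabilities into conductances.
  set C := (1 - P.killed {z}).det * ∏ m with m ≠ z, π m with hC
  have hC0 : C ≠ 0 := mul_ne_zero (det_one_sub_killed_ne_zero hN hsurj hinj hP rfl)
    (Finset.prod_ne_zero_iff.2 fun m _ => hπ0 m)
  have hEC : ∀ f, IsRootedAt (φ r) f → μ.real (E f) * C = ∏ m with m ≠ φ r, c m (f m) := by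
    intro f hf
    have h1 : μ.real (E f) = ∏ j ∈ Finset.range (i + 1), (N.walkLaw (wilsonStart r ord j)).real
        {ω | ErasesTo (treeTarget f (φ r) z s j) (φ ∘ ω) (treePath f (φ r) z s j)} := by
      have : E f = Set.pi (Finset.range (i + 1)) fun j =>
          {ω | ErasesTo (treeTarget f (φ r) z s j) (φ ∘ ω) (treePath f (φ r) z s j)} := by
        ext X
        simp [hE, Set.mem_pi]
      rw [measureReal_def, this, hμ, wilsonLaw,
        Measure.infinitePi_pi _ fun j _ => measurableSet_erasesTo φ _ _, ENNReal.toReal_prod]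
      rfl
    -- The determinants telescope, since the vertices covered at stage `k` are the target of walk `k
    -- + 1`.
    have h2 : ∀ k, (∏ j ∈ Finset.range (k + 1), (N.walkLaw (wilsonStart r ord j)).real
        {ω | ErasesTo (treeTarget f (φ r) z s j) (φ ∘ ω) (treePath f (φ r) z s j)}) *
          (1 - P.killed {z}).det =
        (∏ j ∈ Finset.range (k + 1), P.pathProd (treePath f (φ r) z s j)) *
          (1 - P.killed (treeVerts f (φ r) z s k)).det := by
      have h3 : ∀ j, (N.walkLaw (wilsonStart r ord j)).real
          {ω | ErasesTo (treeTarget f (φ r) z s j) (φ ∘ ω) (treePath f (φ r) z s j)} *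
            (1 - P.killed (treeTarget f (φ r) z s j)).det =
          P.pathProd (treePath f (φ r) z s j) *
            (1 - P.killed (treeVerts f (φ r) z s j)).det := by
        intro j
        obtain ⟨h4, h5, h6⟩ := hf.treePath_spec (z := z) (s := s) j
        rw [← h6]
        refine walkLaw_erasesTo hN hsurj hinj hP (hf.boundary_mem_treeTarget j) h4 ?_
        rw [h5]
        cases j <;> rfl
      intro k
      induction k with
      | zero =>
        rw [zero_add, Finset.prod_range_one, Finset.prod_range_one]
        exact h3 0
      | succ k ih =>
        rw [Finset.prod_range_succ _ (k + 1), Finset.prod_range_succ _ (k + 1), mul_right_comm, ih,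
          mul_assoc, mul_assoc, ← h3 (k + 1), mul_comm (Matrix.det _)]
        rfl
    have h3 := hf.prod_pathProd s hPc (fun a b => (N.wired W).cond_symm a b) i
    have h2 := h2 i
    simp only [hf.treeVerts_eq_univ hcover, Set.mem_univ, true_and] at h3
    rw [hf.treeVerts_eq_univ hcover, Matrix.killed_univ, sub_zero, Matrix.det_one, mul_one,
      ← h1] at h2
    rw [hC, ← mul_assoc, h2, ← h3]
  -- Almost surely every walk leaves the finite set `W`, so that some tree results.
  have hae : ∀ᵐ X ∂μ, ∃ f, IsRootedAt (φ r) f ∧ X ∈ E f := by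
    filter_upwards [hN.wilsonLaw_ae_finite r ord, wilsonLaw_ae_start r ord] with X hX hst
    have hr' : (fun j => φ ∘ X j) 0 0 = φ r := congrArg φ (hst 0)
    have hs' : ∀ j, (fun j => φ ∘ X j) (j + 1) 0 = s j := fun j => congrArg φ (hst (j + 1))
    have hY : ∀ j, ∃ n, (fun j => φ ∘ X j) j n = z := fun j =>
      (exists_notMem_of_finite_visits (hX j) W).imp fun n hn => (hφz _).2 hn
    exact exists_isRootedAt_erasesTo hr' hs' hY (stoppedStage_verts_eq_univ hr' hs' hY hcover)
  -- General in `B`, as `B = ∅` gives the denominator of `treeProb`.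
  have hprob : ∀ B : Finset N.graph.Dart, (∀ d ∈ B, d.fst ∈ W ∧ d.snd ∈ W) →
      (∑ᶠ T ∈ {T : Finset (N.wired W).graph.Dart | (N.wired W).IsOrientedSpanningTree (φ r) T ∧
        T ∈ {T | ∀ d ∈ B, ∃ t ∈ T, t.toProd = (φ d.fst, φ d.snd)}}, (N.wired W).weight T) =
      μ.real {X | ∀ d ∈ B, d.toProd ∈ (stoppedStage (W : Set V)ᶜ X i).edges} * C := by
    intro B hB
    set B' : Set (WiredVertex W × WiredVertex W) :=
      (fun d : N.graph.Dart => (φ d.fst, φ d.snd)) '' B with hB'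
    have h1 : {T : Finset (N.wired W).graph.Dart |
        ∀ d ∈ B, ∃ t ∈ T, t.toProd = (φ d.fst, φ d.snd)} =
        {T | ∀ e ∈ B', ∃ t ∈ T, t.toProd = e} := by
      ext T
      simp [hB']
    rw [h1, finsum_weight]
    have h2 : ∀ f, IsRootedAt (φ r) f → ∀ X ∈ E f,
        ((∀ d ∈ B, d.toProd ∈ (stoppedStage (W : Set V)ᶜ X i).edges) ↔
          B' ⊆ {e | e.1 ≠ φ r ∧ f e.1 = e.2}) := by
      intro f hf X hX
      rw [← hEedges f hf X hX, hB', Set.image_subset_iff]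
      refine forall₂_congr fun d hd => ?_
      constructor
      · intro h
        exact ⟨d.toProd, h, rfl⟩
      · rintro ⟨e, he, h⟩
        -- Both ends of `d` are in `W`, where the identification is injective, so no other edge has
        -- the same image.
        have h5 := eq_of_wire_eq (hB d hd).1 (congrArg Prod.fst h).symm
        have h6 := eq_of_wire_eq (hB d hd).2 (congrArg Prod.snd h).symm
        have : e = d.toProd := Prod.ext h5.symm h6.symm
        rwa [← this]
    have h3 : μ.real {X | ∀ d ∈ B, d.toProd ∈ (stoppedStage (W : Set V)ᶜ X i).edges} =
        ∑ f with IsRootedAt (φ r) f ∧ B' ⊆ {e | e.1 ≠ φ r ∧ f e.1 = e.2}, μ.real (E f) := by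
      rw [← measureReal_biUnion_finset]
      · refine measureReal_congr ?_
        filter_upwards [hae] with X hX
        obtain ⟨f, hf, hX⟩ := hX
        refine propext ⟨fun h => ?_, fun h => ?_⟩
        · refine Set.mem_biUnion (x := f) ?_ hX
          simpa using ⟨hf, (h2 f hf X hX).1 h⟩
        · obtain ⟨g, hg, hX'⟩ := Set.mem_iUnion₂.1 h
          have hg := (Finset.mem_filter.1 hg).2
          exact (h2 g hg.1 X hX').2 hg.2
      · intro f hf g hg hfg
        refine Set.disjoint_left.2 fun X hXf hXg => hfg ?_
        have hf := (Finset.mem_filter.1 hf).2.1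
        have hg := (Finset.mem_filter.1 hg).2.1
        have h4 := (hEedges f hf X hXf).symm.trans (hEedges g hg X hXg)
        ext1 m
        by_cases hm : m = φ r
        · rw [hm, hf.1, hg.1]
        · have h5 : (m, f m) ∈ {e : WiredVertex W × WiredVertex W | e.1 ≠ φ r ∧ f e.1 = e.2} :=
            ⟨hm, rfl⟩
          rw [h4] at h5
          exact h5.2.symm
      · exact fun f _ => hEm f
    rw [h3, Finset.sum_mul]
    exact Finset.sum_congr rfl fun f hf => (hEC f (Finset.mem_filter.1 hf).2.1).symm
  have hden : ∑ᶠ T ∈ {T | (N.wired W).IsOrientedSpanningTree (φ r) T}, (N.wired W).weight T =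
      C := by
    have := hprob ∅ (by simp)
    simpa using this
  rw [wiredTreeProb, treeProb]
  change (∑ᶠ T ∈ {T : Finset (N.wired W).graph.Dart |
    (N.wired W).IsOrientedSpanningTree (φ r) T ∧
        T ∈ {T | ∀ d ∈ B, ∃ t ∈ T, t.toProd = (φ d.fst, φ d.snd)}}, (N.wired W).weight T) /
    (∑ᶠ T ∈ {T | (N.wired W).IsOrientedSpanningTree (φ r) T}, (N.wired W).weight T) = _
  rw [hprob B hB, hden, mul_div_cancel_right₀ _ hC0]

end ElectricalNetwork

/-! ### Laws of random subsets -/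

theorem isPiSystem_setOf_finset_subset (α : Type*) :
    IsPiSystem {s : Set (Set α) | ∃ B : Finset α, s = {H | (B : Set α) ⊆ H}} := by
  classical
  rintro _ ⟨B, rfl⟩ _ ⟨B', rfl⟩ -
  refine ⟨B ∪ B', ?_⟩
  ext H
  simp [Set.union_subset_iff]

theorem measurableSet_setOf_finset_subset {α : Type*} (B : Finset α) :
    MeasurableSet {H : Set α | (B : Set α) ⊆ H} := by
  have : {H : Set α | (B : Set α) ⊆ H} = ⋂ d ∈ B, {H | d ∈ H} := by
    ext H; simp [Set.subset_def]
  rw [this]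
  exact Finset.measurableSet_biInter _ fun d _ => measurableSet_mem d

theorem generateFrom_setOf_finset_subset (α : Type*) :
    (Set.instMeasurableSpace : MeasurableSpace (Set α)) =
      MeasurableSpace.generateFrom
        {s : Set (Set α) | ∃ B : Finset α, s = {H | (B : Set α) ⊆ H}} := by
  refine le_antisymm ?_ (MeasurableSpace.generateFrom_le ?_)
  · intro s hs
    have h : @Measurable (Set α) (Set α) (MeasurableSpace.generateFrom
        {s : Set (Set α) | ∃ B : Finset α, s = {H | (B : Set α) ⊆ H}}) _ id := by
      refine (@measurable_set_iff _ _ (MeasurableSpace.generateFrom _) _).2 fun d => ?_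
      refine (@measurableSet_setOfPred _ (MeasurableSpace.generateFrom _) _).1 ?_
      exact MeasurableSpace.measurableSet_generateFrom ⟨{d}, by simp⟩
    exact h hs
  · rintro _ ⟨B, rfl⟩
    exact measurableSet_setOf_finset_subset B

/-- A finite measure on the subsets of a set is determined by the probabilities that the random set
contains given finite sets. -/
theorem MeasureTheory.Measure.ext_of_finset_subset {α : Type*} {μ ν : Measure (Set α)}
    [IsProbabilityMeasure μ] [IsProbabilityMeasure ν]
    (h : ∀ B : Finset α, μ.real {H | (B : Set α) ⊆ H} = ν.real {H | (B : Set α) ⊆ H}) : μ = ν := by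
  refine ext_of_generate_finite _ (generateFrom_setOf_finset_subset α)
    (isPiSystem_setOf_finset_subset α) ?_ (by simp)
  rintro _ ⟨B, rfl⟩
  exact (measureReal_eq_measureReal_iff).1 (h B)

/-! ### Passage to the limit along an exhaustion -/

namespace ElectricalNetwork

variable {V : Type*} {N : ElectricalNetwork V}

theorem Exhaustion.eventually_mem (E : N.Exhaustion) (v : V) : ∀ᶠ n in atTop, v ∈ E.W n := by
  obtain ⟨n, hn⟩ := E.cover v
  filter_upwards [eventually_ge_atTop n] with m hm
  exact monotone_nat_of_le_succ (f := E.W) E.mono hm hn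

theorem exists_forall_mem_eq_or_lt {r : V} (ord : ℕ ≃ {v : V // v ≠ r}) (S : Finset V) (k : ℕ) :
    ∃ i ≥ k, ∀ v ∈ S, v = r ∨ ∃ j < i, (ord j : V) = v := by
  classical
  induction S using Finset.induction_on with
  | empty => exact ⟨k, le_rfl, by simp⟩
  | insert a S _ ih =>
    obtain ⟨i, hik, hi⟩ := ih
    by_cases ha : a = r
    · refine ⟨i, hik, fun v hv => ?_⟩
      rcases Finset.mem_insert.1 hv with rfl | hv
      exacts [Or.inl ha, hi v hv]
    · refine ⟨max i (ord.symm ⟨a, ha⟩ + 1), hik.trans (le_max_left _ _), fun v hv => ?_⟩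
      rcases Finset.mem_insert.1 hv with rfl | hv
      · exact Or.inr ⟨ord.symm ⟨v, ha⟩, by omega, by simp⟩
      · exact (hi v hv).imp_right fun ⟨j, hj, h⟩ => ⟨j, by omega, h⟩

variable [MeasurableSpace V] [DiscreteMeasurableSpace V]

theorem IsTransient.tendsto_wiredTreeProb (hN : N.IsTransient) {r : V}
    (ord : ℕ ≃ {v : V // v ≠ r}) (B : Finset N.graph.Dart) (E : N.Exhaustion) :
    Tendsto (fun n => N.wiredTreeProb (E.W n) r B) atTop
      (𝓝 ((N.wilsonLaw r ord).real {X | (B : Set N.graph.Dart) ⊆ N.wilsonForest X})) := by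
  classical
  have : Countable V := N.countable_vertices
  set μ := N.wilsonLaw r ord
  -- At stage `i` the walks from the tails of all edges of `B` have been used, so that the status of
  -- these edges is final.
  obtain ⟨i, -, hi⟩ := exists_forall_mem_eq_or_lt ord (B.image fun d => d.fst) 0
  have htail : ∀ K X, (∀ j, X j 0 = wilsonStart r ord j) → ∀ d ∈ B,
      d.fst ∈ (stoppedStage K X i).verts := by
    intro K X hst d hd
    rcases hi d.fst (Finset.mem_image_of_mem _ hd) with h | ⟨j, hj, h⟩
    · have h1 := stoppedStage_verts_mono K X (Nat.zero_le i) (start_mem_stoppedStage K X 0)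
      rw [hst] at h1
      rw [h]; exact h1
    · have h1 := stoppedStage_verts_mono K X (Nat.succ_le_of_lt hj)
        (start_mem_stoppedStage K X (j + 1))
      rw [hst] at h1
      rw [← h]; exact h1
  have hlater : ∀ K X, (∀ (j : ℕ) (v : V), {i | X j i = v}.Finite) →
      (∀ j, X j 0 = wilsonStart r ord j) → ∀ k ≥ i, ∀ d ∈ B,
      (d.toProd ∈ (stoppedStage K X k).edges ↔ d.toProd ∈ (stoppedStage K X i).edges) :=
    fun K X hX hst k hk d hd =>
      ⟨fun h => mem_edges_of_mem_later_stage (fun j S => FiniteVisits.of_forall (hX j) _) hk h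
        (htail K X hst d hd), fun h => stoppedStage_edges_mono K X hk h⟩
  have hfin := hN.wilsonLaw_ae_finite r ord
  have hst := wilsonLaw_ae_start (N := N) r ord
  have h1 : ∀ᶠ n in atTop, N.wiredTreeProb (E.W n) r B =
      μ.real {X | ∀ d ∈ B, d.toProd ∈ (stoppedStage (E.W n : Set V)ᶜ X i).edges} := by
    have hBW : ∀ᶠ n in atTop, ∀ d ∈ B, d.fst ∈ E.W n ∧ d.snd ∈ E.W n :=
      (Finset.eventually_all B).2 fun d _ => (E.eventually_mem d.fst).and (E.eventually_mem d.snd)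
    filter_upwards [E.eventually_mem r, hBW] with n hr hBn
    -- The full tree of the wired network takes a number `k` of stages that depends on `n`; `hlater`
    -- brings the event back to the fixed stage `i`.
    obtain ⟨k, hk, hcov⟩ := exists_forall_mem_eq_or_lt ord (E.W n) i
    rw [hN.wiredTreeProb_eq hr ord B hBn hcov]
    refine measureReal_congr ?_
    filter_upwards [hfin, hst] with X hX hX0
    exact propext (forall₂_congr fun d hd => hlater _ X hX hX0 k hk d hd)
  have h2 : μ.real {X | (B : Set N.graph.Dart) ⊆ N.wilsonForest X} =
      μ.real {X | ∀ d ∈ B, d.toProd ∈ (wilsonStage X i).edges} := by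
    refine measureReal_congr ?_
    filter_upwards [hfin, hst] with X hX hX0
    refine propext (forall₂_congr fun d hd => ⟨?_, fun h => ⟨i, h⟩⟩)
    rintro ⟨k, hk⟩
    rw [← stoppedStage_empty] at hk ⊢
    exact (hlater ∅ X hX hX0 (max i k) (le_max_left _ _) d hd).1
      (stoppedStage_edges_mono ∅ X (le_max_right i k) hk)
  have hmeas : ∀ K, MeasurableSet
      {X : ℕ → ℕ → V | ∀ d ∈ B, d.toProd ∈ (stoppedStage K X i).edges} := by
    intro K
    have : {X : ℕ → ℕ → V | ∀ d ∈ B, d.toProd ∈ (stoppedStage K X i).edges} =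
        ⋂ d ∈ B, {X | d.toProd ∈ (stoppedStage K X i).edges} := by
      ext X; simp
    rw [this]
    exact Finset.measurableSet_biInter _ fun d _ => measurableSet_setOfPred.2 <|
      (measurable_mem_stoppedStage K measurable_walks_eq i).2 d.toProd
  rw [h2, tendsto_congr' h1]
  refine (ENNReal.tendsto_toReal (measure_ne_top _ _)).comp ?_
  -- Bounded convergence: almost surely the indicators of the stopped events are eventually equal to
  -- that of the limit event.
  refine tendsto_measure_of_ae_tendsto_indicator_of_isFiniteMeasure atTop ?_
    (fun n => hmeas (E.W n : Set V)ᶜ) ?_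
  · simpa only [stoppedStage_empty] using hmeas ∅
  · filter_upwards [hfin] with X hX
    have h3 := (eventually_stoppedStage_iff (l := atTop) (K := fun n => (E.W n : Set V)ᶜ)
      (fun v => (E.eventually_mem v).mono fun n hn => by simpa using hn) hX i).2
    have h4 : ∀ᶠ n in atTop, ∀ d ∈ B, (d.toProd ∈ (stoppedStage (E.W n : Set V)ᶜ X i).edges ↔
        d.toProd ∈ (wilsonStage X i).edges) :=
      (Finset.eventually_all B).2 fun d _ => h3 d.toProd
    filter_upwards [h4] with n hn
    exact forall₂_congr hn

/-- Provides an ordering with which the existence of the forest measure is proved. -/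
theorem IsTransient.exists_equiv (hN : N.IsTransient) (r : V) :
    Nonempty (ℕ ≃ {v : V // v ≠ r}) := by
  have := hN.infinite
  have : Countable V := N.countable_vertices
  have : Infinite {v : V // v ≠ r} := (Set.infinite_of_finite_compl (s := {v | v ≠ r})
    (by simp [Set.compl_def])).to_subtype
  obtain ⟨h⟩ := nonempty_denumerable {v : V // v ≠ r}
  exact ⟨(Denumerable.eqv _).symm⟩

end ElectricalNetwork

theorem mainTheorem5 {V : Type*} [MeasurableSpace V] [DiscreteMeasurableSpace V]
    (N : ElectricalNetwork V) (hN : N.IsTransient) (r : V) :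
    (∀ ord : ℕ ≃ {v : V // v ≠ r},
      (∀ᵐ X ∂(N.wilsonLaw r ord), ∀ (j : ℕ) (v : V), {i | X j i = v}.Finite) ∧
      Measurable N.wilsonForest ∧
      ∀ (B : Finset N.graph.Dart) (E : N.Exhaustion),
        Tendsto (fun n => N.wiredTreeProb (E.W n) r B) atTop
          (𝓝 ((N.wilsonLaw r ord).real {X | (B : Set N.graph.Dart) ⊆ N.wilsonForest X}))) ∧
    ∃! μ : Measure (Set N.graph.Dart), N.IsOrientedWSF r μ := by
  refine ⟨fun ord => ⟨hN.wilsonLaw_ae_finite r ord, N.measurable_wilsonForest,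
    hN.tendsto_wiredTreeProb ord⟩, ?_⟩
  obtain ⟨ord⟩ := hN.exists_equiv r
  refine ⟨(N.wilsonLaw r ord).map N.wilsonForest, ⟨?_, fun E B => ?_⟩, ?_⟩
  · exact Measure.isProbabilityMeasure_map N.measurable_wilsonForest.aemeasurable
  · rw [measureReal_def, Measure.map_apply N.measurable_wilsonForest
      (measurableSet_setOf_finset_subset B)]
    exact hN.tendsto_wiredTreeProb ord B E
  · rintro ν ⟨hν, hν'⟩
    have : IsProbabilityMeasure ((N.wilsonLaw r ord).map N.wilsonForest) :=
      Measure.isProbabilityMeasure_map N.measurable_wilsonForest.aemeasurable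
    refine Measure.ext_of_finset_subset fun B => ?_
    -- The defining property speaks of all exhaustions; the balls show that there is one, which
    -- makes the limits determine the measure.
    refine tendsto_nhds_unique (hν' (N.ballExhaustion r) B) ?_
    rw [measureReal_def, Measure.map_apply N.measurable_wilsonForest
      (measurableSet_setOf_finset_subset B)]
    exact hN.tendsto_wiredTreeProb ord B (N.ballExhaustion r)
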